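/- For $\lambda,\beta\in(-1,1)$ let $Z_{\lambda,\beta}=(X_\lambda,Y_\beta)$ be the non-smooth vector field on $\mathbb R^2$ with $X_\lambda(x,y)=(1,\,x-\lambda)$ on $\Sigma_+=\{y\ge 0\}$ and $Y_\beta(x,y)=(-(y+\beta),\,-x)$ on $\Sigma_-=\{y\le 0\}$. (This is the slice $\mu=0$ of the visible family with $X_\lambda$ as above and $Y_{\mu,\beta}=\big(\tfrac{\mu}{2}x+\tfrac{\mu-2}{2}(y+\beta),\ \tfrac{\mu-2}{2}x+\tfrac{\mu}{2}(y+\beta)\big)$.) Let $\Sigma=\{y=0\}$, $f(x,y)=y$; on $\Sigma$ let $\Sigma_1=\{(X.f)(Y.f)>0\}$ (sewing), $\Sigma_2=\{X.f>0>Y.f\}$ (escaping), $\Sigma_3=\{X.f<0<Y.f\}$ (sliding), and let $Z^\Sigma=\frac{(Y.f)X-(X.f)Y}{Y.f-X.f}$ be the sliding (escaping) vector field on $\Sigma_2\cup\Sigma_3$. A pseudo-equilibrium is a zero of $Z^\Sigma$ in $\Sigma_2\cup\Sigma_3$; it is a $\Sigma$-repeller if it lies in $\Sigma_2$ and repels,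 and a $\Sigma$-attractor if it lies in $\Sigma_3$ and attracts, the orbits of $Z^\Sigma$. A tangential singularity is a point of $\Sigma$ with $(X.f)(Y.f)=0$ at which $X$ and $Y$ do not vanish. Homeomorphisms of $\mathbb R^2$ below preserve $\Sigma_+$ and $\Sigma_-$, and "equivalent" means that the homeomorphism carries oriented orbits to oriented orbits; for $Z^\Sigma$ it must also carry each $\Sigma_i$ to $\Sigma_i$. Two members of the family have * the same *typical configuration* if one homeomorphism makes both $X|_{\Sigma_+}$ and $Y|_{\Sigma_-}$ equivalent to their counterparts, and the two fields $Z^\Sigma$ are equivalent; * the same *topological behaviour* if $X|_{\Sigma_+}$, $Y|_{\Sigma_-}$ and $Z^\Sigma$ are equivalent to their counterparts, each by a homeomorphism of its own. A *closed path* of $Z$ is a closed curve made of finitely many nonconstant, positively oriented, injectively traversed orbit pieces (arcs) of $X$ in $\Sigma_+$, of $Y$ in $\Sigma_-$ and of $Z^\Sigma$ in $\Sigma_2\cup\Sigma_3$. A passage between consecutive arcs is *admissible* if it takes place between $X$ and $Y$ at a point of $\Sigma_1$; between $X$ or $Y$ and $Z^\Sigma$ at a $\Sigma$-fold point (of $X$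 or $Y$) or at a point of $\Sigma_2\cup\Sigma_3$ with $Z^\Sigma\ne0$; or between arcs of the same field at a point where that field is defined and nonzero. A *canard cycle* is a closed path $\Gamma$ with only admissible passages that contains arcs of at least two of $X,Y,Z^\Sigma$ or is a single arc of $Z^\Sigma$, and such that, if $\Gamma\neq\Sigma$, each connected component of $\Gamma\cap\Sigma$ that meets $\Sigma_2\cup\Sigma_3$ contains a visible $\Sigma$-fold point. A *$\Sigma$-graph* is a closed path $\Delta$ meeting $\Sigma$, each of whose passages is admissible or takes place at an equilibrium of $X$ in $\Sigma_+$ or of $Y$ in $\Sigma_-$, a pseudo-equilibrium or a tangential singularity, at least one of them at such a point. It is of *kind III* if $\Delta\cap\Sigma\subsetneq\overline{\Sigma_2\cup\Sigma_3}$. **Theorem.** 1. The $(\lambda,\beta)$-square $(-1,1)^2$ contains exactly 13 typical configurations. They are the cells: (1)–(3) $\beta<0$ with $\lambda<0$, $\lambda=0$, $\lambda>0$; (4)–(6) $\beta=0$ with $\lambda<0$, $\lambda=0$, $\lambda>0$; (7)–(13) $\beta>0$ with $\lambda<-\beta$, $\lambda=-\beta$, $-\beta<\lambda<0$, $\lambda=0$,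 $0<\lambda<\beta$, $\lambda=\beta$, $\lambda>\beta$. Each cell meets every neighbourhood of the origin. For $|\lambda|,|\beta|<\frac12$ the cells are also the classes of topological equivalence by one homeomorphism that serves $X$, $Y$ and $Z^\Sigma$ simultaneously; every square $(-\varepsilon,\varepsilon)^2$ with $0<\varepsilon\le\frac12$ contains exactly 13 such classes. 2. On $(-1,1)^2$ there are exactly 7 topological behaviours: $\{1,3\},\{2\},\{4,6\},\{5\},\{7,8,9\},\{10\},\{11,12,13\}$. 3. For all $\lambda,\beta\in(-1,1)$: $d=(\lambda,0)$ is the only $\Sigma$-fold point of $X$ and is visible. The origin is the only $\Sigma$-fold point of $Y$ if $\beta\neq0$, visible if $\beta<0$ and invisible if $\beta>0$; if $\beta=0$, then $Y$ has no $\Sigma$-fold point and vanishes at the origin. On $\Sigma$, $\Sigma_1$ is the open interval between $0$ and $\lambda$, $\Sigma_3=\{x<\min(\lambda,0)\}$ and $\Sigma_2=\{x>\max(\lambda,0)\}$. If $\beta\le0$ then $Z^\Sigma$ points to the right. If $\lambda=0$ then $Z^\Sigma\equiv((1-\beta)/2,0)$. If $\beta>0$ and $\lambda<0$ (resp. $\lambda>0$),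 $Z^\Sigma$ points to the right on $\Sigma_3$ (resp. $\Sigma_2$) and to the left at the points of $\Sigma_2$ (resp. $\Sigma_3$) near the origin. 4. There are no canard cycles. 5. If $\beta\le0$ or $\lambda=0$ there is no pseudo-equilibrium. If $\beta>0$ and $\lambda\ne0$, then $P=(\beta\lambda/(-1+\beta),0)$ is the unique pseudo-equilibrium; it is a $\Sigma$-repeller if $\lambda<0$ and a $\Sigma$-attractor if $\lambda>0$. 6. If $\beta>0$ and $\lambda=0$ (so that $d$ coincides with the invisible fold point $i=(0,0)$ of $Y$), then $d=i$ is a tangential singularity, and the boundary $\Delta$ of the triangle with vertices $h=(-\beta,0)$, $j=(\beta,0)$ and $S=(0,-\beta)$ (the saddle of $Y$) is a $\Sigma$-graph of kind III. Every point in the interior of the triangle lies on another $\Sigma$-graph of kind III passing through $d$. -/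

import Mathlib

open Set Filter Topology

namespace FoldSaddle

/-- Points of the phase plane. The switching function is `f (x, y) = y`. -/
abbrev Pt := ℝ × ℝ

/-- The switching line `Σ = {f = 0}`. -/
def switching : Set Pt := {p | p.2 = 0}

/-- The closed half-plane `Σ₊ = {f ≥ 0}`. -/
def upper : Set Pt := {p | 0 ≤ p.2}

/-- The closed half-plane `Σ₋ = {f ≤ 0}`. -/
def lower : Set Pt := {p | p.2 ≤ 0}

/-- A non-smooth vector field `Z = (X, Y)`: `X` acts on `Σ₊` and `Y` acts on `Σ₋`. -/
@[ext]
structure NSField where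
  X : Pt → Pt
  Y : Pt → Pt

/-- The derivative `V.g` of a function `g` along the vector field `V`. -/
noncomputable def lie (V : Pt → Pt) (g : Pt → ℝ) : Pt → ℝ := fun p => fderiv ℝ g p (V p)

/-- `V.f` for the switching function `f (x, y) = y`. -/
noncomputable def lieF (V : Pt → Pt) : Pt → ℝ := lie V Prod.snd

namespace NSField

variable (Z : NSField)

/-- The sewing region `Σ₁`. -/
def sewing : Set Pt := {p | p ∈ switching ∧ 0 < lieF Z.X p * lieF Z.Y p}

/-- The escaping region `Σ₂`. -/
def escaping : Set Pt := {p | p ∈ switching ∧ 0 < lieF Z.X p ∧ lieF Z.Y p < 0}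

/-- The sliding region `Σ₃`. -/
def sliding : Set Pt := {p | p ∈ switching ∧ lieF Z.X p < 0 ∧ 0 < lieF Z.Y p}

/-- The domain `Σ₂ ∪ Σ₃` of `Z^Σ`. -/
def slidingDomain : Set Pt := Z.escaping ∪ Z.sliding

/-- The sliding (escaping) vector field `Z^Σ` given by Filippov's convention: `q + Z^Σ q` is the
point where the segment from `q + X q` to `q + Y q` meets `Σ`. It is used on `Σ₂ ∪ Σ₃` only,
where the denominator does not vanish. -/
noncomputable def slide (q : Pt) : Pt :=
  (lieF Z.Y q - lieF Z.X q)⁻¹ • (lieF Z.Y q • Z.X q - lieF Z.X q • Z.Y q)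

/-- Pseudo-equilibria: zeros of `Z^Σ`. -/
def IsPseudoEquilibrium (q : Pt) : Prop := q ∈ Z.slidingDomain ∧ Z.slide q = 0

/-- Points of `Σ₂ ∪ Σ₃` which are `Σ`-regular. -/
def IsRegularSliding (q : Pt) : Prop := q ∈ Z.slidingDomain ∧ Z.slide q ≠ 0

/-- Tangential singularities: contact points of `X` or `Y` with `Σ` at which neither
vector field vanishes. -/
def IsTangential (q : Pt) : Prop :=
  q ∈ switching ∧ lieF Z.X q * lieF Z.Y q = 0 ∧ Z.X q ≠ 0 ∧ Z.Y q ≠ 0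

/-- Equilibria of `X` in `Σ₊` and of `Y` in `Σ₋`. -/
def IsEquilibrium (q : Pt) : Prop := (q ∈ upper ∧ Z.X q = 0) ∨ (q ∈ lower ∧ Z.Y q = 0)

end NSField

/-- `Σ`-fold points of a vector field. -/
def IsFold (V : Pt → Pt) (q : Pt) : Prop :=
  q ∈ switching ∧ lieF V q = 0 ∧ lie V (lieF V) q ≠ 0

/-- Visible `Σ`-fold points of a vector field acting on `Σ₊`. -/
def IsVisibleFoldUpper (V : Pt → Pt) (q : Pt) : Prop :=
  q ∈ switching ∧ lieF V q = 0 ∧ 0 < lie V (lieF V) q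

/-- Visible `Σ`-fold points of a vector field acting on `Σ₋`. -/
def IsVisibleFoldLower (V : Pt → Pt) (q : Pt) : Prop :=
  q ∈ switching ∧ lieF V q = 0 ∧ lie V (lieF V) q < 0

/-- `Reach V D p q`: some trajectory of `V` runs inside `D` from `p` to `q` in finite
non-negative time. -/
def Reach (V : Pt → Pt) (D : Set Pt) (p q : Pt) : Prop :=
  ∃ T : ℝ, 0 ≤ T ∧ ∃ γ : ℝ → Pt, γ 0 = p ∧ γ T = q ∧
    ∀ t ∈ Icc 0 T, γ t ∈ D ∧ HasDerivWithinAt γ (V (γ t)) (Icc 0 T) t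

/-- The point `q` attracts the trajectories of `V` in `D` that start near `q`. -/
def IsAttractorFor (V : Pt → Pt) (D : Set Pt) (q : Pt) : Prop :=
  ∃ U ∈ 𝓝 q, ∀ p ∈ U ∩ D, ∃ γ : ℝ → Pt, γ 0 = p ∧
    (∀ t ∈ Ici (0 : ℝ), γ t ∈ D ∧ HasDerivWithinAt γ (V (γ t)) (Ici 0) t) ∧
    Tendsto γ atTop (𝓝 q)

/-- `Σ`-attractors: pseudo-equilibria in `Σ₃` which attract the trajectories of `Z^Σ`. -/
def IsSigmaAttractor (Z : NSField) (q : Pt) : Prop :=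
  Z.IsPseudoEquilibrium q ∧ q ∈ Z.sliding ∧ IsAttractorFor Z.slide Z.slidingDomain q

/-- `Σ`-repellers: pseudo-equilibria in `Σ₂` which attract the trajectories of `-Z^Σ`. -/
def IsSigmaRepeller (Z : NSField) (q : Pt) : Prop :=
  Z.IsPseudoEquilibrium q ∧ q ∈ Z.escaping ∧
    IsAttractorFor (fun p => -Z.slide p) Z.slidingDomain q

/-! ### Closed paths made of arcs of `X`, `Y` and `Z^Σ` -/

/-- The three kinds of arcs: arcs of `X` in `Σ₊`, of `Y` in `Σ₋`, of `Z^Σ` in `Σ₂ ∪ Σ₃`. -/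
inductive ArcKind
  | up
  | down
  | slide

/-- The vector field that belongs to a kind of arcs. -/
noncomputable def ArcKind.field (Z : NSField) : ArcKind → Pt → Pt
  | .up => Z.X
  | .down => Z.Y
  | .slide => Z.slide

/-- The domain in which arcs of a kind run. -/
def ArcKind.domain (Z : NSField) : ArcKind → Set Pt
  | .up => upper
  | .down => lower
  | .slide => Z.slidingDomain

/-- A closed path `c : [0, 1] → ℝ²` cut at `0 = t₀ < t₁ < ⋯ < tₙ₊₁ = 1` into `n + 1` arcs, each of
which is a piece of a non-constant orbit of `X`, `Y` or `Z^Σ` run in the positive direction. -/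
structure ClosedPath (Z : NSField) where
  n : ℕ
  t : Fin (n + 2) → ℝ
  kind : Fin (n + 1) → ArcKind
  c : ℝ → Pt
  t_strictMono : StrictMono t
  t_zero : t 0 = 0
  t_last : t (Fin.last (n + 1)) = 1
  continuousOn : ContinuousOn c (Icc 0 1)
  closed : c 0 = c 1
  arc_injOn : ∀ i : Fin (n + 1), InjOn c (Ioo (t i.castSucc) (t i.succ))
  arc_orbit : ∀ i : Fin (n + 1), ∀ r ∈ Ioo (t i.castSucc) (t i.succ),
    ∀ s ∈ Ioo (t i.castSucc) (t i.succ), r ≤ s →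
      Reach ((kind i).field Z) ((kind i).domain Z) (c r) (c s)

/-- The set of points of a closed path. -/
def ClosedPath.carrier {Z : NSField} (P : ClosedPath Z) : Set Pt := P.c '' Icc 0 1

/-- The initial point of the `i`-th arc; the arc before it is the one with cyclic index `i - 1`. -/
def ClosedPath.junction {Z : NSField} (P : ClosedPath Z) (i : Fin (P.n + 1)) : Pt :=
  P.c (P.t i.castSucc)

/-- The rule for passing at `q` from an arc of one kind to an arc of another kind: between `X` and
`Y` at sewing points, between `X` or `Y` and `Z^Σ` at fold points or at regular points of
`Σ₂ ∪ Σ₃`. If the kind does not change, `q` has to be a regular point of the vector field that is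
followed, so that the two arcs form one arc. -/
def MayPass (Z : NSField) (q : Pt) : ArcKind → ArcKind → Prop
  | .up, .up => q ∈ upper ∧ Z.X q ≠ 0
  | .down, .down => q ∈ lower ∧ Z.Y q ≠ 0
  | .slide, .slide => Z.IsRegularSliding q
  | .up, .down | .down, .up => q ∈ Z.sewing
  | .up, .slide | .slide, .up | .down, .slide | .slide, .down =>
      IsFold Z.X q ∨ IsFold Z.Y q ∨ Z.IsRegularSliding q

/-- Canard cycles. The last clause asks for a visible fold point on every connected component of
`Γ ∩ Σ` that contains sliding or escaping points. -/
def IsCanardCycle (Z : NSField) (Γ : Set Pt) : Prop :=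
  ∃ P : ClosedPath Z, P.carrier = Γ ∧
    ((∃ i j, P.kind i ≠ P.kind j) ∨ (P.n = 0 ∧ ∀ i, P.kind i = ArcKind.slide)) ∧
    (∀ i, MayPass Z (P.junction i) (P.kind (i - 1)) (P.kind i)) ∧
    (Γ ≠ switching → ∀ q ∈ Γ ∩ Z.slidingDomain, ∃ r ∈ connectedComponentIn (Γ ∩ switching) q,
      IsVisibleFoldUpper Z.X r ∨ IsVisibleFoldLower Z.Y r)

/-- The points that a `Σ`-graph joins. -/
def IsVertex (Z : NSField) (q : Pt) : Prop :=
  Z.IsEquilibrium q ∨ Z.IsPseudoEquilibrium q ∨ Z.IsTangential q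

/-- `Σ`-graphs: closed paths that meet `Σ` and consist of equilibria, pseudo-equilibria, tangential
singularities (at least one such point) and arcs of `Z` joining them. -/
def IsSigmaGraph (Z : NSField) (Δ : Set Pt) : Prop :=
  (∃ P : ClosedPath Z, P.carrier = Δ ∧ (∃ i, IsVertex Z (P.junction i)) ∧
    ∀ i, IsVertex Z (P.junction i) ∨ MayPass Z (P.junction i) (P.kind (i - 1)) (P.kind i)) ∧
  (Δ ∩ switching).Nonempty

/-- `Σ`-graphs of kind III. The closure adds the tangency points that bound `Σ₂` and `Σ₃`. -/
def IsSigmaGraphIII (Z : NSField) (Δ : Set Pt) : Prop :=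
  IsSigmaGraph Z Δ ∧ Δ ∩ switching ⊂ closure (Z.escaping ∪ Z.sliding)

/-! ### Comparison of phase portraits -/

/-- `h` carries `Σ₊` to `Σ₊` and `Σ₋` to `Σ₋` (hence `Σ` to `Σ`). -/
def PreservesSides (h : Pt ≃ₜ Pt) : Prop := h '' upper = upper ∧ h '' lower = lower

/-- `h` carries the oriented orbits of `V` in `D` to those of `V'` in `D'`. Since `Reach V D p p`
means `p ∈ D`, it carries `D` to `D'`. -/
def CarriesOrbits (h : Pt ≃ₜ Pt) (V : Pt → Pt) (D : Set Pt) (V' : Pt → Pt) (D' : Set Pt) : Prop :=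
  ∀ p q, Reach V D p q ↔ Reach V' D' (h p) (h q)

/-- `h` carries the oriented orbits of `X` in `Σ₊` to those of `X'`. -/
def CarriesUpper (h : Pt ≃ₜ Pt) (Z W : NSField) : Prop :=
  PreservesSides h ∧ CarriesOrbits h Z.X upper W.X upper

/-- `h` carries the oriented orbits of `Y` in `Σ₋` to those of `Y'`. -/
def CarriesLower (h : Pt ≃ₜ Pt) (Z W : NSField) : Prop :=
  PreservesSides h ∧ CarriesOrbits h Z.Y lower W.Y lower

/-- `h` carries `Σ₁`, `Σ₂`, `Σ₃` and the oriented orbits of `Z^Σ` to those of `W`. -/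
def CarriesSliding (h : Pt ≃ₜ Pt) (Z W : NSField) : Prop :=
  PreservesSides h ∧ h '' Z.sewing = W.sewing ∧ h '' Z.escaping = W.escaping ∧
    h '' Z.sliding = W.sliding ∧
    CarriesOrbits h Z.slide Z.slidingDomain W.slide W.slidingDomain

/-- Same topological behaviour: the phase portraits of `X` on `Σ₊`, of `Y` on `Σ₋` and of
`Z^Σ` on `Σ` are equivalent, each by a homeomorphism of its own. -/
def SameBehaviour (Z W : NSField) : Prop :=
  (∃ h, CarriesUpper h Z W) ∧ (∃ h, CarriesLower h Z W) ∧ (∃ h, CarriesSliding h Z W)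

/-- Same typical configuration: one homeomorphism carries the orbits of `X` and of `Y`, so that it
respects how they are joined along `Σ`, and the phase portraits of `Z^Σ` on `Σ` are equivalent. -/
def SameConfiguration (Z W : NSField) : Prop :=
  (∃ h, CarriesUpper h Z W ∧ CarriesLower h Z W) ∧ (∃ h, CarriesSliding h Z W)

/-- Topological equivalence of non-smooth vector fields: one homeomorphism carries the orbits of
`X`, of `Y` and of `Z^Σ`. -/
def TopEquivalent (Z W : NSField) : Prop :=
  ∃ h, CarriesUpper h Z W ∧ CarriesLower h Z W ∧ CarriesSliding h Z W

/-! ### The family -/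

/-- The type `τ` of the fold point of `X`. -/
inductive FoldType
  | invisible
  | visible

/-- The sign `α₁(τ)`. -/
def FoldType.sign : FoldType → ℝ
  | .invisible => -1
  | .visible => 1

/-- The three-parameter family with parameters `l` (for `λ`), `μ`, `β`. -/
noncomputable def unfolding (τ : FoldType) (l μ β : ℝ) : NSField where
  X := fun p => (1, τ.sign * (p.1 - l))
  Y := fun p => (μ / 2 * p.1 + (μ - 2) / 2 * (p.2 + β), (μ - 2) / 2 * p.1 + μ / 2 * (p.2 + β))

/-- The two-parameter family with parameters `l` (for `λ`) and `β`. -/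
def family (τ : FoldType) (l β : ℝ) : NSField where
  X := fun p => (1, τ.sign * (p.1 - l))
  Y := fun p => (-(p.2 + β), -p.1)

/-- The member of the visible family with parameters `p = (λ, β)`. -/
def Zv (p : ℝ × ℝ) : NSField := family .visible p.1 p.2

/-- The square `(-ε, ε) × (-ε, ε)` in the `(λ, β)`-plane. -/
def square (ε : ℝ) : Set (ℝ × ℝ) := Ioo (-ε) ε ×ˢ Ioo (-ε) ε

/-- The thirteen cells of the `(λ, β)`-plane, called cell 1, …, cell 13 (the index is the
number of the cell minus one). They compare the position `d = λ` of the fold point of `X` with the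
contact point `0` of `Y` (a visible fold `e` for `β < 0`, the saddle `S` for `β = 0`, an
invisible fold `i` for `β > 0`) and, for `β > 0`, with the points `h = -β` and `j = β` where the
unstable and the stable separatrix of the saddle `S = (0, -β)` of `Y` meet `Σ`. -/
def cell : Fin 13 → Set (ℝ × ℝ) :=
  ![{p | p.2 < 0 ∧ p.1 < 0},
    {p | p.2 < 0 ∧ p.1 = 0},
    {p | p.2 < 0 ∧ 0 < p.1},
    {p | p.2 = 0 ∧ p.1 < 0},
    {p | p.2 = 0 ∧ p.1 = 0},
    {p | p.2 = 0 ∧ 0 < p.1},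
    {p | 0 < p.2 ∧ p.1 < -p.2},
    {p | 0 < p.2 ∧ p.1 = -p.2},
    {p | 0 < p.2 ∧ -p.2 < p.1 ∧ p.1 < 0},
    {p | 0 < p.2 ∧ p.1 = 0},
    {p | 0 < p.2 ∧ 0 < p.1 ∧ p.1 < p.2},
    {p | 0 < p.2 ∧ p.1 = p.2},
    {p | 0 < p.2 ∧ p.2 < p.1}]

/-- The distribution of the thirteen cells over seven topological behaviours, which are represented
by the cells 1, 2, 4, 5, 7, 10, 11. -/
def behaviour : Fin 13 → Fin 7 := ![0, 1, 0, 2, 3, 2, 4, 4, 4, 5, 6, 6, 6]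

/-- The classes into which a relation between members of the visible family divides a set of
parameters. -/
def classes (R : NSField → NSField → Prop) (A : Set (ℝ × ℝ)) : Set (Set (ℝ × ℝ)) :=
  {C | ∃ p ∈ A, C = {q | q ∈ A ∧ R (Zv p) (Zv q)}}

/-- The closed curve `{d} ∪ dj ∪ σ₂ ∪ {S} ∪ σ₁ ∪ hd` with `d = (0, 0)`, `j = (β, 0)`,
`S = (0, -β)`, `h = (-β, 0)`; the separatrix arcs `σ₂` and `σ₁` are straight. -/
def separatrixGraph (β : ℝ) : Set Pt :=
  segment ℝ (-β, 0) (β, 0) ∪ segment ℝ (β, 0) (0, -β) ∪ segment ℝ (0, -β) (-β, 0)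

/-- The open region bounded by `separatrixGraph β`. -/
def separatrixInterior (β : ℝ) : Set Pt := {p | p.2 < 0 ∧ |p.1| < p.2 + β}

end FoldSaddle

open FoldSaddle

namespace FoldSaddle

/-! All three fields can be integrated. The orbits of `X` lie on the parabolas `intX l = A`. `Y` is
a linear saddle, diagonal in `u = x + (y + β)` and `v = x - (y + β)`. On `Σ₂ ∪ Σ₃` the field `Z^Σ`
is a multiple of `x - P`, where `P = pseudo l β`, with a factor positive on `Σ₂` and negative on
`Σ₃`. Reachability therefore becomes a matter of order and sign: `reach_X_iff`,
`reach_Y_iff_of_nonneg`, `reach_Y_iff_of_neg`, `reach_slide_iff`.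

Equivalences are built from an increasing bijection `φ` of `Σ`. An arc of `X` never joins two points
of `Σ`, so the upper half-plane only asks for `φ l = l'`. For `β > 0` the arcs of `Y` join `(x, 0)`
to `(-x, 0)` when `0 < x < β`, and the separatrices meet `Σ` at `±β`; an odd `φ` with `φ β = β'`
respects this. Such a `φ` extends to the plane by bending level curves to level curves
(`exists_conjData`, `ConjData.reach_X`, `ConjData.reach_Y`). `Z^Σ` only asks that the sewing
interval and the sides of `P` correspond (`carriesSliding_of_boundary`). If `|λ|` and `β` are below
`1/2`, then `|P| < min |λ| β`, so the cell fixes the order of the marked points and one odd `φ`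
serves all three fields. For larger parameters `|P|` may fall elsewhere, and `Z^Σ` gets a
homeomorphism of its own.

Conversely, the cell can be read from the phase portraits. The saddle is outside `Σ₋`, on `Σ` or
below `Σ` according to the sign of `β`, and it is found as a stationary point. The fold `d` is the
only point of `Σ` that trajectories of `X` both leave and reach. Whether `Y` can leave or reach `d`
gives the sign of `λ`. The interval of `Σ` from which, or to which, `Y` jumps has `±β` as an end,
which compares `|λ|` with `β` (`sameOrder_of_carries`). For the coarser behaviours, `Z^Σ` shows
whether `λ = 0` and, if `β > 0`, on which side the pseudo-equilibrium lies.

Canard cycles fail by monotonicity. For `β ≤ 0` the abscissa increases along every arc. For `β > 0`,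
an arc of `X` that starts on `Σ` never comes back; an arc of `Y` that ends on `Σ` ends at `x < 0`,
where only sliding arcs can follow, and these cannot pass `min λ 0`. For `λ = 0 < β` the sliding
field points right, and an arc of `Y` from `(a, 0)` back to `(-a, 0)` closes a loop through `d`; `a
= β` gives the triangle, which passes through the saddle. -/

lemma Zv_X (l β : ℝ) (q : Pt) : (Zv (l, β)).X q = (1, q.1 - l) := by
  simp [Zv, family, FoldType.sign]

lemma Zv_Y (l β : ℝ) (q : Pt) : (Zv (l, β)).Y q = (-(q.2 + β), -q.1) := rfl

/-! ### Trajectories of the fold field and of the saddle in their half-planes -/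

lemma eq_of_hasDerivWithinAt_zero {f : ℝ → ℝ} {T : ℝ}
    (h : ∀ t ∈ Icc 0 T, HasDerivWithinAt f 0 (Icc 0 T) t) {t : ℝ} (ht : t ∈ Icc 0 T) :
    f t = f 0 := by
  refine constant_of_has_deriv_right_zero (fun t ht => (h t ht).continuousWithinAt) ?_ t ht
  intro x hx
  exact (h x ⟨hx.1, hx.2.le⟩).mono_of_mem_nhdsWithin (Icc_mem_nhdsGE_of_mem hx)

lemma HasDerivWithinAt.pt_fst {γ : ℝ → Pt} {v : Pt} {s : Set ℝ} {t : ℝ}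
    (h : HasDerivWithinAt γ v s t) : HasDerivWithinAt (fun r => (γ r).1) v.1 s t :=
  (hasFDerivAt_fst (𝕜 := ℝ) (p := γ t)).comp_hasDerivWithinAt t h

lemma HasDerivWithinAt.pt_snd {γ : ℝ → Pt} {v : Pt} {s : Set ℝ} {t : ℝ}
    (h : HasDerivWithinAt γ v s t) : HasDerivWithinAt (fun r => (γ r).2) v.2 s t :=
  (hasFDerivAt_snd (𝕜 := ℝ) (p := γ t)).comp_hasDerivWithinAt t h

lemma Reach.mem_left {V : Pt → Pt} {D : Set Pt} {p q : Pt} (h : Reach V D p q) : p ∈ D := by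
  obtain ⟨T, hT, γ, h0, -, h⟩ := h
  exact h0 ▸ (h 0 ⟨le_rfl, hT⟩).1

lemma Reach.mem_right {V : Pt → Pt} {D : Set Pt} {p q : Pt} (h : Reach V D p q) : q ∈ D := by
  obtain ⟨T, hT, γ, -, h0, h⟩ := h
  exact h0 ▸ (h T ⟨hT, le_rfl⟩).1

lemma Reach.refl {V : Pt → Pt} {D : Set Pt} {p : Pt} (h : p ∈ D) : Reach V D p p :=
  ⟨0, le_rfl, fun t => p + t • V p, by simp, by simp, fun t ht => by
    obtain rfl : t = 0 := by simpa using ht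
    refine ⟨by simpa using h, ?_⟩
    simpa using (((hasDerivAt_id (0 : ℝ)).smul_const (V p)).const_add p).hasDerivWithinAt⟩

/-- The time-`t` map of the fold field `X`. -/
lemma reach_X_iff_flow {l β : ℝ} {p q : Pt} : Reach (Zv (l, β)).X upper p q ↔
    ∃ T, 0 ≤ T ∧ q = (p.1 + T, p.2 + (p.1 - l) * T + T ^ 2 / 2) ∧
      ∀ t ∈ Icc 0 T, 0 ≤ p.2 + (p.1 - l) * t + t ^ 2 / 2 := by
  constructor
  · rintro ⟨T, hT, γ, h0, h1, h⟩
    have e1 : ∀ t ∈ Icc 0 T, (γ t).1 = p.1 + t := by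
      intro t ht
      have := eq_of_hasDerivWithinAt_zero (f := fun t => (γ t).1 - t) (T := T) (fun t ht => by
        have h1 := HasDerivWithinAt.pt_fst (h t ht).2
        refine (h1.fun_sub (hasDerivWithinAt_id t _)).congr_deriv ?_
        rw [Zv_X]; simp) ht
      simp only [h0] at this
      linarith
    have e2 : ∀ t ∈ Icc 0 T, (γ t).2 = p.2 + (p.1 - l) * t + t ^ 2 / 2 := by
      intro t ht
      have := eq_of_hasDerivWithinAt_zero (T := T)
        (f := fun t => (γ t).2 - ((p.1 - l) * t + t ^ 2 / 2)) (fun t ht => by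
        have h1 := HasDerivWithinAt.pt_snd (h t ht).2
        have h2 : HasDerivAt (fun t : ℝ => (p.1 - l) * t + t ^ 2 / 2) (p.1 - l + t) t := by
          refine (((hasDerivAt_id' t).const_mul (p.1 - l)).fun_add
            ((hasDerivAt_pow 2 t).div_const 2)).congr_deriv ?_
          norm_num
        refine (h1.fun_sub h2.hasDerivWithinAt).congr_deriv ?_
        rw [Zv_X, e1 t ht]; ring) ht
      simp only [h0] at this
      linarith
    refine ⟨T, hT, ?_, fun t ht => ?_⟩
    · rw [← h1]
      exact Prod.ext (e1 T ⟨hT, le_rfl⟩) (e2 T ⟨hT, le_rfl⟩)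
    · rw [← e2 t ht]
      exact (h t ht).1
  · rintro ⟨T, hT, rfl, h⟩
    refine ⟨T, hT, fun t => (p.1 + t, p.2 + (p.1 - l) * t + t ^ 2 / 2), by simp, rfl,
      fun t ht => ⟨h t ht, HasDerivAt.hasDerivWithinAt ?_⟩⟩
    refine HasDerivAt.prodMk ((hasDerivAt_id t).const_add p.1) ?_
    refine ((((hasDerivAt_id' t).const_mul (p.1 - l)).const_add p.2).fun_add
      ((hasDerivAt_pow 2 t).div_const 2)).congr_deriv ?_
    simp [FoldType.sign]; ring

/-- The first integral of `X`. -/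
def intX (l : ℝ) (p : Pt) : ℝ := (p.1 - l) ^ 2 - 2 * p.2

/-- The first component of `X` is `1`, so the elapsed time is the gain in abscissa. The parabola of
level `A` lies in `Σ₊` entirely if `A ≤ 0`. If `A > 0` it dips below `Σ` for `|x - l| < √A`, and the
sign of `x - l` tells its two branches apart. -/
lemma reach_X_iff {l β : ℝ} {p q : Pt} : Reach (Zv (l, β)).X upper p q ↔
    0 ≤ p.2 ∧ 0 ≤ q.2 ∧ intX l p = intX l q ∧ p.1 ≤ q.1 ∧
      (0 < intX l p → 0 < (p.1 - l) * (q.1 - l)) := by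
  rw [reach_X_iff_flow]
  constructor
  · rintro ⟨T, hT, rfl, h⟩
    have hp : 0 ≤ p.2 := by simpa using h 0 ⟨le_rfl, hT⟩
    refine ⟨hp, h T ⟨hT, le_rfl⟩, by simp only [intX]; ring, by simpa using hT, ?_⟩
    intro hA
    simp only [intX] at hA
    by_contra! hc
    simp only at hc
    have h1 : p.1 - l ≤ 0 := by
      by_contra! h2
      nlinarith
    have h2 : 0 ≤ p.1 + T - l := by
      by_contra! h2
      nlinarith
    -- At this time the abscissa is `l` and the height is `-A / 2 < 0`.
    have := h (l - p.1) ⟨by linarith, by linarith⟩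
    nlinarith
  · rintro ⟨hp, hq, hA, h1, h2⟩
    refine ⟨q.1 - p.1, by linarith, Prod.ext (by simp) ?_, fun t ht => ?_⟩
    · simp only [intX] at hA
      simp only; linarith
    · obtain ⟨ht0, ht1⟩ := ht
      by_cases hA0 : 0 < intX l p
      · have h3 := h2 hA0
        simp only [intX] at *
        rcases le_or_gt (p.1 - l) 0 with h4 | h4
        · have h5 : q.1 - l < 0 := by
            by_contra! h6
            nlinarith
          nlinarith
        · nlinarith
      · simp only [intX] at *
        nlinarith [sq_nonneg (p.1 - l + t)]

/-- The time-`T` map of the saddle in the coordinates `u = x + (y + β)`, `v = x - (y + β)`. -/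
lemma reach_Y_iff_flow {l β : ℝ} {p q : Pt} : Reach (Zv (l, β)).Y lower p q ↔
    ∃ T, 0 ≤ T ∧ q.1 + (q.2 + β) = (p.1 + (p.2 + β)) * Real.exp (-T) ∧
      q.1 - (q.2 + β) = (p.1 - (p.2 + β)) * Real.exp T ∧
      ∀ t ∈ Icc 0 T,
        (p.1 + (p.2 + β)) * Real.exp (-t) - (p.1 - (p.2 + β)) * Real.exp t ≤ 2 * β := by
  have dneg : ∀ t : ℝ, HasDerivAt (fun t => Real.exp (-t)) (-Real.exp (-t)) t := fun t => by
    simpa using (hasDerivAt_neg t).exp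
  constructor
  · rintro ⟨T, hT, γ, h0, h1, h⟩
    have e1 : ∀ t ∈ Icc 0 T, (γ t).1 + ((γ t).2 + β) = (p.1 + (p.2 + β)) * Real.exp (-t) := by
      intro t ht
      have := eq_of_hasDerivWithinAt_zero (T := T)
        (f := fun t => ((γ t).1 + ((γ t).2 + β)) * Real.exp t) (fun t ht => by
        have h1 := HasDerivWithinAt.pt_fst (h t ht).2
        have h2 := HasDerivWithinAt.pt_snd (h t ht).2
        refine ((h1.fun_add (h2.add_const β)).fun_mul
          (Real.hasDerivAt_exp t).hasDerivWithinAt).congr_deriv ?_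
        rw [Zv_Y]; ring) ht
      simp only [h0, Real.exp_zero, mul_one] at this
      rw [← this, mul_assoc, ← Real.exp_add]; simp
    have e2 : ∀ t ∈ Icc 0 T, (γ t).1 - ((γ t).2 + β) = (p.1 - (p.2 + β)) * Real.exp t := by
      intro t ht
      have := eq_of_hasDerivWithinAt_zero (T := T)
        (f := fun t => ((γ t).1 - ((γ t).2 + β)) * Real.exp (-t)) (fun t ht => by
        have h1 := HasDerivWithinAt.pt_fst (h t ht).2
        have h2 := HasDerivWithinAt.pt_snd (h t ht).2
        refine ((h1.fun_sub (h2.add_const β)).fun_mul (dneg t).hasDerivWithinAt).congr_deriv ?_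
        rw [Zv_Y]; ring) ht
      simp only [h0, neg_zero, Real.exp_zero, mul_one] at this
      rw [← this, mul_assoc, ← Real.exp_add]; simp
    refine ⟨T, hT, ?_, ?_, fun t ht => ?_⟩
    · rw [← h1]; exact e1 T ⟨hT, le_rfl⟩
    · rw [← h1]; exact e2 T ⟨hT, le_rfl⟩
    · rw [← e1 t ht, ← e2 t ht]
      have : (γ t).2 ≤ 0 := (h t ht).1
      linarith
  · rintro ⟨T, hT, hu, hv, h⟩
    set u := p.1 + (p.2 + β) with hu'
    set v := p.1 - (p.2 + β) with hv'
    refine ⟨T, hT, fun t => ((u * Real.exp (-t) + v * Real.exp t) / 2,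
      (u * Real.exp (-t) - v * Real.exp t) / 2 - β), ?_, ?_, fun t ht => ⟨?_, ?_⟩⟩
    · refine Prod.ext ?_ ?_ <;> simp [hu', hv']
    · refine Prod.ext ?_ ?_ <;> simp only <;> linarith
    · have := h t ht
      change _ - β ≤ 0; linarith
    · refine HasDerivAt.hasDerivWithinAt ?_
      have h1 := (dneg t).const_mul u
      have h2 := (Real.hasDerivAt_exp t).const_mul v
      refine (((h1.fun_add h2).div_const 2).prodMk
        (((h1.fun_sub h2).div_const 2).sub_const β)).congr_deriv ?_
      rw [Zv_Y]
      refine Prod.ext ?_ ?_ <;> ring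

/-- `(u', v')` lies ahead of `(u, v)` on its orbit of the linear saddle `u̇ = -u`, `v̇ = v`. -/
def SaddleLE (u v u' v' : ℝ) : Prop :=
  u * v = u' * v' ∧ ((0 < v ∧ v ≤ v') ∨ (v < 0 ∧ v' ≤ v) ∨ (0 < u' ∧ u' ≤ u) ∨
    (u' < 0 ∧ u ≤ u') ∨ (u = u' ∧ v = v'))

/-- Any nonzero coordinate serves as a clock: `v` moves away from `0`, `u` moves towards it, and the
invariant product `u * v` determines the other coordinate. The four sign alternatives cover
everything but the equilibrium. -/
lemma exists_exp_iff {u v u' v' : ℝ} :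
    (∃ T, 0 ≤ T ∧ u' = u * Real.exp (-T) ∧ v' = v * Real.exp T) ↔ SaddleLE u v u' v' := by
  constructor
  · rintro ⟨T, hT, rfl, rfl⟩
    have h1 : 1 ≤ Real.exp T := Real.one_le_exp hT
    have h2 : Real.exp (-T) ≤ 1 := Real.exp_le_one_iff.2 (by linarith)
    have h3 := Real.exp_pos (-T)
    refine ⟨?_, ?_⟩
    · have : Real.exp (-T) * Real.exp T = 1 := by rw [← Real.exp_add]; simp
      linear_combination (-(u * v)) * this
    · rcases lt_trichotomy v 0 with h | rfl | h
      · right; left; exact ⟨h, by nlinarith⟩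
      · rcases lt_trichotomy u 0 with h | rfl | h
        · right; right; right; left; exact ⟨by nlinarith, by nlinarith⟩
        · simp
        · right; right; left; exact ⟨mul_pos h h3, by nlinarith⟩
      · left; exact ⟨h, by nlinarith⟩
  · rintro ⟨hK, h⟩
    have main : ∀ {a a' b b' : ℝ}, 0 < a → a ≤ a' → a * b = a' * b' →
        ∃ T, 0 ≤ T ∧ a' = a * Real.exp T ∧ b' = b * Real.exp (-T) := by
      intro a a' b b' ha haa hab
      have ha' : 0 < a' := ha.trans_le haa
      refine ⟨Real.log (a' / a), Real.log_nonneg (by rwa [le_div_iff₀ ha, one_mul]), ?_, ?_⟩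
      · rw [Real.exp_log (by positivity)]; field_simp
      · rw [Real.exp_neg, Real.exp_log (by positivity)]; field_simp; linarith
    have back : ∀ {a b T : ℝ}, a = b * Real.exp T → b = a * Real.exp (-T) := by
      rintro a b T rfl
      rw [mul_assoc, ← Real.exp_add]; simp
    have back' : ∀ {a b T : ℝ}, a = b * Real.exp (-T) → b = a * Real.exp T := by
      rintro a b T rfl
      rw [mul_assoc, ← Real.exp_add]; simp
    rcases h with ⟨h1, h2⟩ | ⟨h1, h2⟩ | ⟨h1, h2⟩ | ⟨h1, h2⟩ | ⟨rfl, rfl⟩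
    · obtain ⟨T, hT, e1, e2⟩ := main h1 h2 (by linarith : v * u = v' * u')
      exact ⟨T, hT, e2, e1⟩
    · obtain ⟨T, hT, e1, e2⟩ := main (by linarith : 0 < -v) (by linarith : -v ≤ -v')
        (by linarith : -v * u = -v' * u')
      exact ⟨T, hT, e2, by linarith⟩
    · obtain ⟨T, hT, e1, e2⟩ := main h1 h2 (by linarith : u' * v' = u * v)
      exact ⟨T, hT, back e1, back' e2⟩
    · obtain ⟨T, hT, e1, e2⟩ := main (by linarith : 0 < -u') (by linarith : -u' ≤ -u)
        (by linarith : -u' * v' = -u * v)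
      exact ⟨T, hT, back (by linarith), back' e2⟩
    · exact ⟨0, le_rfl, by simp, by simp⟩

/-- The orbit relation of `Y`, disregarding the boundary of `Σ₋`. -/
def OrbY (β : ℝ) (p q : Pt) : Prop :=
  SaddleLE (p.1 + (p.2 + β)) (p.1 - (p.2 + β)) (q.1 + (q.2 + β)) (q.1 - (q.2 + β))

lemma Reach.orbY {l β : ℝ} {p q : Pt} (h : Reach (Zv (l, β)).Y lower p q) : OrbY β p q := by
  obtain ⟨T, hT, h1, h2, -⟩ := reach_Y_iff_flow.1 h
  exact exists_exp_iff.1 ⟨T, hT, h1, h2⟩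

/-- Along the flow the left-hand side is `2 * (y + β)`, a solution of `f'' = f`, so it has no
positive interior maximum. A trajectory with both ends below a level `b ≥ 0` stays below it. -/
lemma saddle_max {u v b t T : ℝ} (ht0 : 0 ≤ t) (htT : t ≤ T) (hb : 0 ≤ b) (h0 : u - v ≤ b)
    (h1 : u * Real.exp (-T) - v * Real.exp T ≤ b) :
    u * Real.exp (-t) - v * Real.exp t ≤ b := by
  have a1 : 1 ≤ Real.exp t := Real.one_le_exp ht0
  have a2 : Real.exp t ≤ Real.exp T := Real.exp_le_exp.2 htT
  have c1 : Real.exp (-t) ≤ 1 := Real.exp_le_one_iff.2 (by linarith)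
  have c2 : Real.exp (-T) ≤ Real.exp (-t) := Real.exp_le_exp.2 (by linarith)
  have c3 := Real.exp_pos (-T)
  have m1 : Real.exp (-t) * Real.exp t = 1 := by rw [← Real.exp_add]; simp
  have m2 : Real.exp (-T) * Real.exp T = 1 := by rw [← Real.exp_add]; simp
  generalize Real.exp t = s at *
  generalize Real.exp T = S at *
  generalize Real.exp (-t) = s' at *
  generalize Real.exp (-T) = S' at *
  rcases le_total 0 u with hu | hu <;> rcases le_total 0 v with hv | hv
  · nlinarith [mul_nonneg hu (sub_nonneg.2 c1), mul_nonneg hv (sub_nonneg.2 a1)]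
  · by_cases hS : S = 1
    · have : s = 1 := by linarith
      have : s' = 1 := by nlinarith
      subst_vars; linarith
    have hS1 : 0 < S - 1 := by
      rcases lt_or_eq_of_le (a1.trans a2) with h | h
      · linarith
      · exact absurd h.symm hS
    have k1 : 0 ≤ (s - 1) * (S - s) := mul_nonneg (by linarith) (by linarith)
    -- Convexity of `1 / s`: its graph lies below the chord over `[1, S]`. Only the case `u ≥ 0 ≥ v`
    -- needs this; in the others the expression is monotone or nonpositive.
    have k2 : s' * (S - 1) ≤ (S - s) + (s - 1) * S' := by
      have hs : 0 < s := by linarith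
      have : (s' * (S - 1)) * (s * S) ≤ ((S - s) + (s - 1) * S') * (s * S) := by
        have e1 : (s' * (S - 1)) * (s * S) = (S - 1) * S := by linear_combination ((S - 1) * S) * m1
        have e2 : ((S - s) + (s - 1) * S') * (s * S) = (S - s) * s * S + (s - 1) * s := by
          linear_combination ((s - 1) * s) * m2
        rw [e1, e2]
        nlinarith [mul_nonneg k1 hS1.le]
      exact le_of_mul_le_mul_right this (mul_pos hs (by linarith))
    have k3 : (u * s' - v * s) * (S - 1) ≤ b * (S - 1) := by
      nlinarith [mul_le_mul_of_nonneg_left k2 hu,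
        mul_le_mul_of_nonneg_left h0 (by linarith : 0 ≤ S - s),
        mul_le_mul_of_nonneg_left h1 (by linarith : 0 ≤ s - 1)]
    exact le_of_mul_le_mul_right k3 hS1
  · have : 0 ≤ s' := by linarith
    nlinarith
  · nlinarith [mul_nonneg (neg_nonneg.2 hu) (sub_nonneg.2 c2),
      mul_nonneg (neg_nonneg.2 hv) (sub_nonneg.2 a2)]

/-- By `saddle_max` with `b = 2 * β`, the line `Σ` never cuts the piece of a saddle orbit between
two points of `Σ₋`. The orbit order alone decides. -/
lemma reach_Y_iff_of_nonneg {l β : ℝ} (hβ : 0 ≤ β) {p q : Pt} :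
    Reach (Zv (l, β)).Y lower p q ↔ p.2 ≤ 0 ∧ q.2 ≤ 0 ∧ OrbY β p q := by
  constructor
  · intro h
    exact ⟨h.mem_left, h.mem_right, h.orbY⟩
  · rintro ⟨hp, hq, h⟩
    obtain ⟨T, hT, h1, h2⟩ := exists_exp_iff.2 h
    refine reach_Y_iff_flow.2 ⟨T, hT, h1, h2, fun t ht => ?_⟩
    refine saddle_max ht.1 ht.2 (by linarith) (by linarith) ?_
    rw [← h1, ← h2]; linarith

/-- The first integral of `Y`. -/
def intY (β : ℝ) (p : Pt) : ℝ := p.1 ^ 2 - (p.2 + β) ^ 2 + β ^ 2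

/-- The numbers `w`, `w'` stand for `y + β` at the two ends. Since `w ^ 2 - x ^ 2` is constant,
`|w|` is large where `|x|` is. If the level is positive, both ends are on the same side of `x = 0`,
so the trajectory stays at least as far from that axis as its nearer end, or else its height is
monotone. If the level is at most `0`, then `w ^ 2 ≥ β ^ 2` on the whole orbit. -/
lemma saddle_le_of_neg {β x w x' w' s s' S S' : ℝ} (hβ : β < 0) (hw : w ≤ β) (hw' : w' ≤ β)
    (hA : x ^ 2 - w ^ 2 + β ^ 2 = x' ^ 2 - w' ^ 2 + β ^ 2) (hx : x ≤ x')
    (hs : 0 < x ^ 2 - w ^ 2 + β ^ 2 → 0 < x * x') (a1 : 1 ≤ s) (a2 : s ≤ S) (c1 : s' ≤ 1)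
    (c2 : S' ≤ s') (m1 : s' * s = 1) (c3 : 0 < S') (h1 : x' + w' = (x + w) * S')
    (h2 : x' - w' = (x - w) * S) : (x + w) * s' - (x - w) * s ≤ 2 * β := by
  have hsq : ((x + w) * s' - (x - w) * s) ^ 2 =
      ((x + w) * s' + (x - w) * s) ^ 2 - 4 * (x ^ 2 - w ^ 2) := by
    linear_combination (-4 * ((x + w) * (x - w))) * m1
  have hs0 : 0 < s' := by linarith
  -- Given the signs of `u` and `v`, a lower bound for the square of `2 * w` at time `t` becomes an
  -- upper bound for `w`, which is negative.
  have fin : ∀ c ≤ β, x + w ≤ 0 → 0 ≤ x - w →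
      (2 * c) ^ 2 ≤ ((x + w) * s' - (x - w) * s) ^ 2 →
      (x + w) * s' - (x - w) * s ≤ 2 * β := by
    intro c hc hu hv h
    have k1 : (x + w) * s' ≤ 0 := mul_nonpos_of_nonpos_of_nonneg hu hs0.le
    have k2 : 0 ≤ (x - w) * s := mul_nonneg hv (by linarith)
    have := sq_le_sq.1 h
    rw [abs_of_nonpos (by linarith : (x + w) * s' - (x - w) * s ≤ 0),
      abs_of_neg (by linarith : 2 * c < 0)] at this
    linarith
  by_cases hA0 : 0 < x ^ 2 - w ^ 2 + β ^ 2
  · have h3 := hs hA0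
    rcases le_total x 0 with h | h
    · have hx' : x' < 0 := by
        by_contra! h'
        exact absurd h3 (not_lt.2 (mul_nonpos_of_nonpos_of_nonneg h h'))
      have hu : x + w < 0 := by linarith
      have k1 : (x + w) * s' ≤ (x + w) * S' := mul_le_mul_of_nonpos_left c2 hu.le
      rcases le_total (x - w) 0 with hv | hv
      · have k2 : (x - w) * S ≤ (x - w) * s := mul_le_mul_of_nonpos_left a2 hv
        linarith
      · have k2 : (x - w) * s ≤ (x - w) * S := mul_le_mul_of_nonneg_left a2 hv
        have k3 : (2 * x') ^ 2 ≤ ((x + w) * s' + (x - w) * s) ^ 2 :=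
          sq_le_sq.2 (by rw [abs_of_neg (by linarith), abs_of_neg (by linarith)]; linarith)
        exact fin w' hw' hu.le hv (by rw [hsq]; linarith)
    · have hv : 0 < x - w := by linarith
      have k1 : x - w ≤ (x - w) * s := le_mul_of_one_le_right hv.le a1
      rcases le_total (x + w) 0 with hu | hu
      · have k2 : x + w ≤ (x + w) * s' := by nlinarith
        have k3 : (2 * x) ^ 2 ≤ ((x + w) * s' + (x - w) * s) ^ 2 :=
          sq_le_sq.2 (by rw [abs_of_nonneg (by linarith), abs_of_nonneg (by linarith)]; linarith)
        exact fin w hw hu hv.le (by rw [hsq]; linarith)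
      · have k2 : (x + w) * s' ≤ x + w := mul_le_of_le_one_right hu c1
        linarith
  · have hK : (x + w) * (x - w) < 0 := by nlinarith
    have h1 : 0 < x - w := by nlinarith
    have h2 : x + w < 0 := by nlinarith
    exact fin β le_rfl h2.le h1.le (by nlinarith [sq_nonneg ((x + w) * s' + (x - w) * s)])

/-- For `β < 0` the half-plane `Σ₋` lies in `y + β < 0`, where the abscissa increases. The picture
is that of the visible fold of `X`: `intY` is normalised to equal `x ^ 2` on `Σ`, so an orbit of
positive level `A` leaves `Σ₋` for `|x| < √A` and has two branches there, while the other levels are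
not cut. -/
lemma reach_Y_iff_of_neg {l β : ℝ} (hβ : β < 0) {p q : Pt} :
    Reach (Zv (l, β)).Y lower p q ↔ p.2 ≤ 0 ∧ q.2 ≤ 0 ∧ intY β p = intY β q ∧ p.1 ≤ q.1 ∧
      (0 < intY β p → 0 < p.1 * q.1) := by
  constructor
  · intro h
    obtain ⟨T, hT, h1, h2, h3⟩ := reach_Y_iff_flow.1 h
    have hp : p.2 ≤ 0 := h.mem_left
    have hq : q.2 ≤ 0 := h.mem_right
    have a1 : 1 ≤ Real.exp T := Real.one_le_exp hT
    have c1 : Real.exp (-T) ≤ 1 := Real.exp_le_one_iff.2 (by linarith)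
    have c3 := Real.exp_pos (-T)
    have m2 : Real.exp (-T) * Real.exp T = 1 := by rw [← Real.exp_add]; simp
    have hA : intY β p = intY β q := by
      have := h.orbY.1
      simp only [intY]; linarith
    refine ⟨hp, hq, hA, ?_, fun hA0 => ?_⟩
    · have e : 2 * (q.1 - p.1) =
          (Real.exp T - 1) * ((p.1 - (p.2 + β)) - (q.1 + (q.2 + β))) := by
        rw [h1]
        linear_combination h1 + h2 + (p.1 + (p.2 + β)) * m2
      have : 0 ≤ (p.1 - (p.2 + β)) - (q.1 + (q.2 + β)) := by
        rcases le_total 0 (p.1 + (p.2 + β)) with h | h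
        · nlinarith
        · have : q.1 + (q.2 + β) ≤ 0 := by rw [h1]; nlinarith
          rcases le_total 0 (p.1 - (p.2 + β)) with h' | h'
          · linarith
          · nlinarith
      nlinarith [mul_nonneg (sub_nonneg.2 a1) this]
    · by_contra! hc
      -- The abscissa along the trajectory. If its sign changed, it would vanish at some time, and
      -- there `(y + β) ^ 2 = β ^ 2 - A < β ^ 2`, which is impossible in `Σ₋`.
      let f : ℝ → ℝ := fun t =>
        ((p.1 + (p.2 + β)) * Real.exp (-t) + (p.1 - (p.2 + β)) * Real.exp t) / 2
      have hf : ContinuousOn f (Icc 0 T) := by fun_prop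
      have hf0 : f 0 = p.1 := by simp [f]
      have hfT : f T = q.1 := by simp only [f]; linarith
      have : ∃ t ∈ Icc 0 T, f t = 0 := by
        rcases le_total p.1 0 with h | h
        · rcases eq_or_lt_of_le h with h | h
          · exact ⟨0, ⟨le_rfl, hT⟩, by rw [hf0, h]⟩
          · exact intermediate_value_Icc hT hf ⟨by rw [hf0]; linarith, by rw [hfT]; nlinarith⟩
        · rcases eq_or_lt_of_le h with h | h
          · exact ⟨0, ⟨le_rfl, hT⟩, by rw [hf0, h]⟩
          · exact intermediate_value_Icc' hT hf ⟨by rw [hfT]; nlinarith, by rw [hf0]; linarith⟩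
      obtain ⟨t, ht, hft⟩ := this
      have h4 := h3 t ht
      have m1 : Real.exp (-t) * Real.exp t = 1 := by rw [← Real.exp_add]; simp
      simp only [f] at hft
      simp only [intY] at hA0
      have e : ((p.1 + (p.2 + β)) * Real.exp (-t) - (p.1 - (p.2 + β)) * Real.exp t) ^ 2 =
          -4 * (p.1 ^ 2 - (p.2 + β) ^ 2) := by
        have hs : (p.1 + (p.2 + β)) * Real.exp (-t) + (p.1 - (p.2 + β)) * Real.exp t = 0 := by
          linarith
        linear_combination ((p.1 + (p.2 + β)) * Real.exp (-t) + (p.1 - (p.2 + β)) * Real.exp t) * hs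
          - 4 * (p.1 ^ 2 - (p.2 + β) ^ 2) * m1
      nlinarith
  · rintro ⟨hp, hq, hA, hx, hs⟩
    simp only [intY] at hA hs
    have hlin : ∀ p : Pt, p.2 ≤ 0 → p.2 + β < 0 := fun p hp => by linarith
    have hw := hlin p hp
    have hw' := hlin q hq
    generalize hw1 : p.2 + β = w at *
    generalize hw2 : q.2 + β = w' at *
    obtain ⟨x, y⟩ := p
    obtain ⟨x', y'⟩ := q
    simp only at *
    have hS : SaddleLE (x + w) (x - w) (x' + w') (x' - w') := by
      refine ⟨by linarith, ?_⟩
      by_cases hA0 : 0 < x ^ 2 - w ^ 2 + β ^ 2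
      · have h1 := hs hA0
        rcases le_total x 0 with h | h
        · have hx' : x' < 0 := by nlinarith
          have : w ≤ w' := by nlinarith
          right; right; right; left
          constructor <;> linarith
        · have : w' ≤ w := by nlinarith
          left
          constructor <;> nlinarith
      · have hK : (x + w) * (x - w) < 0 := by nlinarith
        have h1 : 0 < x - w := by nlinarith
        have h2 : x + w < 0 := by nlinarith
        have hK' : (x' + w') * (x' - w') < 0 := by nlinarith
        have h1' : 0 < x' - w' := by nlinarith
        have h2' : x' + w' < 0 := by nlinarith
        left
        refine ⟨h1, ?_⟩
        by_contra! h3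
        nlinarith
    obtain ⟨T, hT, h1, h2⟩ := exists_exp_iff.2 hS
    refine reach_Y_iff_flow.2 ⟨T, hT, by simpa [hw1, hw2] using h1, by simpa [hw1, hw2] using h2,
      fun t ht => ?_⟩
    simp only [hw1]
    obtain ⟨ht0, htT⟩ := ht
    refine saddle_le_of_neg hβ (by linarith) (by linarith) hA hx hs
      (Real.one_le_exp ht0) (Real.exp_le_exp.2 htT) (Real.exp_le_one_iff.2 (by linarith))
      (Real.exp_le_exp.2 (by linarith)) (by rw [← Real.exp_add]; simp) (Real.exp_pos (-T)) h1 h2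

end FoldSaddle

namespace FoldSaddle

/-! ### The regions of `Σ` and the sliding vector field -/

lemma lieF_eq (V : Pt → Pt) (p : Pt) : lieF V p = (V p).2 := by
  simp [lieF, lie, fderiv_snd]

lemma lieF_X (l β : ℝ) (p : Pt) : lieF (Zv (l, β)).X p = p.1 - l := by
  rw [lieF_eq, Zv_X]

lemma lieF_Y (l β : ℝ) (p : Pt) : lieF (Zv (l, β)).Y p = -p.1 := by
  rw [lieF_eq, Zv_Y]

lemma mem_escaping {l β : ℝ} {q : Pt} : q ∈ (Zv (l, β)).escaping ↔ q.2 = 0 ∧ max l 0 < q.1 := by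
  change (q.2 = 0 ∧ 0 < lieF _ q ∧ lieF _ q < 0) ↔ _
  rw [lieF_X, lieF_Y, max_lt_iff, sub_pos, neg_lt_zero]

lemma mem_sliding {l β : ℝ} {q : Pt} : q ∈ (Zv (l, β)).sliding ↔ q.2 = 0 ∧ q.1 < min l 0 := by
  change (q.2 = 0 ∧ lieF _ q < 0 ∧ 0 < lieF _ q) ↔ _
  rw [lieF_X, lieF_Y, lt_min_iff, sub_neg, neg_pos]

lemma mem_sewing {l β : ℝ} {q : Pt} :
    q ∈ (Zv (l, β)).sewing ↔ q.2 = 0 ∧ min l 0 < q.1 ∧ q.1 < max l 0 := by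
  change (q.2 = 0 ∧ 0 < lieF _ q * lieF _ q) ↔ _
  rw [lieF_X, lieF_Y, min_lt_iff, lt_max_iff]
  refine and_congr_right fun _ => ⟨fun h => ?_, fun h => ?_⟩
  · rcases lt_trichotomy q.1 0 with h0 | h0 | h0
    · have : l < q.1 := by nlinarith
      exact ⟨Or.inl this, Or.inr h0⟩
    · simp [h0] at h
    · have : q.1 < l := by nlinarith
      exact ⟨Or.inr h0, Or.inl this⟩
  · rcases h with ⟨h1 | h1, h2 | h2⟩ <;> nlinarith

lemma mem_slidingDomain {l β : ℝ} {q : Pt} : q ∈ (Zv (l, β)).slidingDomain ↔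
    q.2 = 0 ∧ (max l 0 < q.1 ∨ q.1 < min l 0) := by
  change q ∈ (Zv (l, β)).escaping ∨ q ∈ (Zv (l, β)).sliding ↔ _
  rw [mem_escaping, mem_sliding]; tauto

/-- The abscissa of the zero of the sliding vector field. -/
noncomputable def pseudo (l β : ℝ) : ℝ := β * l / (-1 + β)

/-- On `Σ` the numerator is `-x + β * (x - l) = (β - 1) * (x - P)` and the denominator is `l - 2 *
x`. The quotient `(β - 1) / (l - 2 * x)` is positive on `Σ₂` and negative on `Σ₃`, so orbits move
away from `P` on `Σ₂` and towards it on `Σ₃`. -/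
lemma slide_eq {l β : ℝ} (hβ : β < 1) {q : Pt} (hq : q ∈ (Zv (l, β)).slidingDomain) :
    (Zv (l, β)).slide q = ((β - 1) / (l - 2 * q.1) * (q.1 - pseudo l β), 0) := by
  obtain ⟨h0, -⟩ := mem_slidingDomain.1 hq
  have hβ' : -1 + β ≠ 0 := by linarith
  rw [NSField.slide, lieF_X, lieF_Y, Zv_X, Zv_Y]
  refine Prod.ext ?_ ?_
  · simp only [h0, Prod.smul_mk, Prod.mk_sub_mk, smul_eq_mul, pseudo, zero_add]
    rw [show -q.1 - (q.1 - l) = l - 2 * q.1 by ring, div_mul_eq_mul_div, div_eq_inv_mul]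
    congr 1
    field_simp
    ring
  · simp only [Prod.smul_mk, Prod.mk_sub_mk, smul_eq_mul]
    ring

lemma escaping_denom {l x : ℝ} (h : max l 0 < x) : l - 2 * x < 0 := by
  have := max_lt_iff.1 h
  linarith

lemma sliding_denom {l x : ℝ} (h : x < min l 0) : 0 < l - 2 * x := by
  have := lt_min_iff.1 h
  linarith

/-! ### Change of time -/

/-- `G` is the inverse of the antiderivative of `g` that vanishes at `0`. The lower bound `c` makes
this antiderivative onto the line. -/
lemma exists_clock {g : ℝ → ℝ} (hg : Continuous g) {c : ℝ} (hc : 0 < c) (h : ∀ s, c ≤ g s) :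
    ∃ G : ℝ ≃o ℝ, G 0 = 0 ∧ ∀ t, HasDerivAt G (g (G t))⁻¹ t := by
  let F : ℝ → ℝ := fun s => ∫ r in (0 : ℝ)..s, g r
  have hF : ∀ s, HasDerivAt F (g s) s := fun s =>
    intervalIntegral.integral_hasDerivAt_right (hg.intervalIntegrable _ _)
      hg.aestronglyMeasurable.stronglyMeasurableAtFilter hg.continuousAt
  have hF0 : F 0 = 0 := by simp [F]
  have hmono : StrictMono F := strictMono_of_deriv_pos fun s => by
    rw [(hF s).deriv]; exact hc.trans_le (h s)
  have hlin : Monotone fun s => F s - c * s := by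
    have hd : ∀ s, HasDerivAt (fun s => F s - c * s) (g s - c) s := fun s =>
      ((hF s).fun_sub ((hasDerivAt_id' s).const_mul c)).congr_deriv (by simp)
    refine monotone_of_deriv_nonneg (fun s => (hd s).differentiableAt) fun s => ?_
    rw [(hd s).deriv]; linarith [h s]
  have hcont : Continuous F := continuous_iff_continuousAt.2 fun s => (hF s).continuousAt
  have hsurj : Function.Surjective F := by
    refine hcont.surjective ?_ ?_
    · refine tendsto_atTop_mono' _ ?_ (tendsto_id.const_mul_atTop hc)
      filter_upwards [eventually_ge_atTop 0] with s hs
      have := hlin hs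
      simp only [hF0] at this
      simp only [id]; linarith
    · refine tendsto_atBot_mono' _ ?_ (tendsto_id.const_mul_atBot hc)
      filter_upwards [eventually_le_atBot 0] with s hs
      have := hlin hs
      simp only [hF0] at this
      simp only [id]; linarith
  let e := hmono.orderIsoOfSurjective F hsurj
  have he : ∀ s, e s = F s := fun s => rfl
  refine ⟨e.symm, ?_, fun t => ?_⟩
  · rw [OrderIso.symm_apply_eq, he, hF0]
  · refine HasDerivAt.of_local_left_inverse e.symm.continuous.continuousAt (hF _)
      (hc.trans_le (h _)).ne' (Eventually.of_forall fun y => ?_)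
    rw [← he, OrderIso.apply_symm_apply]

/-- A positive change of time does not alter `Reach`. This allows the use of exponential curves,
whose velocity is only proportional to `Z^Σ`. -/
lemma reach_of_param {V : Pt → Pt} {D : Set Pt} {σ : ℝ → Pt} {g : ℝ → ℝ} {S : ℝ} (hS : 0 ≤ S)
    (hg : ContinuousOn g (Icc 0 S)) (hpos : ∀ s ∈ Icc 0 S, 0 < g s)
    (h : ∀ s ∈ Icc 0 S, σ s ∈ D ∧ HasDerivAt σ (g s • V (σ s)) s) :
    Reach V D (σ 0) (σ S) := by
  -- `g` is controlled on `[0, S]` only. Clamping its argument extends it to the line with the same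
  -- minimum.
  have hclamp : ∀ s : ℝ, max 0 (min s S) ∈ Icc 0 S := fun s =>
    ⟨le_max_left _ _, max_le hS (min_le_right _ _)⟩
  obtain ⟨s₀, hs₀, hmin⟩ := isCompact_Icc.exists_isMinOn ⟨0, le_rfl, hS⟩ hg
  obtain ⟨G, G0, hG⟩ := exists_clock (g := fun s => g (max 0 (min s S)))
    (hg.comp_continuous (by fun_prop) hclamp) (hpos s₀ hs₀) (fun s => hmin (hclamp s))
  have hT : 0 ≤ G.symm S := by
    rw [OrderIso.le_symm_apply, G0]; exact hS
  refine ⟨G.symm S, hT, fun t => σ (G t), by simp [G0], by simp, fun t ht => ?_⟩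
  have hGt : G t ∈ Icc 0 S := by
    refine ⟨?_, ?_⟩
    · rw [← G0]; exact G.monotone ht.1
    · rw [← OrderIso.le_symm_apply]; exact ht.2
  refine ⟨(h _ hGt).1, HasDerivAt.hasDerivWithinAt ?_⟩
  have h1 := HasDerivAt.scomp t (h _ hGt).2 (hG t)
  refine h1.congr_deriv ?_
  rw [max_eq_right (by rw [min_eq_left hGt.2]; exact hGt.1), min_eq_left hGt.2, smul_smul,
    inv_mul_cancel₀ (hpos _ hGt).ne', one_smul]

lemma trajectory_of_param {V : Pt → Pt} {D : Set Pt} {q : Pt} {σ : ℝ → Pt} {g : ℝ → ℝ} {c : ℝ}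
    (hc : 0 < c) (hg : ContinuousOn g (Ici 0)) (hpos : ∀ s, 0 ≤ s → c ≤ g s)
    (h : ∀ s, 0 ≤ s → σ s ∈ D ∧ HasDerivAt σ (g s • V (σ s)) s) (hlim : Tendsto σ atTop (𝓝 q)) :
    ∃ γ : ℝ → Pt, γ 0 = σ 0 ∧
      (∀ t ∈ Ici (0 : ℝ), γ t ∈ D ∧ HasDerivWithinAt γ (V (γ t)) (Ici 0) t) ∧
      Tendsto γ atTop (𝓝 q) := by
  obtain ⟨G, G0, hG⟩ := exists_clock (g := fun s => g (max 0 s))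
    (hg.comp_continuous (by fun_prop) fun s => mem_Ici.2 (le_max_left _ _)) hc
    (fun s => hpos _ (le_max_left _ _))
  refine ⟨fun t => σ (G t), by simp [G0], fun t ht => ?_, hlim.comp G.tendsto_atTop⟩
  have hGt : 0 ≤ G t := by
    rw [← G0]; exact G.monotone ht
  refine ⟨(h _ hGt).1, HasDerivAt.hasDerivWithinAt ?_⟩
  refine (HasDerivAt.scomp t (h _ hGt).2 (hG t)).congr_deriv ?_
  rw [max_eq_right hGt, smul_smul, inv_mul_cancel₀ (hc.trans_le (hpos _ hGt)).ne', one_smul]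

/-- Integrating factor: `M` is the integral of `m` over `[0, T]`, so it inherits the sign of `m`.
For `Z^Σ` this is used with `z = x - P` and the factor of `slide_eq` taken along the trajectory. -/
lemma exists_exp_of_linear_ode {z m : ℝ → ℝ} {T : ℝ} (hT : 0 ≤ T) (hm : ContinuousOn m (Icc 0 T))
    (hz : ∀ t ∈ Icc 0 T, HasDerivWithinAt z (m t * z t) (Icc 0 T) t) :
    ∃ M, z T = z 0 * Real.exp M ∧ ((∀ t ∈ Icc 0 T, 0 ≤ m t) → 0 ≤ M) ∧
      ((∀ t ∈ Icc 0 T, m t ≤ 0) → M ≤ 0) := by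
  let n : ℝ → ℝ := fun t => m (max 0 (min t T))
  have hn : Continuous n := hm.comp_continuous (by fun_prop) fun t =>
    ⟨le_max_left _ _, max_le hT (min_le_right _ _)⟩
  have hnm : ∀ t ∈ Icc 0 T, n t = m t := fun t ht => by
    simp only [n]; rw [min_eq_left ht.2, max_eq_right ht.1]
  let F : ℝ → ℝ := fun s => ∫ r in (0 : ℝ)..s, n r
  have hF : ∀ s, HasDerivAt F (n s) s := fun s =>
    intervalIntegral.integral_hasDerivAt_right (hn.intervalIntegrable _ _)
      hn.aestronglyMeasurable.stronglyMeasurableAtFilter hn.continuousAt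
  have hF0 : F 0 = 0 := by simp [F]
  have key := eq_of_hasDerivWithinAt_zero (f := fun t => z t * Real.exp (-F t)) (T := T)
    (fun t ht => by
      refine ((hz t ht).fun_mul ((hF t).fun_neg.exp).hasDerivWithinAt).congr_deriv ?_
      rw [hnm t ht]; ring) (t := T) ⟨hT, le_rfl⟩
  refine ⟨F T, ?_, fun h => ?_, fun h => ?_⟩
  · simp only [hF0, neg_zero, Real.exp_zero, mul_one] at key
    rw [← key, mul_assoc, ← Real.exp_add]; simp
  · exact intervalIntegral.integral_nonneg hT fun t ht => by rw [hnm t ht]; exact h t ht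
  · have : 0 ≤ ∫ r in (0 : ℝ)..T, -n r :=
      intervalIntegral.integral_nonneg hT fun t ht => by rw [hnm t ht]; linarith [h t ht]
    rw [intervalIntegral.integral_neg] at this
    change (∫ r in (0 : ℝ)..T, n r) ≤ 0
    linarith

/-! ### Orbits of the sliding vector field -/

/-- `z'` has the sign of `z` and is at least as far from `0`. -/
def AwayLE (z z' : ℝ) : Prop := (0 < z ∧ z ≤ z') ∨ (z' ≤ z ∧ z < 0) ∨ z = z'

lemma awayLE_iff {z z' : ℝ} : AwayLE z z' ↔ ∃ M, 0 ≤ M ∧ z' = z * Real.exp M := by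
  constructor
  · rintro (⟨h1, h2⟩ | ⟨h1, h2⟩ | rfl)
    · refine ⟨Real.log (z' / z), Real.log_nonneg (by rwa [le_div_iff₀ h1, one_mul]), ?_⟩
      rw [Real.exp_log (div_pos (h1.trans_le h2) h1)]; field_simp
    · refine ⟨Real.log (z' / z), Real.log_nonneg ?_, ?_⟩
      · rwa [le_div_iff_of_neg h2, one_mul]
      · rw [Real.exp_log (div_pos_of_neg_of_neg (h1.trans_lt h2) h2)]
        field_simp [h2.ne]
    · exact ⟨0, le_rfl, by simp⟩
  · rintro ⟨M, hM, rfl⟩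
    have := Real.one_le_exp hM
    rcases lt_trichotomy z 0 with h | rfl | h
    · right; left; exact ⟨by nlinarith, h⟩
    · simp [AwayLE]
    · left; exact ⟨h, by nlinarith⟩

lemma div_mul_div_cancel_mul {a b z : ℝ} (ha : a ≠ 0) (hb : b ≠ 0) : a / b * (b / a * z) = z := by
  field_simp

/-- A trajectory cannot change between `Σ₂` and `Σ₃`, because `0` lies between them and belongs to
neither. On each of them `x - P` solves a linear equation whose coefficient has a fixed sign.
Conversely, `P + z * exp (±s)` runs between the two points and is a time change of a trajectory. -/
lemma reach_slide_iff {l β : ℝ} (hβ : β < 1) {p q : Pt} :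
    Reach (Zv (l, β)).slide (Zv (l, β)).slidingDomain p q ↔
      (p ∈ (Zv (l, β)).escaping ∧ q ∈ (Zv (l, β)).escaping ∧
        AwayLE (p.1 - pseudo l β) (q.1 - pseudo l β)) ∨
      (p ∈ (Zv (l, β)).sliding ∧ q ∈ (Zv (l, β)).sliding ∧
        AwayLE (q.1 - pseudo l β) (p.1 - pseudo l β)) := by
  set P := pseudo l β with hP
  constructor
  · rintro ⟨T, hT, γ, rfl, rfl, h⟩
    have hx : ∀ t ∈ Icc 0 T, HasDerivWithinAt (fun t => (γ t).1)
        ((β - 1) / (l - 2 * (γ t).1) * ((γ t).1 - P)) (Icc 0 T) t := fun t ht => by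
      have := HasDerivWithinAt.pt_fst (h t ht).2
      rwa [slide_eq hβ (h t ht).1] at this
    have hc : ContinuousOn (fun t => (γ t).1) (Icc 0 T) := fun t ht =>
      (hx t ht).continuousWithinAt
    have hD : ∀ t ∈ Icc 0 T, (γ t).2 = 0 ∧ (max l 0 < (γ t).1 ∨ (γ t).1 < min l 0) :=
      fun t ht => mem_slidingDomain.1 (h t ht).1
    have h0 : ∀ t ∈ Icc 0 T, (γ t).1 ≠ 0 := fun t ht h0 => by
      rcases (hD t ht).2 with h1 | h1
      · rw [h0] at h1; exact absurd h1 (not_lt.2 (le_max_right _ _))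
      · rw [h0] at h1; exact absurd h1 (not_lt.2 (min_le_right _ _))
    have hne : ∀ t ∈ Icc 0 T, l - 2 * (γ t).1 ≠ 0 := fun t ht => by
      rcases (hD t ht).2 with h1 | h1
      · exact (escaping_denom h1).ne
      · exact (sliding_denom h1).ne'
    obtain ⟨M, hM, hM1, hM2⟩ := exists_exp_of_linear_ode (z := fun t => (γ t).1 - P)
      (m := fun t => (β - 1) / (l - 2 * (γ t).1)) hT
      (continuousOn_const.div (continuousOn_const.sub (continuousOn_const.mul hc)) hne)
      (fun t ht => (hx t ht).sub_const P)
    have sub : ∀ {t}, t ∈ Icc 0 T → ContinuousOn (fun t => (γ t).1) (Icc 0 t) := fun ht =>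
      hc.mono (Icc_subset_Icc_right ht.2)
    rcases (hD 0 ⟨le_rfl, hT⟩).2 with h1 | h1
    · have all : ∀ t ∈ Icc 0 T, max l 0 < (γ t).1 := fun t ht => by
        rcases (hD t ht).2 with h2 | h2
        · exact h2
        · obtain ⟨s, hs, hs0⟩ := intermediate_value_Icc' ht.1 (sub ht)
            (show (0 : ℝ) ∈ Icc (γ t).1 (γ 0).1 from
              ⟨(h2.trans_le (min_le_right _ _)).le, ((le_max_right _ _).trans_lt h1).le⟩)
          exact absurd hs0 (h0 s ⟨hs.1, hs.2.trans ht.2⟩)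
      left
      refine ⟨mem_escaping.2 ⟨(hD 0 ⟨le_rfl, hT⟩).1, h1⟩,
        mem_escaping.2 ⟨(hD T ⟨hT, le_rfl⟩).1, all T ⟨hT, le_rfl⟩⟩, awayLE_iff.2 ⟨M, hM1 ?_, hM⟩⟩
      exact fun t ht => div_nonneg_of_nonpos (by linarith) (escaping_denom (all t ht)).le
    · have all : ∀ t ∈ Icc 0 T, (γ t).1 < min l 0 := fun t ht => by
        rcases (hD t ht).2 with h2 | h2
        · obtain ⟨s, hs, hs0⟩ := intermediate_value_Icc ht.1 (sub ht)
            (show (0 : ℝ) ∈ Icc (γ 0).1 (γ t).1 from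
              ⟨(h1.trans_le (min_le_right _ _)).le, ((le_max_right _ _).trans_lt h2).le⟩)
          exact absurd hs0 (h0 s ⟨hs.1, hs.2.trans ht.2⟩)
        · exact h2
      right
      refine ⟨mem_sliding.2 ⟨(hD 0 ⟨le_rfl, hT⟩).1, h1⟩,
        mem_sliding.2 ⟨(hD T ⟨hT, le_rfl⟩).1, all T ⟨hT, le_rfl⟩⟩,
        awayLE_iff.2 ⟨-M, neg_nonneg.2 (hM2 ?_), ?_⟩⟩
      · exact fun t ht => div_nonpos_of_nonpos_of_nonneg (by linarith) (sliding_denom (all t ht)).le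
      · rw [hM, mul_assoc, ← Real.exp_add]; simp
  · have der : ∀ (z ε : ℝ) (s : ℝ), HasDerivAt (fun s => ((P + z * Real.exp (ε * s), 0) : Pt))
        (ε * (z * Real.exp (ε * s)), 0) s := fun z ε s => by
      refine HasDerivAt.prodMk ?_ (hasDerivAt_const s 0)
      refine ((((hasDerivAt_id' s).const_mul ε).exp.const_mul z).const_add P).congr_deriv ?_
      ring
    rintro (⟨hp, hq, h⟩ | ⟨hp, hq, h⟩)
    · obtain ⟨M, hM, hz⟩ := awayLE_iff.1 h
      have hp' := mem_escaping.1 hp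
      have hq' := mem_escaping.1 hq
      -- The exponential is monotone in `s`, so the curve stays to the right of its left end, which
      -- is `p` or `q` according to the sign of `p.1 - P`.
      have hx : ∀ s ∈ Icc 0 M, max l 0 < P + (p.1 - P) * Real.exp (1 * s) := fun s hs => by
        have e1 : 1 ≤ Real.exp (1 * s) := Real.one_le_exp (by linarith [hs.1])
        have e2 : Real.exp (1 * s) ≤ Real.exp M := Real.exp_le_exp.2 (by linarith [hs.2])
        rcases le_total 0 (p.1 - P) with h | h
        · nlinarith [hp'.2]
        · nlinarith [hq'.2]
      have := reach_of_param (V := (Zv (l, β)).slide) (D := (Zv (l, β)).slidingDomain)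
        (σ := fun s => ((P + (p.1 - P) * Real.exp (1 * s), 0) : Pt))
        (g := fun s => (l - 2 * (P + (p.1 - P) * Real.exp (1 * s))) / (β - 1)) hM
        (by fun_prop) (fun s hs => div_pos_of_neg_of_neg (escaping_denom (hx s hs)) (by linarith))
        (fun s hs => by
          have hmem : ((P + (p.1 - P) * Real.exp (1 * s), 0) : Pt) ∈ (Zv (l, β)).slidingDomain :=
            mem_slidingDomain.2 ⟨rfl, Or.inl (hx s hs)⟩
          refine ⟨hmem, (der _ 1 s).congr_deriv ?_⟩
          rw [slide_eq hβ hmem]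
          have h1 := (escaping_denom (hx s hs)).ne
          have h2 : β - 1 ≠ 0 := by linarith
          refine Prod.ext ?_ (by simp)
          simp only [Prod.smul_mk, smul_eq_mul, ← hP]
          rw [div_mul_div_cancel_mul h1 h2]
          ring)
      convert this using 1
      · exact Prod.ext (by simp) hp'.1
      · exact Prod.ext (by simp only [one_mul, ← hz]; ring) hq'.1
    · obtain ⟨M, hM, hz⟩ := awayLE_iff.1 h
      have hp' := mem_sliding.1 hp
      have hq' := mem_sliding.1 hq
      have hx : ∀ s ∈ Icc 0 M, P + (p.1 - P) * Real.exp (-1 * s) < min l 0 := fun s hs => by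
        have e1 : Real.exp (-1 * s) ≤ 1 := Real.exp_le_one_iff.2 (by linarith [hs.1])
        have e2 : Real.exp (-M) ≤ Real.exp (-1 * s) := Real.exp_le_exp.2 (by linarith [hs.2])
        have e3 : q.1 - P = (p.1 - P) * Real.exp (-M) := by
          rw [hz, mul_assoc, ← Real.exp_add]; simp
        rcases le_total 0 (p.1 - P) with h | h
        · nlinarith [hp'.2]
        · nlinarith [hq'.2]
      have := reach_of_param (V := (Zv (l, β)).slide) (D := (Zv (l, β)).slidingDomain)
        (σ := fun s => ((P + (p.1 - P) * Real.exp (-1 * s), 0) : Pt))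
        (g := fun s => (l - 2 * (P + (p.1 - P) * Real.exp (-1 * s))) / (1 - β)) hM
        (by fun_prop) (fun s hs => div_pos (sliding_denom (hx s hs)) (by linarith))
        (fun s hs => by
          have hmem : ((P + (p.1 - P) * Real.exp (-1 * s), 0) : Pt) ∈ (Zv (l, β)).slidingDomain :=
            mem_slidingDomain.2 ⟨rfl, Or.inr (hx s hs)⟩
          refine ⟨hmem, (der _ (-1) s).congr_deriv ?_⟩
          rw [slide_eq hβ hmem]
          have h1 := (sliding_denom (hx s hs)).ne'
          have h2 : 1 - β ≠ 0 := by linarith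
          refine Prod.ext ?_ (by simp)
          simp only [Prod.smul_mk, smul_eq_mul, ← hP]
          rw [show (β - 1) = -(1 - β) by ring, neg_div,
            neg_mul ((1 - β) / (l - 2 * (P + (p.1 - P) * Real.exp (-1 * s)))), mul_neg,
            div_mul_div_cancel_mul h1 h2]
          ring)
      convert this using 1
      · exact Prod.ext (by simp) hp'.1
      · refine Prod.ext ?_ hq'.1
        simp only [hz, neg_mul, one_mul]
        rw [mul_assoc, ← Real.exp_add]; simp

end FoldSaddle

namespace FoldSaddle

/-! ### Bending a family of level curves -/

/-- The map that carries the curve `x ^ 2 + p = A` to `x ^ 2 + g p = g A`, with `g = gp` for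
`x ≥ 0` and `g = gm` for `x ≤ 0`. -/
noncomputable def bend (gp gm : ℝ ≃o ℝ) (x p : ℝ) : ℝ :=
  if 0 ≤ x then √(gp (x ^ 2 + p) - gp p) else -√(gm (x ^ 2 + p) - gm p)

section bend
variable {gp gm : ℝ ≃o ℝ} {x x' p p' : ℝ}

lemma bend_arg_nonneg (g : ℝ ≃o ℝ) (x p : ℝ) : 0 ≤ g (x ^ 2 + p) - g p :=
  sub_nonneg.2 (g.monotone (by nlinarith))

lemma bend_arg_pos (g : ℝ ≃o ℝ) (hx : x ≠ 0) (p : ℝ) : 0 < g (x ^ 2 + p) - g p :=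
  sub_pos.2 (g.strictMono (by have := sq_pos_of_ne_zero hx; linarith))

lemma bend_zero : bend gp gm 0 p = 0 := by simp [bend]

lemma bend_pos (hx : 0 < x) : 0 < bend gp gm x p := by
  rw [bend, if_pos hx.le]
  exact Real.sqrt_pos.2 (bend_arg_pos _ hx.ne' _)

lemma bend_neg (hx : x < 0) : bend gp gm x p < 0 := by
  rw [bend, if_neg (not_le.2 hx), neg_lt_zero]
  exact Real.sqrt_pos.2 (bend_arg_pos _ hx.ne _)

lemma bend_pos_iff : 0 < bend gp gm x p ↔ 0 < x := by
  refine ⟨fun h => ?_, bend_pos⟩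
  rcases lt_trichotomy x 0 with h0 | rfl | h0
  · exact absurd h (bend_neg h0).not_gt
  · simp [bend_zero] at h
  · exact h0

lemma bend_neg_iff : bend gp gm x p < 0 ↔ x < 0 := by
  refine ⟨fun h => ?_, bend_neg⟩
  rcases lt_trichotomy x 0 with h0 | rfl | h0
  · exact h0
  · simp [bend_zero] at h
  · exact absurd h (bend_pos h0).not_gt

lemma bend_sq_of_nonneg (hx : 0 ≤ x) : bend gp gm x p ^ 2 = gp (x ^ 2 + p) - gp p := by
  rw [bend, if_pos hx, Real.sq_sqrt (bend_arg_nonneg _ _ _)]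

lemma bend_sq_of_nonpos (hx : x ≤ 0) : bend gp gm x p ^ 2 = gm (x ^ 2 + p) - gm p := by
  rcases eq_or_lt_of_le hx with rfl | hx
  · simp [bend_zero]
  · rw [bend, if_neg (not_le.2 hx), neg_sq, Real.sq_sqrt (bend_arg_nonneg _ _ _)]

lemma bend_self_sq (g : ℝ ≃o ℝ) : bend g g x p ^ 2 = g (x ^ 2 + p) - g p :=
  (le_total 0 x).elim bend_sq_of_nonneg bend_sq_of_nonpos

lemma continuous_bend (gp gm : ℝ ≃o ℝ) : Continuous fun q : ℝ × ℝ => bend gp gm q.1 q.2 := by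
  have h1 : Continuous gp := gp.continuous
  have h2 : Continuous gm := gm.continuous
  refine Continuous.if_le (by fun_prop) (by fun_prop) continuous_const continuous_fst ?_
  rintro ⟨x, p⟩ h
  simp only at h
  simp [← h]

/-- The hypotheses say that both halves send the value `p` to the same `p'`. Then `bend ^ 2 + p' = g
(x ^ 2 + p)`, which is inverted by the same recipe with `g.symm`. -/
lemma bend_symm (h1 : gp p = p') (h2 : gm p = p') :
    bend gp.symm gm.symm (bend gp gm x p) p' = x := by
  have e1 : gp.symm p' = p := by rw [← h1]; simp
  have e2 : gm.symm p' = p := by rw [← h2]; simp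
  rcases lt_or_ge x 0 with hx | hx
  · have h := bend_sq_of_nonpos (gp := gp) (gm := gm) (p := p) hx.le
    have h0 : bend gp gm x p < 0 := bend_neg hx
    rw [bend, if_neg (not_le.2 h0), h, h2, sub_add_cancel, e2]
    simp [Real.sqrt_sq_eq_abs, abs_of_neg hx]
  · have h := bend_sq_of_nonneg (gp := gp) (gm := gm) (p := p) hx
    have h0 : 0 ≤ bend gp gm x p := by
      by_contra! h0
      exact (bend_neg_iff.1 h0).not_ge hx
    rw [bend, if_pos h0, h, h1, sub_add_cancel, e1]
    simp [Real.sqrt_sq hx]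

/-- On a level curve, bending preserves the order of abscissae. -/
lemma bend_le (hA : x ^ 2 + p = x' ^ 2 + p') (h : x ≤ x') :
    bend gp gm x p ≤ bend gp gm x' p' := by
  rcases lt_or_ge x 0 with hx | hx
  · rcases lt_or_ge x' 0 with hx' | hx'
    · rw [bend, bend, if_neg (not_le.2 hx), if_neg (not_le.2 hx'), neg_le_neg_iff, hA]
      have : p ≤ p' := by nlinarith
      exact Real.sqrt_le_sqrt (by linarith [gm.monotone this])
    · refine (bend_neg hx).le.trans ?_
      rw [bend, if_pos hx']; positivity
  · rw [bend, bend, if_pos hx, if_pos (hx.trans h), hA]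
    have : p' ≤ p := by nlinarith
    exact Real.sqrt_le_sqrt (by linarith [gp.monotone this])

end bend

/-! ### The conjugating homeomorphism -/

/-- The map with parameters `(l, β)`, `(l', β')`. -/
noncomputable def conjFun (l β l' β' : ℝ) (g gp gm W : ℝ ≃o ℝ) (q : Pt) : Pt :=
  if 0 ≤ q.2 then (l' + bend gp gm (q.1 - l) (-2 * q.2), q.2)
  else (bend g g q.1 (β ^ 2 - (q.2 + β) ^ 2), W (q.2 + β) - β')

/-- Compatibility conditions under which `conjFun` is a homeomorphism that restricts to `φ`
on `Σ`. -/
structure ConjData (l β l' β' : ℝ) (φ g gp gm W : ℝ ≃o ℝ) : Prop where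
  map_l : φ l = l'
  map_zero : φ 0 = 0
  gp_neg : ∀ A ≤ 0, gp A = A
  gm_neg : ∀ A ≤ 0, gm A = A
  gp_sq : ∀ s, 0 ≤ s → gp (s ^ 2) = (φ (l + s) - l') ^ 2
  gm_sq : ∀ s, 0 ≤ s → gm (s ^ 2) = (φ (l - s) - l') ^ 2
  g_sq : ∀ x, g (x ^ 2) = φ x ^ 2
  W_zero : W 0 = 0
  W_end : W β = β'
  W_sq : ∀ w ≤ β, W w ^ 2 = β' ^ 2 - g (β ^ 2 - w ^ 2)

namespace ConjData
variable {l β l' β' : ℝ} {φ g gp gm W : ℝ ≃o ℝ}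

lemma symm (h : ConjData l β l' β' φ g gp gm W) :
    ConjData l' β' l β φ.symm g.symm gp.symm gm.symm W.symm where
  map_l := by rw [OrderIso.symm_apply_eq, h.map_l]
  map_zero := by rw [OrderIso.symm_apply_eq, h.map_zero]
  gp_neg A hA := by rw [OrderIso.symm_apply_eq, h.gp_neg A hA]
  gm_neg A hA := by rw [OrderIso.symm_apply_eq, h.gm_neg A hA]
  gp_sq s hs := by
    have h1 : 0 ≤ φ.symm (l' + s) - l := by
      rw [sub_nonneg, OrderIso.le_symm_apply, h.map_l]; linarith
    rw [OrderIso.symm_apply_eq, h.gp_sq _ h1]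
    simp
  gm_sq s hs := by
    have h1 : 0 ≤ l - φ.symm (l' - s) := by
      rw [sub_nonneg, OrderIso.symm_apply_le, h.map_l]; linarith
    rw [OrderIso.symm_apply_eq, show (φ.symm (l' - s) - l) ^ 2 = (l - φ.symm (l' - s)) ^ 2 by ring,
      h.gm_sq _ h1]
    simp
  g_sq x := by rw [OrderIso.symm_apply_eq, h.g_sq]; simp
  W_zero := by rw [OrderIso.symm_apply_eq, h.W_zero]
  W_end := by rw [OrderIso.symm_apply_eq, h.W_end]
  W_sq w hw := by
    have h1 : W.symm w ≤ β := by rw [OrderIso.symm_apply_le, h.W_end]; exact hw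
    have := h.W_sq _ h1
    rw [OrderIso.apply_symm_apply] at this
    have h2 : g.symm (β' ^ 2 - w ^ 2) = β ^ 2 - W.symm w ^ 2 := by
      rw [OrderIso.symm_apply_eq]; linarith
    rw [h2]; ring

lemma g_zero (h : ConjData l β l' β' φ g gp gm W) : g 0 = 0 := by
  simpa [h.map_zero] using h.g_sq 0

/-- Together with `conjFun_boundary_upper` this glues the two halves of `conjFun`: both formulas
reduce to `φ` on `Σ`. -/
lemma bend_boundary (h : ConjData l β l' β' φ g gp gm W) (x : ℝ) : bend g g x 0 = φ x := by
  rw [bend, add_zero, h.g_zero, sub_zero, h.g_sq, Real.sqrt_sq_eq_abs]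
  split_ifs with h0
  · rw [abs_of_nonneg]; rw [← h.map_zero]; exact φ.monotone h0
  · rw [abs_of_nonpos, neg_neg]; rw [← h.map_zero]; exact φ.monotone (le_of_not_ge h0)

lemma conjFun_boundary_upper (h : ConjData l β l' β' φ g gp gm W) (x : ℝ) :
    l' + bend gp gm (x - l) 0 = φ x := by
  rw [bend, add_zero, h.gp_neg 0 le_rfl, h.gm_neg 0 le_rfl, sub_zero, sub_zero]
  split_ifs with h0
  · rw [h.gp_sq _ h0, Real.sqrt_sq]
    · rw [add_sub_cancel l x]; ring
    · rw [add_sub_cancel, sub_nonneg, ← h.map_l]; exact φ.monotone (by linarith)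
  · rw [show (x - l) ^ 2 = (l - x) ^ 2 by ring, h.gm_sq _ (by linarith), Real.sqrt_sq_eq_abs,
      sub_sub_cancel, abs_of_nonpos]
    · ring
    · rw [sub_nonpos, ← h.map_l]; exact φ.monotone (by linarith)

lemma conjFun_of_nonneg {q : Pt} (hq : 0 ≤ q.2) : conjFun l β l' β' g gp gm W q =
    (l' + bend gp gm (q.1 - l) (-2 * q.2), q.2) := if_pos hq

lemma conjFun_of_nonpos (h : ConjData l β l' β' φ g gp gm W) {q : Pt} (hq : q.2 ≤ 0) :
    conjFun l β l' β' g gp gm W q =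
      (bend g g q.1 (β ^ 2 - (q.2 + β) ^ 2), W (q.2 + β) - β') := by
  rcases eq_or_lt_of_le hq with h0 | h0
  · rw [conjFun, if_pos h0.ge, h0, zero_add, h.W_end, mul_zero, h.conjFun_boundary_upper,
      sub_self, sub_self, h.bend_boundary]
  · exact if_neg (not_le.2 h0)

lemma conjFun_boundary (h : ConjData l β l' β' φ g gp gm W) (x : ℝ) :
    conjFun l β l' β' g gp gm W (x, 0) = (φ x, 0) := by
  rw [conjFun_of_nonneg le_rfl, mul_zero, h.conjFun_boundary_upper]

lemma continuous_conjFun (h : ConjData l β l' β' φ g gp gm W) :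
    Continuous (conjFun l β l' β' g gp gm W) := by
  have hW : Continuous W := W.continuous
  have h1 := continuous_bend gp gm
  have h2 := continuous_bend g g
  refine Continuous.if_le ?_ ?_ continuous_const continuous_snd ?_
  · refine Continuous.prodMk ?_ continuous_snd
    exact continuous_const.add (h1.comp (f := fun q : Pt => (q.1 - l, -2 * q.2)) (by fun_prop))
  · refine Continuous.prodMk ?_ (by fun_prop)
    exact h2.comp (f := fun q : Pt => (q.1, β ^ 2 - (q.2 + β) ^ 2)) (by fun_prop)
  · intro q hq
    have := h.conjFun_of_nonpos hq.ge
    rwa [conjFun_of_nonneg hq.le] at this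

lemma g_level (h : ConjData l β l' β' φ g gp gm W) {y : ℝ} (hy : y ≤ 0) :
    g (β ^ 2 - (y + β) ^ 2) = β' ^ 2 - (W (y + β) - β' + β') ^ 2 := by
  rw [sub_add_cancel, h.W_sq _ (by linarith)]; ring

lemma conjFun_snd_nonpos (h : ConjData l β l' β' φ g gp gm W) {q : Pt} (hq : q.2 ≤ 0) :
    (conjFun l β l' β' g gp gm W q).2 ≤ 0 := by
  rw [h.conjFun_of_nonpos hq, sub_nonpos, ← h.W_end]
  exact W.monotone (by linarith)

lemma leftInverse (h : ConjData l β l' β' φ g gp gm W) (q : Pt) :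
    conjFun l' β' l β g.symm gp.symm gm.symm W.symm (conjFun l β l' β' g gp gm W q) = q := by
  rcases le_total 0 q.2 with hq | hq
  · rw [conjFun_of_nonneg hq,
      conjFun_of_nonneg (q := (l' + bend gp gm (q.1 - l) (-2 * q.2), q.2)) hq]
    simp only
    -- `gp` and `gm` are the identity on the nonpositive half-line, hence at `-2 * y`. That is why
    -- the upper half of the map can keep the ordinate.
    rw [add_sub_cancel_left, bend_symm (h.gp_neg _ (by linarith)) (h.gm_neg _ (by linarith))]
    simp
  · have := h.conjFun_snd_nonpos hq
    rw [h.conjFun_of_nonpos hq] at this ⊢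
    rw [h.symm.conjFun_of_nonpos this]
    simp only
    rw [bend_symm (h.g_level hq) (h.g_level hq)]
    simp

/-- The homeomorphism given by `conjFun`. -/
noncomputable def homeo (h : ConjData l β l' β' φ g gp gm W) : Pt ≃ₜ Pt where
  toFun := conjFun l β l' β' g gp gm W
  invFun := conjFun l' β' l β g.symm gp.symm gm.symm W.symm
  left_inv := h.leftInverse
  right_inv := h.symm.leftInverse
  continuous_toFun := h.continuous_conjFun
  continuous_invFun := h.symm.continuous_conjFun

end ConjData

/-! ### Signs and sectors of the saddle -/

lemma image_eq_of_mem_iff {h : Pt ≃ₜ Pt} {S S' : Set Pt} (H : ∀ p, p ∈ S ↔ h p ∈ S') :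
    h '' S = S' := by
  ext p
  constructor
  · rintro ⟨q, hq, rfl⟩
    exact (H q).1 hq
  · intro hp
    exact ⟨h.symm p, (H _).2 (by simpa using hp), by simp⟩

/-- `a` and `b` have the same sign. -/
def SameSign (a b : ℝ) : Prop := (0 < a ↔ 0 < b) ∧ (a < 0 ↔ b < 0)

lemma SameSign.neg {a b : ℝ} (h : SameSign a b) : SameSign (-a) (-b) := by
  simpa [SameSign, and_comm] using h

lemma SameSign.nonneg {a b : ℝ} (h : SameSign a b) : 0 ≤ a ↔ 0 ≤ b := by
  rw [← not_lt, ← not_lt, h.2]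

lemma SameSign.nonpos {a b : ℝ} (h : SameSign a b) : a ≤ 0 ↔ b ≤ 0 := by
  rw [← not_lt, ← not_lt, h.1]

/-- `(x, w)` and `(X, V)` lie in the same sector of the saddle `ẋ = -w`, `ẇ = -x`. -/
def SameSector (x w X V : ℝ) : Prop :=
  SameSign x X ∧ SameSign w V ∧ SameSign (x ^ 2 - w ^ 2) (X ^ 2 - V ^ 2)

section sector
variable {x w X V x' w' X' V' : ℝ}

lemma SameSector.neg (h : SameSector x w X V) : SameSector (-x) (-w) (-X) (-V) :=
  ⟨h.1.neg, h.2.1.neg, by simpa using h.2.2⟩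

lemma SameSector.neg_right (h : SameSector x w X V) : SameSector x (-w) X (-V) :=
  ⟨h.1, h.2.1.neg, by simpa using h.2.2⟩

lemma SameSector.neg_left (h : SameSector x w X V) : SameSector (-x) w (-X) V :=
  ⟨h.1.neg, h.2.1, by simpa using h.2.2⟩

/-- The sign of `x - w` can be recovered from those of `x`, `w` and `x ^ 2 - w ^ 2`: if `x` and `w`
have the same sign, the last one compares their absolute values. -/
lemma SameSector.sub_pos (h : SameSector x w X V) (hv : 0 < x - w) : 0 < X - V := by
  obtain ⟨h1, h2, h3⟩ := h
  rcases lt_or_ge w 0 with hw | hw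
  · have hV := h2.2.1 hw
    rcases lt_or_ge x 0 with hx | hx
    · have hX := h1.2.1 hx
      have := h3.2.1 (by nlinarith)
      nlinarith
    · have := h1.nonneg.1 hx
      linarith
  · have hV := h2.nonneg.1 hw
    have hX := h1.1.1 (by linarith)
    have := h3.1.1 (by nlinarith)
    nlinarith

lemma SameSector.sub_nonneg (h : SameSector x w X V) (hv : 0 ≤ x - w) : 0 ≤ X - V := by
  rcases eq_or_lt_of_le hv with h0 | h0
  · have hxw : x = w := by linarith
    obtain ⟨h1, h2, h3⟩ := h
    subst hxw
    simp only [SameSign, sub_self, lt_self_iff_false, false_iff, not_lt] at h3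
    have h4 : X ^ 2 = V ^ 2 := by linarith [h3.1, h3.2]
    rcases sq_eq_sq_iff_eq_or_eq_neg.1 h4 with h5 | h5
    · linarith
    · rcases lt_trichotomy x 0 with hx | hx | hx
      · have := h1.2.1 hx; have := h2.2.1 hx; linarith
      · have := h1.nonneg.1 hx.ge; have := h2.nonpos.1 hx.le; linarith
      · have := h1.1.1 hx; have := h2.1.1 hx; linarith
  · exact (h.sub_pos h0).le

/-- Along a hyperbola with `v = x - w > 0` increasing, `w` decreases if `u = x + w ≥ 0`, and `x`
increases if `u < 0`. A map that is monotone in `x` and in `w` along the level thus respects the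
order by `v`: reversing that order would contradict one of the two monotonicities. -/
lemma SameSector.le_of_pos (h : SameSector x w X V) (h' : SameSector x' w' X' V')
    (hk : x ^ 2 - w ^ 2 = x' ^ 2 - w' ^ 2) (hK : X ^ 2 - V ^ 2 = X' ^ 2 - V' ^ 2)
    (mw : w' ≤ w → V' ≤ V) (mx : x ≤ x' → X ≤ X') (hv : 0 < x - w) (hvv : x - w ≤ x' - w') :
    0 < X - V ∧ X - V ≤ X' - V' := by
  have hV := h.sub_pos hv
  have hV' := h'.sub_pos (hv.trans_le hvv)
  refine ⟨hV, ?_⟩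
  by_contra! hc
  rcases le_or_gt 0 (x + w) with hu | hu
  · have hu' : 0 ≤ x' + w' := by
      by_contra! h0
      nlinarith
    have huu : x' + w' ≤ x + w := by
      by_contra! h0
      nlinarith
    have := mw (by linarith)
    have hU' : 0 ≤ X' + V' := by
      simpa using h'.neg_right.sub_nonneg (by linarith)
    nlinarith
  · have hu' : x' + w' < 0 := by
      by_contra! h0
      nlinarith
    have huu : x + w ≤ x' + w' := by
      by_contra! h0
      nlinarith
    have := mx (by linarith)
    have hU' : 0 < -X' - V' := by
      simpa using h'.neg_left.sub_pos (by linarith)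
    nlinarith

/-- The four cases with a nonzero clock are one case up to symmetry. `(x, w) ↦ (-x, -w)` changes the
sign of `v`; the reflections in one axis exchange `u` and `v` up to sign and reverse time, so there
the two points trade places. -/
lemma SaddleLE.transfer (h : SameSector x w X V) (h' : SameSector x' w' X' V')
    (hK : X ^ 2 - V ^ 2 = X' ^ 2 - V' ^ 2)
    (mw : w' ≤ w → V' ≤ V) (mw' : w ≤ w' → V ≤ V') (mx : x ≤ x' → X ≤ X') (mx' : x' ≤ x → X' ≤ X)
    (hs : SaddleLE (x + w) (x - w) (x' + w') (x' - w')) :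
    SaddleLE (X + V) (X - V) (X' + V') (X' - V') := by
  obtain ⟨hp, hs⟩ := hs
  have hk : x ^ 2 - w ^ 2 = x' ^ 2 - w' ^ 2 := by linarith
  refine ⟨by linarith, ?_⟩
  rcases hs with ⟨h1, h2⟩ | ⟨h1, h2⟩ | ⟨h1, h2⟩ | ⟨h1, h2⟩ | ⟨h1, h2⟩
  · exact Or.inl (h.le_of_pos h' hk hK mw mx h1 h2)
  · have := h.neg.le_of_pos h'.neg (by linarith) (by linarith)
      (fun h => neg_le_neg (mw' (neg_le_neg_iff.1 h)))
        (fun h => neg_le_neg (mx' (neg_le_neg_iff.1 h)))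
      (by linarith) (by linarith)
    exact Or.inr (Or.inl ⟨by linarith [this.1], by linarith [this.2]⟩)
  · have := h'.neg_right.le_of_pos h.neg_right (by linarith) (by linarith)
      (fun h => neg_le_neg (mw (neg_le_neg_iff.1 h))) mx' (by linarith) (by linarith)
    exact Or.inr (Or.inr (Or.inl ⟨by linarith [this.1], by linarith [this.2]⟩))
  · have := h'.neg_left.le_of_pos h.neg_left (by linarith) (by linarith) mw'
      (fun h => neg_le_neg (mx (neg_le_neg_iff.1 h))) (by linarith) (by linarith)
    exact Or.inr (Or.inr (Or.inr (Or.inl ⟨by linarith [this.1], by linarith [this.2]⟩)))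
  · have e1 : X ≤ X' := mx (by linarith)
    have e2 : X' ≤ X := mx' (by linarith)
    have e3 : V ≤ V' := mw' (by linarith)
    have e4 : V' ≤ V := mw (by linarith)
    exact Or.inr (Or.inr (Or.inr (Or.inr ⟨by linarith, by linarith⟩)))

end sector

/-! ### Action of the conjugating homeomorphism on trajectories -/

namespace ConjData
variable {l β l' β' : ℝ} {φ g gp gm W : ℝ ≃o ℝ}

/-- The level `A` goes to `gp A` to the right of the fold and to `gm A` to the left. A trajectory of
positive level stays on one side; on levels `A ≤ 0`, which may cross `x = l`, both maps are the
identity. -/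
lemma reach_X (h : ConjData l β l' β' φ g gp gm W) {p q : Pt}
    (hr : Reach (Zv (l, β)).X upper p q) :
    Reach (Zv (l', β')).X upper (conjFun l β l' β' g gp gm W p)
      (conjFun l β l' β' g gp gm W q) := by
  obtain ⟨hp, hq, hA, hx, hs⟩ := reach_X_iff.1 hr
  rw [reach_X_iff, conjFun_of_nonneg hp, conjFun_of_nonneg hq]
  have key : ∀ r : Pt, 0 ≤ r.2 →
      (0 ≤ r.1 - l → intX l' (l' + bend gp gm (r.1 - l) (-2 * r.2), r.2) = gp (intX l r)) ∧
      (r.1 - l ≤ 0 → intX l' (l' + bend gp gm (r.1 - l) (-2 * r.2), r.2) = gm (intX l r)) := by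
    intro r hr
    constructor
    · intro h0
      have := bend_sq_of_nonneg (gp := gp) (gm := gm) (p := -2 * r.2) h0
      rw [h.gp_neg (-2 * r.2) (by linarith)] at this
      simp only [intX, add_sub_cancel_left]
      rw [this]; ring_nf
    · intro h0
      have := bend_sq_of_nonpos (gp := gp) (gm := gm) (p := -2 * r.2) h0
      rw [h.gm_neg (-2 * r.2) (by linarith)] at this
      simp only [intX, add_sub_cancel_left]
      rw [this]; ring_nf
  have hle : bend gp gm (p.1 - l) (-2 * p.2) ≤ bend gp gm (q.1 - l) (-2 * q.2) :=
    bend_le (by simp only [intX] at hA; linarith) (by linarith)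
  refine ⟨hp, hq, ?_, by simpa using hle, fun hpos => ?_⟩
  · rcases lt_or_ge 0 (intX l p) with h0 | h0
    · rcases le_total 0 (p.1 - l) with h1 | h1
      · have h2 : 0 ≤ q.1 - l := by linarith
        rw [(key p hp).1 h1, (key q hq).1 h2, hA]
      · have h2 : q.1 - l ≤ 0 := by
          by_contra! h2
          nlinarith [hs h0]
        rw [(key p hp).2 h1, (key q hq).2 h2, hA]
    · have e : ∀ r : Pt, 0 ≤ r.2 → intX l r ≤ 0 →
          intX l' (l' + bend gp gm (r.1 - l) (-2 * r.2), r.2) = intX l r := fun r hr h0 => by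
        rcases le_total 0 (r.1 - l) with h1 | h1
        · rw [(key r hr).1 h1, h.gp_neg _ h0]
        · rw [(key r hr).2 h1, h.gm_neg _ h0]
      rw [e p hp h0, e q hq (hA ▸ h0), hA]
  · have h0 : 0 < intX l p := by
      by_contra! h0
      rcases le_total 0 (p.1 - l) with h1 | h1
      · rw [(key p hp).1 h1, h.gp_neg _ h0] at hpos; linarith
      · rw [(key p hp).2 h1, h.gm_neg _ h0] at hpos; linarith
    simp only [add_sub_cancel_left]
    rcases pos_and_pos_or_neg_and_neg_of_mul_pos (hs h0) with ⟨h1, h2⟩ | ⟨h1, h2⟩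
    · exact mul_pos (bend_pos h1) (bend_pos h2)
    · exact mul_pos_of_neg_of_neg (bend_neg h1) (bend_neg h2)

lemma intY_conjFun (h : ConjData l β l' β' φ g gp gm W) {r : Pt} (hr : r.2 ≤ 0) :
    intY β' (conjFun l β l' β' g gp gm W r) = g (intY β r) := by
  rw [h.conjFun_of_nonpos hr]
  have := bend_self_sq (x := r.1) (p := β ^ 2 - (r.2 + β) ^ 2) g
  have h2 := h.g_level hr
  simp only [intY]
  rw [this, h2]; ring_nf

/-- Levels of `intY` are mapped by `g`. For `β < 0` the order by abscissa on a level suffices. For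
`β ≥ 0` the saddle lies in `Σ₋`, and the orbit order is transferred sector by sector, with `bend`
monotone in `x` along levels and `W` monotone in `y + β`. -/
lemma reach_Y (h : ConjData l β l' β' φ g gp gm W) {p q : Pt}
    (hr : Reach (Zv (l, β)).Y lower p q) :
    Reach (Zv (l', β')).Y lower (conjFun l β l' β' g gp gm W p)
      (conjFun l β l' β' g gp gm W q) := by
  have hgpos : ∀ {A}, 0 < g A ↔ 0 < A := fun {A} => by
    conv_lhs => rw [← h.g_zero]
    exact g.lt_iff_lt
  rcases lt_or_ge β 0 with hβ | hβ
  · have hβ' : β' < 0 := by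
      rw [← h.W_end, ← h.W_zero]; exact W.strictMono hβ
    obtain ⟨hp, hq, hA, hx, hs⟩ := (reach_Y_iff_of_neg hβ).1 hr
    refine (reach_Y_iff_of_neg hβ').2 ⟨h.conjFun_snd_nonpos hp, h.conjFun_snd_nonpos hq, ?_, ?_, ?_⟩
    · rw [h.intY_conjFun hp, h.intY_conjFun hq, hA]
    · rw [h.conjFun_of_nonpos hp, h.conjFun_of_nonpos hq]
      exact bend_le (by simp only [intY] at hA; linarith) hx
    · intro hpos
      rw [h.intY_conjFun hp, hgpos] at hpos
      rw [h.conjFun_of_nonpos hp, h.conjFun_of_nonpos hq]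
      rcases pos_and_pos_or_neg_and_neg_of_mul_pos (hs hpos) with ⟨h1, h2⟩ | ⟨h1, h2⟩
      · exact mul_pos (bend_pos h1) (bend_pos h2)
      · exact mul_pos_of_neg_of_neg (bend_neg h1) (bend_neg h2)
  · have hβ' : 0 ≤ β' := by
      rw [← h.W_end, ← h.W_zero]; exact W.monotone hβ
    obtain ⟨hp, hq, ho⟩ := (reach_Y_iff_of_nonneg hβ).1 hr
    refine (reach_Y_iff_of_nonneg hβ').2 ⟨h.conjFun_snd_nonpos hp, h.conjFun_snd_nonpos hq, ?_⟩
    have hA : intY β p = intY β q := by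
      have := ho.1
      simp only [intY]; linarith
    -- The separatrices form the level `intY = β ^ 2`. They have to go to separatrices for sectors
    -- to correspond.
    have hgβ : g (β ^ 2) = β' ^ 2 := by
      have := h.W_sq 0 hβ
      rw [h.W_zero] at this
      simp at this; linarith
    have hIp := h.intY_conjFun hp
    have hIq := h.intY_conjFun hq
    have sector : ∀ {r : Pt}, r.2 ≤ 0 →
        SameSector r.1 (r.2 + β) (conjFun l β l' β' g gp gm W r).1
          ((conjFun l β l' β' g gp gm W r).2 + β') := by
      intro r hr
      have hI := h.intY_conjFun hr
      have e1 : (conjFun l β l' β' g gp gm W r).1 ^ 2 -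
          ((conjFun l β l' β' g gp gm W r).2 + β') ^ 2 = g (intY β r) - g (β ^ 2) := by
        rw [hgβ, ← hI]; simp only [intY]; ring
      have e2 : r.1 ^ 2 - (r.2 + β) ^ 2 = intY β r - β ^ 2 := by simp only [intY]; ring
      refine ⟨?_, ?_, ?_⟩
      · rw [h.conjFun_of_nonpos hr]
        exact ⟨bend_pos_iff.symm, bend_neg_iff.symm⟩
      · rw [h.conjFun_of_nonpos hr]
        simp only [sub_add_cancel, SameSign]
        constructor
        · conv_rhs => rw [← h.W_zero]
          exact W.lt_iff_lt.symm
        · conv_rhs => rw [← h.W_zero]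
          exact W.lt_iff_lt.symm
      · rw [e1, e2, SameSign, sub_pos, sub_pos, sub_neg, sub_neg, g.lt_iff_lt, g.lt_iff_lt]
        exact ⟨Iff.rfl, Iff.rfl⟩
    have hA' : p.1 ^ 2 + (β ^ 2 - (p.2 + β) ^ 2) = q.1 ^ 2 + (β ^ 2 - (q.2 + β) ^ 2) := by
      simp only [intY] at hA; linarith
    have mw : ∀ {r s : Pt}, r.2 ≤ 0 → s.2 ≤ 0 → r.2 + β ≤ s.2 + β →
        (conjFun l β l' β' g gp gm W r).2 + β' ≤ (conjFun l β l' β' g gp gm W s).2 + β' := by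
      intro r s hr hs hrs
      rw [h.conjFun_of_nonpos hr, h.conjFun_of_nonpos hs]
      simpa using hrs
    refine SaddleLE.transfer (sector hp) (sector hq) ?_ (mw hq hp) (mw hp hq) ?_ ?_ ho
    · simp only [intY] at hIp hIq hA
      rw [hA, ← hIq] at hIp; linarith
    · intro hx
      rw [h.conjFun_of_nonpos hp, h.conjFun_of_nonpos hq]
      exact bend_le hA' hx
    · intro hx
      rw [h.conjFun_of_nonpos hp, h.conjFun_of_nonpos hq]
      exact bend_le hA'.symm hx

lemma homeo_boundary (h : ConjData l β l' β' φ g gp gm W) (x : ℝ) : h.homeo (x, 0) = (φ x, 0) :=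
  h.conjFun_boundary x

lemma preservesSides (h : ConjData l β l' β' φ g gp gm W) : PreservesSides h.homeo := by
  have up : ∀ {l β l' β' : ℝ} {φ g gp gm W : ℝ ≃o ℝ} (_ : ConjData l β l' β' φ g gp gm W) {q : Pt},
      q ∈ upper → conjFun l β l' β' g gp gm W q ∈ upper := by
    intro _ _ _ _ _ _ _ _ _ _ q hq
    rw [conjFun_of_nonneg hq]; exact hq
  constructor
  · refine image_eq_of_mem_iff fun q => ⟨up h, fun hq => ?_⟩
    have := up h.symm hq
    rwa [show h.homeo q = conjFun l β l' β' g gp gm W q from rfl, h.leftInverse] at this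
  · refine image_eq_of_mem_iff fun q => ⟨h.conjFun_snd_nonpos, fun hq => ?_⟩
    have := h.symm.conjFun_snd_nonpos hq
    rwa [show h.homeo q = conjFun l β l' β' g gp gm W q from rfl, h.leftInverse] at this

lemma carriesUpper (h : ConjData l β l' β' φ g gp gm W) :
    CarriesUpper h.homeo (Zv (l, β)) (Zv (l', β')) := by
  refine ⟨h.preservesSides, fun p q => ⟨h.reach_X, fun hr => ?_⟩⟩
  have := h.symm.reach_X hr
  change Reach _ _ (conjFun _ _ _ _ _ _ _ _ (conjFun _ _ _ _ _ _ _ _ _))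
    (conjFun _ _ _ _ _ _ _ _ (conjFun _ _ _ _ _ _ _ _ _)) at this
  rwa [h.leftInverse, h.leftInverse] at this

lemma carriesLower (h : ConjData l β l' β' φ g gp gm W) :
    CarriesLower h.homeo (Zv (l, β)) (Zv (l', β')) := by
  refine ⟨h.preservesSides, fun p q => ⟨h.reach_Y, fun hr => ?_⟩⟩
  have := h.symm.reach_Y hr
  change Reach _ _ (conjFun _ _ _ _ _ _ _ _ (conjFun _ _ _ _ _ _ _ _ _))
    (conjFun _ _ _ _ _ _ _ _ (conjFun _ _ _ _ _ _ _ _ _)) at this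
  rwa [h.leftInverse, h.leftInverse] at this

end ConjData

end FoldSaddle

namespace FoldSaddle

/-! ### Order isomorphisms of the line -/

lemma bend_mono (G : ℝ ≃o ℝ) : Monotone fun x => bend G G x 0 := by
  intro x y hxy
  rcases lt_or_ge x 0 with hx | hx
  · rcases lt_or_ge y 0 with hy | hy
    · simp only [bend, if_neg (not_le.2 hx), if_neg (not_le.2 hy), neg_le_neg_iff, add_zero]
      have : y ^ 2 ≤ x ^ 2 := by nlinarith
      exact Real.sqrt_le_sqrt (by linarith [G.monotone this])
    · refine (bend_neg hx).le.trans ?_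
      simp only [bend, if_pos hy]; positivity
  · simp only [bend, if_pos hx, if_pos (hx.trans hxy), add_zero]
    have : x ^ 2 ≤ y ^ 2 := by nlinarith
    exact Real.sqrt_le_sqrt (by linarith [G.monotone this])

lemma exists_orderIso_sq (G : ℝ ≃o ℝ) (hG : G 0 = 0) :
    ∃ W : ℝ ≃o ℝ, W 0 = 0 ∧ ∀ w, W w ^ 2 = G (w ^ 2) := by
  have hG' : G.symm 0 = 0 := by rw [OrderIso.symm_apply_eq, hG]
  let e : ℝ ≃ ℝ :=
    { toFun := fun x => bend G G x 0
      invFun := fun x => bend G.symm G.symm x 0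
      left_inv := fun x => bend_symm hG hG
      right_inv := fun x => bend_symm (gp := G.symm) (gm := G.symm) hG' hG' }
  refine ⟨e.toOrderIso (bend_mono G) (bend_mono G.symm), bend_zero, fun w => ?_⟩
  have := bend_self_sq (x := w) (p := 0) G
  rw [hG, add_zero, sub_zero] at this
  exact this

/-- Multiplication by `c` on the negative half-line, `s ^ 2 ↦ ψ s ^ 2` on the positive one. -/
noncomputable def sqMap (c : ℝ) (ψ : ℝ ≃o ℝ) (A : ℝ) : ℝ := if A ≤ 0 then c * A else ψ √A ^ 2

lemma sqMap_mono {c : ℝ} (hc : 0 < c) {ψ : ℝ ≃o ℝ} (hψ : ψ 0 = 0) : Monotone (sqMap c ψ) := by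
  have hpos : ∀ {x}, 0 ≤ x → 0 ≤ ψ x := fun h => by rw [← hψ]; exact ψ.monotone h
  intro x y hxy
  rw [sqMap, sqMap]
  split_ifs with h1 h2 h2
  · exact mul_le_mul_of_nonneg_left hxy hc.le
  · exact (mul_nonpos_of_nonneg_of_nonpos hc.le h1).trans (sq_nonneg _)
  · linarith
  · exact pow_le_pow_left₀ (hpos (Real.sqrt_nonneg _)) (ψ.monotone (Real.sqrt_le_sqrt hxy)) 2

lemma sqMap_symm {c : ℝ} (hc : 0 < c) {ψ : ℝ ≃o ℝ} (hψ : ψ 0 = 0) (A : ℝ) :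
    sqMap c⁻¹ ψ.symm (sqMap c ψ A) = A := by
  by_cases h : A ≤ 0
  · rw [sqMap, sqMap, if_pos h, if_pos (mul_nonpos_of_nonneg_of_nonpos hc.le h),
      inv_mul_cancel_left₀ hc.ne']
  · rw [not_le] at h
    have h1 : 0 < ψ √A := by
      rw [← hψ]; exact ψ.strictMono (Real.sqrt_pos.2 h)
    rw [sqMap, sqMap, if_neg (not_le.2 h), if_neg (not_le.2 (pow_pos h1 2)), Real.sqrt_sq h1.le,
      OrderIso.symm_apply_apply, Real.sq_sqrt h.le]

lemma exists_orderIso_sqMap {c : ℝ} (hc : 0 < c) (ψ : ℝ ≃o ℝ) (hψ : ψ 0 = 0) :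
    ∃ G : ℝ ≃o ℝ, (∀ A ≤ 0, G A = c * A) ∧ ∀ s, 0 ≤ s → G (s ^ 2) = ψ s ^ 2 := by
  have hψ' : ψ.symm 0 = 0 := by rw [OrderIso.symm_apply_eq, hψ]
  let e : ℝ ≃ ℝ :=
    { toFun := sqMap c ψ
      invFun := sqMap c⁻¹ ψ.symm
      left_inv := sqMap_symm hc hψ
      right_inv := fun A => by
        have := sqMap_symm (inv_pos.2 hc) hψ' A
        rwa [inv_inv] at this }
  refine ⟨e.toOrderIso (sqMap_mono hc hψ) (sqMap_mono (inv_pos.2 hc) hψ'), fun A hA => if_pos hA,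
    fun s hs => ?_⟩
  change sqMap c ψ (s ^ 2) = _
  rcases eq_or_lt_of_le hs with rfl | hs
  · simp [sqMap, hψ]
  · rw [sqMap, if_neg (not_le.2 (pow_pos hs 2)), Real.sqrt_sq hs.le]

/-- The affine order isomorphism `x ↦ b + c * (x - a)`. -/
noncomputable def affIso (a b c : ℝ) (hc : 0 < c) : ℝ ≃o ℝ :=
  Equiv.toOrderIso
    { toFun := fun x => b + c * (x - a)
      invFun := fun x => a + c⁻¹ * (x - b)
      left_inv := fun x => by field_simp; ring
      right_inv := fun x => by field_simp; ring }
    (fun x y h => by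
      have := mul_le_mul_of_nonneg_left h hc.le
      simp only [Equiv.coe_fn_mk]; linarith)
    (fun x y h => by
      have := mul_le_mul_of_nonneg_left h (inv_pos.2 hc).le
      simp only [Equiv.coe_fn_symm_mk]; linarith)

lemma affIso_apply {a b c : ℝ} (hc : 0 < c) (x : ℝ) : affIso a b c hc x = b + c * (x - a) := rfl

/-- The arcs of level `A > 0` meet `Σ` at `l ± √A` above and `±√A` below, so `φ` dictates `gp`, `gm`
and `g` on positive levels; one `g` can serve both signs of `x` since `φ` is odd. It remains to
match `W` with `g`. For `β ≤ 0` only nonpositive values `β ^ 2 - w ^ 2` occur, so `W` may be linear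
of slope `c` and `g` multiplication by `c ^ 2` there. For `β > 0` positive values occur as well and
`g` determines `W`. -/
lemma exists_conjData {l β l' β' : ℝ} (φ : ℝ ≃o ℝ) (hodd : ∀ x, φ (-x) = -φ x) (hl : φ l = l')
    (hβ : (β < 0 ∧ β' < 0) ∨ (β = 0 ∧ β' = 0) ∨ (0 < β ∧ 0 < β' ∧ φ β = β')) :
    ∃ g gp gm W, ConjData l β l' β' φ g gp gm W := by
  have h0 : φ 0 = 0 := by
    have := hodd 0
    rw [neg_zero] at this; linarith
  obtain ⟨gp, gp1, gp2⟩ := exists_orderIso_sqMap one_pos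
    (((affIso 0 l 1 one_pos).trans φ).trans (affIso l' 0 1 one_pos))
    (by simp [affIso_apply, hl])
  obtain ⟨gm, gm1, gm2⟩ := exists_orderIso_sqMap one_pos
    (((affIso 0 (-l) 1 one_pos).trans φ).trans (affIso (-l') 0 1 one_pos))
    (by simp [affIso_apply, hodd, hl])
  have gp2' : ∀ s, 0 ≤ s → gp (s ^ 2) = (φ (l + s) - l') ^ 2 := fun s hs => by
    rw [gp2 s hs]; simp [affIso_apply]
  have gm2' : ∀ s, 0 ≤ s → gm (s ^ 2) = (φ (l - s) - l') ^ 2 := fun s hs => by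
    have : φ (-l + s) = -φ (l - s) := by rw [← hodd]; ring_nf
    rw [gm2 s hs]; simp [affIso_apply, this]; ring
  have sq : ∀ {g : ℝ ≃o ℝ}, (∀ s, 0 ≤ s → g (s ^ 2) = φ s ^ 2) → ∀ x, g (x ^ 2) = φ x ^ 2 := by
    intro g hg x
    rcases le_total 0 x with h | h
    · exact hg x h
    · have := hg (-x) (by linarith)
      rwa [hodd, neg_sq, neg_sq] at this
  have neg : ∀ {c : ℝ}, 0 < c → β ≤ 0 → β' = c * β → ∃ g gp gm W,
      ConjData l β l' β' φ g gp gm W := by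
    intro c hc hβ0 hβ'
    obtain ⟨g, g1, g2⟩ := exists_orderIso_sqMap (pow_pos hc 2) φ h0
    refine ⟨g, gp, gm, affIso 0 0 c hc, hl, h0, by simpa using gp1, by simpa using gm1, gp2', gm2',
      sq g2, by simp [affIso_apply], by simp [affIso_apply, hβ'], fun w hw => ?_⟩
    rw [g1 _ (by nlinarith), affIso_apply, hβ']; ring
  rcases hβ with ⟨h1, h2⟩ | ⟨h1, h2⟩ | ⟨h1, h2, h3⟩
  · exact neg (div_pos_of_neg_of_neg h2 h1) h1.le (by field_simp [h1.ne])
  · exact neg one_pos h1.le (by rw [h1, h2]; simp)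
  · obtain ⟨g, g1, g2⟩ := exists_orderIso_sqMap one_pos φ h0
    -- `W` is to satisfy `W w ^ 2 = k (w ^ 2)`. The condition `k 0 = 0` amounts to `g (β ^ 2) = β' ^
    -- 2`, which is where `φ β = β'` enters.
    let k : ℝ ≃o ℝ := Equiv.toOrderIso
      { toFun := fun s => β' ^ 2 - g (β ^ 2 - s)
        invFun := fun s => β ^ 2 - g.symm (β' ^ 2 - s)
        left_inv := fun s => by simp
        right_inv := fun s => by simp }
      (fun x y h => by
        have := g.monotone (by linarith : β ^ 2 - y ≤ β ^ 2 - x)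
        simp only [Equiv.coe_fn_mk]; linarith)
      (fun x y h => by
        have := g.symm.monotone (by linarith : β' ^ 2 - y ≤ β' ^ 2 - x)
        simp only [Equiv.coe_fn_symm_mk]; linarith)
    have hk : ∀ s, k s = β' ^ 2 - g (β ^ 2 - s) := fun s => rfl
    obtain ⟨W, W0, W2⟩ := exists_orderIso_sq k (by rw [hk, sub_zero, g2 β h1.le, h3, sub_self])
    refine ⟨g, gp, gm, W, hl, h0, by simpa using gp1, by simpa using gm1, gp2', gm2', sq g2, W0, ?_,
      fun w hw => by rw [W2, hk]⟩
    have hWβ : 0 < W β := by rw [← W0]; exact W.strictMono h1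
    have := W2 β
    rw [hk, sub_self, g1 0 le_rfl, mul_zero, sub_zero] at this
    exact (pow_left_inj₀ hWβ.le h2.le two_ne_zero).1 this

/-- Follow `f` by a map that stretches the half-line above `f a` linearly. Nothing changes up to
`a`, so repeated use prescribes values at successive points. -/
lemma exists_orderIso_extend (f : ℝ ≃o ℝ) {a b c : ℝ} (hab : a < b) (hc : f a < c) :
    ∃ f' : ℝ ≃o ℝ, (∀ x ≤ a, f' x = f x) ∧ f' b = c := by
  have hab' : f a < f b := f.strictMono hab
  set s := (c - f a) / (f b - f a) with hs
  have hs0 : 0 < s := div_pos (by linarith) (by linarith)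
  have mono : ∀ {m s : ℝ}, 0 < s → Monotone fun x => if x ≤ m then x else m + s * (x - m) := by
    intro m s hs x y hxy
    simp only
    split_ifs with h1 h2 h2
    · exact hxy
    · nlinarith
    · linarith
    · nlinarith
  have inv : ∀ {m s : ℝ}, 0 < s → Function.LeftInverse
      (fun x => if x ≤ m then x else m + s⁻¹ * (x - m))
      (fun x => if x ≤ m then x else m + s * (x - m)) := by
    intro m s hs x
    simp only
    by_cases h1 : x ≤ m
    · simp [h1]
    · rw [not_le] at h1
      have : ¬ m + s * (x - m) ≤ m := by
        rw [not_le]; nlinarith [mul_pos hs (by linarith : 0 < x - m)]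
      rw [if_neg (not_le.2 h1), if_neg this]
      field_simp; ring
  let k : ℝ ≃o ℝ := Equiv.toOrderIso
    { toFun := fun x => if x ≤ f a then x else f a + s * (x - f a)
      invFun := fun x => if x ≤ f a then x else f a + s⁻¹ * (x - f a)
      left_inv := inv hs0
      right_inv := by
        have := inv (m := f a) (inv_pos.2 hs0)
        rwa [inv_inv] at this }
    (mono hs0) (mono (inv_pos.2 hs0))
  have hk : ∀ x, k x = if x ≤ f a then x else f a + s * (x - f a) := fun x => rfl
  refine ⟨f.trans k, fun x hx => ?_, ?_⟩
  · rw [OrderIso.trans_apply, hk, if_pos (f.monotone hx)]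
  · rw [OrderIso.trans_apply, hk, if_neg (not_le.2 hab'), hs]
    have : f b - f a ≠ 0 := by linarith
    field_simp
    ring

lemma exists_odd_extension (f : ℝ ≃o ℝ) (hf : f 0 = 0) :
    ∃ φ : ℝ ≃o ℝ, (∀ x, φ (-x) = -φ x) ∧ ∀ x, 0 ≤ x → φ x = f x := by
  have hpos : ∀ {f : ℝ ≃o ℝ}, f 0 = 0 → ∀ {x}, 0 ≤ x → 0 ≤ f x := fun hf _ h => by
    rw [← hf]; exact OrderIso.monotone _ h
  have mono : ∀ {f : ℝ ≃o ℝ}, f 0 = 0 → Monotone fun x => if 0 ≤ x then f x else -f (-x) := by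
    intro f hf x y hxy
    simp only
    split_ifs with h1 h2 h2
    · exact f.monotone hxy
    · linarith
    · have := hpos hf (by linarith : 0 ≤ -x)
      linarith [hpos hf h2]
    · exact neg_le_neg (f.monotone (by linarith))
  have inv : ∀ {f : ℝ ≃o ℝ}, f 0 = 0 → Function.LeftInverse
      (fun x => if 0 ≤ x then f.symm x else -f.symm (-x))
      (fun x => if 0 ≤ x then f x else -f (-x)) := by
    intro f hf x
    simp only
    by_cases h1 : 0 ≤ x
    · simp [h1, hpos hf h1]
    · rw [not_le] at h1
      have : 0 < f (-x) := by rw [← hf]; exact f.strictMono (by linarith)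
      simp [not_le.2 h1, not_le.2 this]
  have hf' : f.symm 0 = 0 := by rw [OrderIso.symm_apply_eq, hf]
  let φ : ℝ ≃o ℝ := Equiv.toOrderIso
    { toFun := fun x => if 0 ≤ x then f x else -f (-x)
      invFun := fun x => if 0 ≤ x then f.symm x else -f.symm (-x)
      left_inv := inv hf
      right_inv := inv (f := f.symm) hf' }
    (mono hf) (mono hf')
  have hφ : ∀ x, φ x = if 0 ≤ x then f x else -f (-x) := fun x => rfl
  refine ⟨φ, fun x => ?_, fun x hx => by rw [hφ, if_pos hx]⟩
  rw [hφ, hφ]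
  rcases lt_trichotomy x 0 with h | rfl | h
  · rw [if_pos (by linarith), if_neg (not_le.2 h), neg_neg]
  · simp [hf]
  · rw [if_neg (by linarith), if_pos h.le, neg_neg]

/-- An odd order isomorphism with prescribed values at three positive points. -/
lemma exists_odd_orderIso {a b c a' b' c' : ℝ} (h0 : 0 < a) (h1 : a < b) (h2 : b < c)
    (h0' : 0 < a') (h1' : a' < b') (h2' : b' < c') :
    ∃ φ : ℝ ≃o ℝ, (∀ x, φ (-x) = -φ x) ∧ φ a = a' ∧ φ b = b' ∧ φ c = c' := by
  obtain ⟨f, f1, f2⟩ := exists_orderIso_extend (OrderIso.refl ℝ) h0 h0'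
  obtain ⟨g, g1, g2⟩ := exists_orderIso_extend f h1 (by rwa [f2])
  obtain ⟨k, k1, k2⟩ := exists_orderIso_extend g h2 (by rwa [g2])
  have k0 : k 0 = 0 := by
    rw [k1 0 (by linarith), g1 0 h0.le, f1 0 le_rfl]; rfl
  obtain ⟨φ, o, e⟩ := exists_odd_extension k k0
  refine ⟨φ, o, ?_, ?_, ?_⟩
  · rw [e _ h0.le, k1 _ h1.le, g1 _ le_rfl, f2]
  · rw [e _ (by linarith), k1 _ le_rfl, g2]
  · rw [e _ (by linarith), k2]

/-- An order isomorphism that fixes `0` and has prescribed values at one point on either side. -/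
lemma exists_orderIso_two {a b a' b' : ℝ} (ha : a < 0) (hb : 0 < b) (ha' : a' < 0) (hb' : 0 < b') :
    ∃ φ : ℝ ≃o ℝ, φ 0 = 0 ∧ φ a = a' ∧ φ b = b' := by
  have hs : 0 < a' / a := div_pos_of_neg_of_neg ha' ha
  obtain ⟨f, f1, f2⟩ := exists_orderIso_extend (affIso 0 0 (a' / a) hs) hb
    (by simpa [affIso_apply] using hb')
  refine ⟨f, ?_, ?_, f2⟩
  · rw [f1 0 le_rfl]; simp [affIso_apply]
  · rw [f1 a ha.le]
    simp only [affIso_apply]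
    field_simp [ha.ne]
    ring

/-! ### Equivalence of the sliding vector fields -/

lemma PreservesSides.snd_eq_zero_iff {h : Pt ≃ₜ Pt} (hs : PreservesSides h) (p : Pt) :
    (h p).2 = 0 ↔ p.2 = 0 := by
  have up : p ∈ upper ↔ h p ∈ upper := by
    conv_rhs => rw [← hs.1]
    exact (h.injective.mem_set_image).symm
  have lo : p ∈ lower ↔ h p ∈ lower := by
    conv_rhs => rw [← hs.2]
    exact (h.injective.mem_set_image).symm
  change 0 ≤ p.2 ↔ 0 ≤ (h p).2 at up
  change p.2 ≤ 0 ↔ (h p).2 ≤ 0 at lo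
  rw [le_antisymm_iff, le_antisymm_iff, up, lo]

lemma awayLE_sub_iff {P x y : ℝ} :
    AwayLE (x - P) (y - P) ↔ (0 < x - P ∧ x ≤ y) ∨ (y ≤ x ∧ x - P < 0) ∨ x = y := by
  simp [AwayLE]

/-- By `reach_slide_iff`, the orbits of `Z^Σ` depend only on the order of `Σ`, on the ends of the
sewing interval and on the side of `P` where a sliding or escaping point lies. An increasing `φ`
that matches the last two is enough. -/
lemma carriesSliding_of_boundary {l β l' β' : ℝ} (hβ : β < 1) (hβ' : β' < 1) {h : Pt ≃ₜ Pt}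
    (hs : PreservesSides h) (φ : ℝ ≃o ℝ) (hφ : ∀ x, h (x, 0) = (φ x, 0))
    (hmin : φ (min l 0) = min l' 0) (hmax : φ (max l 0) = max l' 0)
    (hP : ∀ x, max l 0 < x ∨ x < min l 0 → SameSign (x - pseudo l β) (φ x - pseudo l' β')) :
    CarriesSliding h (Zv (l, β)) (Zv (l', β')) := by
  have h2 := hs.snd_eq_zero_iff
  have hφ' : ∀ p : Pt, p.2 = 0 → h p = (φ p.1, 0) := fun p hp => by
    rw [← hφ]; congr 1; exact Prod.ext rfl hp
  have esc : ∀ p, p ∈ (Zv (l, β)).escaping ↔ h p ∈ (Zv (l', β')).escaping := fun p => by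
    rw [mem_escaping, mem_escaping, h2]
    refine and_congr_right fun hp => ?_
    rw [hφ' p hp, ← hmax, φ.lt_iff_lt]
  have sli : ∀ p, p ∈ (Zv (l, β)).sliding ↔ h p ∈ (Zv (l', β')).sliding := fun p => by
    rw [mem_sliding, mem_sliding, h2]
    refine and_congr_right fun hp => ?_
    rw [hφ' p hp, ← hmin, φ.lt_iff_lt]
  refine ⟨hs, image_eq_of_mem_iff fun p => ?_, image_eq_of_mem_iff esc, image_eq_of_mem_iff sli,
    fun p q => ?_⟩
  · rw [mem_sewing, mem_sewing, h2]
    refine and_congr_right fun hp => ?_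
    rw [hφ' p hp, ← hmin, ← hmax, φ.lt_iff_lt, φ.lt_iff_lt]
  · have away : ∀ {x y : ℝ}, max l 0 < x ∨ x < min l 0 →
        (AwayLE (x - pseudo l β) (y - pseudo l β) ↔
          AwayLE (φ x - pseudo l' β') (φ y - pseudo l' β')) := by
      intro x y hx
      rw [awayLE_sub_iff, awayLE_sub_iff, (hP x hx).1, (hP x hx).2, φ.le_iff_le, φ.le_iff_le,
        φ.injective.eq_iff]
    rw [reach_slide_iff hβ, reach_slide_iff hβ', ← esc, ← esc, ← sli, ← sli]
    refine or_congr (and_congr_right fun hp => and_congr_right fun hq => ?_)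
      (and_congr_right fun hp => and_congr_right fun hq => ?_)
    · have hp' := mem_escaping.1 hp
      have hq' := mem_escaping.1 hq
      rw [hφ' p hp'.1, hφ' q hq'.1]
      exact away (Or.inl hp'.2)
    · have hp' := mem_sliding.1 hp
      have hq' := mem_sliding.1 hq
      rw [hφ' p hp'.1, hφ' q hq'.1]
      exact away (Or.inr hq'.2)

/-- There is no zero of the sliding vector field outside the closed sewing interval. -/
lemma pseudo_mem_sewing_closure {l β : ℝ} (hβ : β < 1) (h : β ≤ 0 ∨ l = 0) :
    min l 0 ≤ pseudo l β ∧ pseudo l β ≤ max l 0 := by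
  rcases h with h | rfl
  · have e : pseudo l β = (β / (-1 + β)) * l := by rw [pseudo]; ring
    have h1 : 0 ≤ β / (-1 + β) := div_nonneg_of_nonpos h (by linarith)
    have h2 : β / (-1 + β) ≤ 1 := by
      rw [div_le_one_of_neg (by linarith)]; linarith
    rw [e]
    rcases le_total l 0 with h0 | h0
    · rw [min_eq_left h0, max_eq_right h0]
      constructor <;> nlinarith
    · rw [min_eq_right h0, max_eq_left h0]
      constructor <;> nlinarith
  · simp [pseudo]

lemma sameSign_of_no_pseudo {l β l' β' : ℝ} (hβ : β < 1) (hβ' : β' < 1) (h : β ≤ 0 ∨ l = 0)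
    (h' : β' ≤ 0 ∨ l' = 0) (φ : ℝ ≃o ℝ) (hmin : φ (min l 0) = min l' 0)
    (hmax : φ (max l 0) = max l' 0) (x : ℝ) (hx : max l 0 < x ∨ x < min l 0) :
    SameSign (x - pseudo l β) (φ x - pseudo l' β') := by
  have a := pseudo_mem_sewing_closure hβ h
  have a' := pseudo_mem_sewing_closure hβ' h'
  rcases hx with hx | hx
  · have := φ.strictMono hx
    rw [hmax] at this
    exact ⟨iff_of_true (by linarith) (by linarith), iff_of_false (by linarith) (by linarith)⟩
  · have := φ.strictMono hx
    rw [hmin] at this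
    exact ⟨iff_of_false (by linarith) (by linarith), iff_of_true (by linarith) (by linarith)⟩

lemma sameSign_of_map {P P' : ℝ} (φ : ℝ ≃o ℝ) (h : φ P = P') (x : ℝ) :
    SameSign (x - P) (φ x - P') := by
  rw [SameSign, sub_pos, sub_pos, sub_neg, sub_neg, ← h, φ.lt_iff_lt, φ.lt_iff_lt]
  exact ⟨Iff.rfl, Iff.rfl⟩

lemma map_min_max {l l' : ℝ} (φ : ℝ ≃o ℝ) (h0 : φ 0 = 0) (hl : φ l = l') :
    φ (min l 0) = min l' 0 ∧ φ (max l 0) = max l' 0 := by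
  rw [φ.monotone.map_min, φ.monotone.map_max, h0, hl]
  exact ⟨rfl, rfl⟩

/-- The homeomorphism `(x, y) ↦ (φ x, y)`. -/
noncomputable def horizontal (φ : ℝ ≃o ℝ) : Pt ≃ₜ Pt := φ.toHomeomorph.prodCongr (Homeomorph.refl ℝ)

lemma horizontal_preservesSides (φ : ℝ ≃o ℝ) : PreservesSides (horizontal φ) :=
  ⟨image_eq_of_mem_iff fun _ => Iff.rfl, image_eq_of_mem_iff fun _ => Iff.rfl⟩

lemma exists_carriesSliding {l β l' β' : ℝ} (hβ : β < 1) (hβ' : β' < 1) (φ : ℝ ≃o ℝ)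
    (hmin : φ (min l 0) = min l' 0) (hmax : φ (max l 0) = max l' 0)
    (hP : ∀ x, max l 0 < x ∨ x < min l 0 → SameSign (x - pseudo l β) (φ x - pseudo l' β')) :
    ∃ h, CarriesSliding h (Zv (l, β)) (Zv (l', β')) :=
  ⟨horizontal φ, carriesSliding_of_boundary hβ hβ' (horizontal_preservesSides φ) φ
    (fun _ => rfl) hmin hmax hP⟩

/-- Reduces the equivalence of planar fields to finding an odd increasing map of the line that
matches a few marked points. -/
lemma topEquivalent_of_odd {l β l' β' : ℝ} (hβ1 : β < 1) (hβ1' : β' < 1) (φ : ℝ ≃o ℝ)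
    (hodd : ∀ x, φ (-x) = -φ x) (hl : φ l = l')
    (hβ : (β < 0 ∧ β' < 0) ∨ (β = 0 ∧ β' = 0) ∨ (0 < β ∧ 0 < β' ∧ φ β = β'))
    (hP : ∀ x, max l 0 < x ∨ x < min l 0 → SameSign (x - pseudo l β) (φ x - pseudo l' β')) :
    TopEquivalent (Zv (l, β)) (Zv (l', β')) := by
  obtain ⟨g, gp, gm, W, h⟩ := exists_conjData φ hodd hl hβ
  have hm := map_min_max φ h.map_zero hl
  exact ⟨h.homeo, h.carriesUpper, h.carriesLower, carriesSliding_of_boundary hβ1 hβ1'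
    h.preservesSides φ h.homeo_boundary hm.1 hm.2 hP⟩

lemma TopEquivalent.sameConfiguration {Z W : NSField} (h : TopEquivalent Z W) :
    SameConfiguration Z W := by
  obtain ⟨h, h1, h2, h3⟩ := h
  exact ⟨⟨h, h1, h2⟩, ⟨h, h3⟩⟩

/-- An odd map is determined by its values at absolute values. -/
lemma odd_map_of_abs {φ : ℝ ≃o ℝ} (hodd : ∀ x, φ (-x) = -φ x) {a a' : ℝ} (h : φ |a| = |a'|)
    (hs : SameSign a a') : φ a = a' := by
  rcases lt_trichotomy a 0 with h0 | rfl | h0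
  · rw [abs_of_neg h0, abs_of_neg (hs.2.1 h0), hodd] at h
    linarith
  · have h1 := hs.nonneg.1 le_rfl
    have h2 := hs.nonpos.1 le_rfl
    have : a' = 0 := le_antisymm h2 h1
    simpa [this] using h
  · rwa [abs_of_pos h0, abs_of_pos (hs.1.1 h0)] at h

lemma topEquivalent_of_nonpos {l β l' β' : ℝ} (hβ : (β < 0 ∧ β' < 0) ∨ (β = 0 ∧ β' = 0))
    (hl : SameSign l l') : TopEquivalent (Zv (l, β)) (Zv (l', β')) := by
  have h1 : β ≤ 0 := by rcases hβ with h | h <;> linarith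
  have h2 : β' ≤ 0 := by rcases hβ with h | h <;> linarith
  obtain ⟨φ, hodd, hφ⟩ : ∃ φ : ℝ ≃o ℝ, (∀ x, φ (-x) = -φ x) ∧ φ l = l' := by
    by_cases h0 : l = 0
    · refine ⟨OrderIso.refl ℝ, fun x => rfl, ?_⟩
      rw [h0] at hl ⊢
      exact le_antisymm (hl.nonneg.1 le_rfl) (hl.nonpos.1 le_rfl)
    · have h0' : l' ≠ 0 := by
        rintro rfl
        exact h0 (le_antisymm (hl.nonpos.2 le_rfl) (hl.nonneg.2 le_rfl))
      obtain ⟨φ, hodd, e, -, -⟩ := exists_odd_orderIso (abs_pos.2 h0)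
        (by linarith : |l| < |l| + 1) (by linarith : |l| + 1 < |l| + 2) (abs_pos.2 h0')
        (by linarith : |l'| < |l'| + 1) (by linarith : |l'| + 1 < |l'| + 2)
      exact ⟨φ, hodd, odd_map_of_abs hodd e hl⟩
  have hz : φ 0 = 0 := by
    have := hodd 0
    rw [neg_zero] at this; linarith
  have hm := map_min_max φ hz hφ
  refine topEquivalent_of_odd (by linarith) (by linarith) φ hodd hφ ?_
    (sameSign_of_no_pseudo (by linarith) (by linarith) (Or.inl h1) (Or.inl h2) φ hm.1 hm.2)
  rcases hβ with h | h
  · exact Or.inl h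
  · exact Or.inr (Or.inl h)

lemma topEquivalent_of_zero {β β' : ℝ} (hβ : 0 < β) (hβ' : 0 < β') (h1 : β < 1) (h1' : β' < 1) :
    TopEquivalent (Zv (0, β)) (Zv (0, β')) := by
  obtain ⟨φ, hodd, e, -, -⟩ := exists_odd_orderIso hβ
    (by linarith : β < β + 1) (by linarith : β + 1 < β + 2) hβ'
    (by linarith : β' < β' + 1) (by linarith : β' + 1 < β' + 2)
  have hz : φ 0 = 0 := by
    have := hodd 0
    rw [neg_zero] at this; linarith
  have hm := map_min_max φ hz hz
  exact topEquivalent_of_odd h1 h1' φ hodd hz (Or.inr (Or.inr ⟨hβ, hβ', e⟩))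
    (sameSign_of_no_pseudo h1 h1' (Or.inr rfl) (Or.inr rfl) φ hm.1 hm.2)

lemma abs_pseudo {l β : ℝ} (hβ : 0 < β) (h1 : β < 1) : |pseudo l β| = β * |l| / (1 - β) := by
  rw [pseudo, abs_div, abs_mul, abs_of_pos hβ, abs_of_neg (by linarith : -1 + β < 0)]
  congr 1; ring

lemma pseudo_pos_iff {l β : ℝ} (hβ : 0 < β) (h1 : β < 1) : 0 < pseudo l β ↔ l < 0 := by
  have e : pseudo l β = (β / (1 - β)) * (-l) := by
    rw [pseudo, show (-1 + β) = -(1 - β) by ring, div_neg]; ring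
  rw [e, mul_pos_iff_of_pos_left (div_pos hβ (by linarith)), neg_pos]

lemma pseudo_neg_iff {l β : ℝ} (hβ : 0 < β) (h1 : β < 1) : pseudo l β < 0 ↔ 0 < l := by
  have e : pseudo l β = -((β / (1 - β)) * l) := by
    rw [pseudo, show (-1 + β) = -(1 - β) by ring, div_neg]; ring
  rw [e, neg_lt_zero, mul_pos_iff_of_pos_left (div_pos hβ (by linarith))]

lemma sameSign_pseudo {l β l' β' : ℝ} (hβ : 0 < β) (h1 : β < 1) (hβ' : 0 < β') (h1' : β' < 1)
    (hl : SameSign l l') : SameSign (pseudo l β) (pseudo l' β') := by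
  rw [SameSign, pseudo_pos_iff hβ h1, pseudo_pos_iff hβ' h1', pseudo_neg_iff hβ h1,
    pseudo_neg_iff hβ' h1']
  exact ⟨hl.2, hl.1⟩

/-- The position of `|l|` with respect to `β` is the same for both parameters. -/
def SameOrder (l β l' β' : ℝ) : Prop :=
  (|l| < β ∧ |l'| < β') ∨ (|l| = β ∧ |l'| = β') ∨ (β < |l| ∧ β' < |l'|)

/-- Since `|P| = β * |l| / (1 - β)`, the bounds `1 / 2` give `|P| < |l|` and `|P| < β`. The only
order left open among the marked points is that of `|l|` and `β`, and `SameOrder` fixes it. -/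
lemma topEquivalent_of_pos {l β l' β' : ℝ} (hβ : 0 < β) (hβ' : 0 < β') (h1 : β < 1 / 2)
    (h1' : β' < 1 / 2) (h2 : |l| < 1 / 2) (h2' : |l'| < 1 / 2) (h0 : l ≠ 0) (h0' : l' ≠ 0)
    (hl : SameSign l l') (ho : SameOrder l β l' β') :
    TopEquivalent (Zv (l, β)) (Zv (l', β')) := by
  have bounds : ∀ {l β : ℝ}, 0 < β → β < 1 / 2 → |l| < 1 / 2 → l ≠ 0 →
      0 < |pseudo l β| ∧ |pseudo l β| < |l| ∧ |pseudo l β| < β := by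
    intro l β hβ h1 h2 h0
    have hl := abs_pos.2 h0
    rw [abs_pseudo hβ (by linarith)]
    refine ⟨by apply div_pos (mul_pos hβ hl); linarith, ?_, ?_⟩
    · rw [div_lt_iff₀ (by linarith)]; nlinarith
    · rw [div_lt_iff₀ (by linarith)]; nlinarith
  obtain ⟨b1, b2, b3⟩ := bounds hβ h1 h2 h0
  obtain ⟨b1', b2', b3'⟩ := bounds hβ' h1' h2' h0'
  obtain ⟨φ, hodd, eP, el, eβ⟩ : ∃ φ : ℝ ≃o ℝ, (∀ x, φ (-x) = -φ x) ∧
      φ |pseudo l β| = |pseudo l' β'| ∧ φ |l| = |l'| ∧ φ β = β' := by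
    rcases ho with ⟨h, h'⟩ | ⟨h, h'⟩ | ⟨h, h'⟩
    · exact exists_odd_orderIso b1 b2 h b1' b2' h'
    · obtain ⟨φ, hodd, e1, e2, -⟩ := exists_odd_orderIso b1 b2 (by linarith : |l| < |l| + 1)
        b1' b2' (by linarith : |l'| < |l'| + 1)
      exact ⟨φ, hodd, e1, e2, by rw [← h, ← h', e2]⟩
    · obtain ⟨φ, hodd, e1, e2, e3⟩ := exists_odd_orderIso b1 b3 h b1' b3' h'
      exact ⟨φ, hodd, e1, e3, e2⟩
  refine topEquivalent_of_odd (by linarith) (by linarith) φ hodd (odd_map_of_abs hodd el hl)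
    (Or.inr (Or.inr ⟨hβ, hβ', eβ⟩)) (fun x _ => sameSign_of_map φ (odd_map_of_abs hodd eP ?_) x)
  exact sameSign_pseudo hβ (by linarith) hβ' (by linarith) hl

/-- `P` and `l` lie on opposite sides of `0`, so an increasing map fixing `0` can move each freely.
Oddness, which would tie them together, is not needed for `Z^Σ` alone. -/
lemma exists_carriesSliding_of_pos {l β l' β' : ℝ} (hβ : 0 < β) (hβ' : 0 < β') (h1 : β < 1)
    (h1' : β' < 1) (h0 : l ≠ 0) (hl : SameSign l l') :
    ∃ h, CarriesSliding h (Zv (l, β)) (Zv (l', β')) := by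
  obtain ⟨φ, e0, el, eP⟩ : ∃ φ : ℝ ≃o ℝ, φ 0 = 0 ∧ φ l = l' ∧ φ (pseudo l β) = pseudo l' β' := by
    rcases lt_or_gt_of_ne h0 with h | h
    · exact exists_orderIso_two h ((pseudo_pos_iff hβ h1).2 h) (hl.2.1 h)
        ((pseudo_pos_iff hβ' h1').2 (hl.2.1 h))
    · obtain ⟨φ, e0, e1, e2⟩ := exists_orderIso_two ((pseudo_neg_iff hβ h1).2 h) h
        ((pseudo_neg_iff hβ' h1').2 (hl.1.1 h)) (hl.1.1 h)
      exact ⟨φ, e0, e2, e1⟩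
  have hm := map_min_max φ e0 el
  exact exists_carriesSliding h1 h1' φ hm.1 hm.2 fun x _ => sameSign_of_map φ eP x

lemma sameConfiguration_of_pos {l β l' β' : ℝ} (hβ : 0 < β) (hβ' : 0 < β') (h1 : β < 1)
    (h1' : β' < 1) (h0 : l ≠ 0) (h0' : l' ≠ 0) (hl : SameSign l l') (ho : SameOrder l β l' β') :
    SameConfiguration (Zv (l, β)) (Zv (l', β')) := by
  refine ⟨?_, exists_carriesSliding_of_pos hβ hβ' h1 h1' h0 hl⟩
  have p0 := abs_pos.2 h0
  have p0' := abs_pos.2 h0'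
  obtain ⟨φ, hodd, el, eβ⟩ : ∃ φ : ℝ ≃o ℝ, (∀ x, φ (-x) = -φ x) ∧ φ |l| = |l'| ∧ φ β = β' := by
    rcases ho with ⟨h, h'⟩ | ⟨h, h'⟩ | ⟨h, h'⟩
    · obtain ⟨φ, hodd, e1, e2, -⟩ := exists_odd_orderIso p0 h (by linarith : β < β + 1)
        p0' h' (by linarith : β' < β' + 1)
      exact ⟨φ, hodd, e1, e2⟩
    · obtain ⟨φ, hodd, e1, -, -⟩ := exists_odd_orderIso p0 (by linarith : |l| < |l| + 1)
        (by linarith : |l| + 1 < |l| + 2) p0' (by linarith : |l'| < |l'| + 1)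
        (by linarith : |l'| + 1 < |l'| + 2)
      exact ⟨φ, hodd, e1, by rw [← h, ← h', e1]⟩
    · obtain ⟨φ, hodd, e1, e2, -⟩ := exists_odd_orderIso hβ h (by linarith : |l| < |l| + 1)
        hβ' h' (by linarith : |l'| < |l'| + 1)
      exact ⟨φ, hodd, e2, e1⟩
  obtain ⟨g, gp, gm, W, h⟩ := exists_conjData (β := β) (β' := β') φ hodd (odd_map_of_abs hodd el hl)
    (Or.inr (Or.inr ⟨hβ, hβ', eβ⟩))
  exact ⟨h.homeo, h.carriesUpper, h.carriesLower⟩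

/-! ### Equivalence of the three phase portraits taken separately -/

lemma exists_carriesUpper (l β l' β' : ℝ) : ∃ h, CarriesUpper h (Zv (l, β)) (Zv (l', β')) := by
  refine ⟨horizontal (affIso l l' 1 one_pos), horizontal_preservesSides _, fun p q => ?_⟩
  have e : ∀ p, horizontal (affIso l l' 1 one_pos) p = (l' + (p.1 - l), p.2) := fun p => by
    refine Prod.ext ?_ rfl
    change affIso l l' 1 one_pos p.1 = _
    rw [affIso_apply, one_mul]
  rw [e, e, reach_X_iff, reach_X_iff]
  simp [intX]

lemma exists_carriesLower (l l' : ℝ) {β β' : ℝ}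
    (hβ : (β < 0 ∧ β' < 0) ∨ (β = 0 ∧ β' = 0) ∨ (0 < β ∧ 0 < β')) :
    ∃ h, CarriesLower h (Zv (l, β)) (Zv (l', β')) := by
  obtain ⟨φ, hodd, e⟩ : ∃ φ : ℝ ≃o ℝ, (∀ x, φ (-x) = -φ x) ∧ (0 < β → 0 < β' → φ β = β') := by
    by_cases h : 0 < β ∧ 0 < β'
    · obtain ⟨φ, hodd, e, -, -⟩ := exists_odd_orderIso h.1
        (by linarith : β < β + 1) (by linarith : β + 1 < β + 2) h.2
        (by linarith : β' < β' + 1) (by linarith : β' + 1 < β' + 2)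
      exact ⟨φ, hodd, fun _ _ => e⟩
    · exact ⟨OrderIso.refl ℝ, fun x => rfl, fun h1 h2 => absurd ⟨h1, h2⟩ h⟩
  have hz : φ 0 = 0 := by
    have := hodd 0
    rw [neg_zero] at this; linarith
  -- `Y` does not involve `λ`, so the value `0` is used on both sides.
  obtain ⟨g, gp, gm, W, h⟩ := exists_conjData (l := 0) (l' := 0) (β := β) (β' := β') φ hodd hz
    (by
      rcases hβ with h | h | h
      · exact Or.inl h
      · exact Or.inr (Or.inl h)
      · exact Or.inr (Or.inr ⟨h.1, h.2, e h.1 h.2⟩))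
  exact ⟨h.homeo, h.carriesLower⟩

/-- Without pseudo-equilibria only the sewing interval matters, and `Z^Σ` does not show which of its
ends is the fold of `X`. Hence cells 1 and 3, and likewise 4 and 6, share a behaviour. -/
lemma exists_carriesSliding_of_nonpos {l β l' β' : ℝ} (hβ : β ≤ 0) (hβ' : β' ≤ 0) (hl : l ≠ 0)
    (hl' : l' ≠ 0) : ∃ h, CarriesSliding h (Zv (l, β)) (Zv (l', β')) := by
  have hc : 0 < |l'| / |l| := div_pos (abs_pos.2 hl') (abs_pos.2 hl)
  have h1 : affIso (min l 0) (min l' 0) (|l'| / |l|) hc (min l 0) = min l' 0 := by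
    rw [affIso_apply, sub_self, mul_zero, add_zero]
  have h2 : affIso (min l 0) (min l' 0) (|l'| / |l|) hc (max l 0) = max l' 0 := by
    have e : ∀ l : ℝ, max l 0 - min l 0 = |l| := fun l => by rw [max_sub_min_eq_abs]; simp
    rw [affIso_apply, e, div_mul_cancel₀ _ (abs_pos.2 hl).ne', ← e l']; ring
  exact exists_carriesSliding (by linarith) (by linarith) _ h1 h2
    (sameSign_of_no_pseudo (by linarith) (by linarith) (Or.inl hβ) (Or.inl hβ') _ h1 h2)

lemma exists_carriesSliding_of_zero {β β' : ℝ} (hβ : β < 1) (hβ' : β' < 1) :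
    ∃ h, CarriesSliding h (Zv (0, β)) (Zv (0, β')) :=
  exists_carriesSliding hβ hβ' (OrderIso.refl ℝ) rfl rfl
    (sameSign_of_no_pseudo hβ hβ' (Or.inr rfl) (Or.inr rfl) _ rfl rfl)

end FoldSaddle

namespace FoldSaddle

/-! ### Topological invariants of the phase portraits -/

/-- A nonconstant trajectory of `V` in `D` starts at `p`. -/
def CanLeave (V : Pt → Pt) (D : Set Pt) (p : Pt) : Prop := ∃ q, q ≠ p ∧ Reach V D p q

/-- A nonconstant trajectory of `V` in `D` ends at `p`. -/
def CanArrive (V : Pt → Pt) (D : Set Pt) (p : Pt) : Prop := ∃ q, q ≠ p ∧ Reach V D q p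

lemma CarriesOrbits.canLeave_iff {h : Pt ≃ₜ Pt} {V V' : Pt → Pt} {D D' : Set Pt}
    (H : CarriesOrbits h V D V' D') (p : Pt) : CanLeave V D p ↔ CanLeave V' D' (h p) := by
  constructor
  · rintro ⟨q, h1, h2⟩
    exact ⟨h q, h.injective.ne h1, (H p q).1 h2⟩
  · rintro ⟨q, h1, h2⟩
    refine ⟨h.symm q, fun e => h1 (by rw [← e]; simp), (H _ _).2 (by simpa using h2)⟩

lemma CarriesOrbits.canArrive_iff {h : Pt ≃ₜ Pt} {V V' : Pt → Pt} {D D' : Set Pt}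
    (H : CarriesOrbits h V D V' D') (p : Pt) : CanArrive V D p ↔ CanArrive V' D' (h p) := by
  constructor
  · rintro ⟨q, h1, h2⟩
    exact ⟨h q, h.injective.ne h1, (H q p).1 h2⟩
  · rintro ⟨q, h1, h2⟩
    refine ⟨h.symm q, fun e => h1 (by rw [← e]; simp), (H _ _).2 (by simpa using h2)⟩

/-- The reflection in the line `x = l` reverses `X`; similarly `x ↦ -x` reverses `Y`. Statements on
arriving thus follow from statements on leaving. -/
lemma reach_X_reverse {l β : ℝ} {p q : Pt} (h : Reach (Zv (l, β)).X upper p q) :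
    Reach (Zv (l, β)).X upper (2 * l - q.1, q.2) (2 * l - p.1, p.2) := by
  obtain ⟨h1, h2, h3, h4, h5⟩ := reach_X_iff.1 h
  simp only [intX] at h3 h5
  refine reach_X_iff.2 ⟨h2, h1, ?_, by simp only; linarith, fun h6 => ?_⟩
  · simp only [intX]; linarith
  · simp only [intX] at h6 ⊢
    have := h5 (by rw [h3]; linarith)
    linarith

lemma reach_Y_reverse {l β : ℝ} {p q : Pt} (h : Reach (Zv (l, β)).Y lower p q) :
    Reach (Zv (l, β)).Y lower (-q.1, q.2) (-p.1, p.2) := by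
  obtain ⟨T, hT, h1, h2, h3⟩ := reach_Y_iff_flow.1 h
  have back : ∀ {a b T : ℝ}, a = b * Real.exp T → b = a * Real.exp (-T) := by
    rintro a b T rfl
    rw [mul_assoc, ← Real.exp_add]; simp
  have back' : ∀ {a b T : ℝ}, a = b * Real.exp (-T) → b = a * Real.exp T := by
    rintro a b T rfl
    rw [mul_assoc, ← Real.exp_add]; simp
  refine reach_Y_iff_flow.2 ⟨T, hT, ?_, ?_, fun t ht => ?_⟩
  · have := back h2
    simp only; linarith
  · have := back' h1
    simp only; linarith
  · have := h3 (T - t) ⟨by linarith [ht.2], by linarith [ht.1]⟩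
    have e1 : (p.1 + (p.2 + β)) * Real.exp (-(T - t)) = (q.1 + (q.2 + β)) * Real.exp t := by
      rw [h1, mul_assoc, ← Real.exp_add]; ring_nf
    have e2 : (p.1 - (p.2 + β)) * Real.exp (T - t) = (q.1 - (q.2 + β)) * Real.exp (-t) := by
      rw [h2, mul_assoc, ← Real.exp_add]; ring_nf
    rw [e1, e2] at this
    simp only; linarith

lemma reflect_ne {c : ℝ} {p q : Pt} (h : q ≠ p) : ((c - q.1, q.2) : Pt) ≠ (c - p.1, p.2) := by
  intro e
  simp only [Prod.mk.injEq, sub_right_inj] at e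
  exact h (Prod.ext e.1 e.2)

lemma canArrive_X_iff {l β : ℝ} {p : Pt} : CanArrive (Zv (l, β)).X upper p ↔
    CanLeave (Zv (l, β)).X upper (2 * l - p.1, p.2) := by
  constructor
  · rintro ⟨q, h1, h2⟩
    exact ⟨_, reflect_ne h1, reach_X_reverse h2⟩
  · rintro ⟨q, h1, h2⟩
    refine ⟨(2 * l - q.1, q.2), fun e => h1 ?_, by simpa using reach_X_reverse h2⟩
    rw [← e]; simp

lemma canArrive_Y_iff {l β : ℝ} {p : Pt} : CanArrive (Zv (l, β)).Y lower p ↔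
    CanLeave (Zv (l, β)).Y lower (-p.1, p.2) := by
  constructor
  · rintro ⟨q, h1, h2⟩
    refine ⟨_, ?_, reach_Y_reverse h2⟩
    simpa using reflect_ne (c := 0) h1
  · rintro ⟨q, h1, h2⟩
    refine ⟨(-q.1, q.2), fun e => h1 ?_, by simpa using reach_Y_reverse h2⟩
    rw [← e]; simp

lemma canLeave_X_iff {l β x : ℝ} : CanLeave (Zv (l, β)).X upper (x, 0) ↔ l ≤ x := by
  constructor
  · rintro ⟨q, h1, h2⟩
    obtain ⟨-, hq, hA, hx, hs⟩ := reach_X_iff.1 h2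
    by_contra! hl
    simp only [intX] at hA hs hx
    have := hs (by nlinarith)
    have hq1 : q.1 - l < 0 := by nlinarith
    have h3 : q.2 = 0 := by nlinarith
    have h4 : q.1 = x := by nlinarith
    exact h1 (Prod.ext h4 h3)
  · intro h
    refine ⟨(x + 1, ((x + 1 - l) ^ 2 - (x - l) ^ 2) / 2), by simp,
      reach_X_iff.2 ⟨le_rfl, ?_, ?_, ?_, ?_⟩⟩
    · simp only; nlinarith
    · simp only [intX]; ring
    · simp
    · simp only [intX]; intro h0
      have : 0 < x - l := by nlinarith
      nlinarith

lemma canArrive_X_boundary_iff {l β x : ℝ} :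
    CanArrive (Zv (l, β)).X upper (x, 0) ↔ x ≤ l := by
  rw [canArrive_X_iff, canLeave_X_iff]
  constructor <;> intro h <;> linarith

/-- A trajectory of `Y` cannot leave `Σ` downwards to the left of the contact point. -/
lemma eq_of_reach_Y_from {l β x : ℝ} {q : Pt} (hx : x < 0 ∨ (x = 0 ∧ 0 ≤ β))
    (h : Reach (Zv (l, β)).Y lower (x, 0) q) : q = (x, 0) := by
  have hq : q.2 ≤ 0 := h.mem_right
  rcases lt_or_ge β 0 with hβ | hβ
  · have hx : x < 0 := by
      rcases hx with h | h
      · exact h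
      · linarith [h.2]
    obtain ⟨-, -, hA, h1, hs⟩ := (reach_Y_iff_of_neg hβ).1 h
    simp only [intY] at hA h1 hs
    have hs' := hs (by nlinarith)
    have h2 : q.1 < 0 := by nlinarith
    have h3 : q.1 = x := by nlinarith
    have h4 : q.2 = 0 := by
      rw [h3] at hA
      nlinarith
    exact Prod.ext h3 h4
  · obtain ⟨T, hT, h1, h2, -⟩ := reach_Y_iff_flow.1 h
    simp only [zero_add] at h1 h2
    have m : Real.exp (-T) * Real.exp T = 1 := by rw [← Real.exp_add]; simp
    rcases eq_or_lt_of_le hT with rfl | hT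
    · simp only [neg_zero, Real.exp_zero, mul_one] at h1 h2
      exact Prod.ext (by simp only; linarith) (by simp only; linarith)
    have h3 : 1 < Real.exp T := Real.one_lt_exp_iff.2 hT
    have h4 := Real.exp_pos (-T)
    generalize Real.exp T = S at *
    generalize Real.exp (-T) = S' at *
    have h5 : S' < 1 := by nlinarith
    -- The product is `2 * y` at the final time. Its second factor would be positive for `x < 0`,
    -- but the final point lies in `Σ₋`.
    have key : (S - 1) * (-x * (1 + S') + β * (1 - S')) ≤ 0 := by
      have e : (S - 1) * (-x * (1 + S') + β * (1 - S')) =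
          (x + β) * S' - (x - β) * S - 2 * β := by
        linear_combination (-(x + β)) * m
      rw [e, ← h1, ← h2]; linarith
    have key2 : -x * (1 + S') + β * (1 - S') ≤ 0 := by
      by_contra! h0
      nlinarith
    have hb : 0 ≤ β * (1 - S') := mul_nonneg hβ (by linarith)
    rcases hx with hx | ⟨rfl, -⟩
    · nlinarith
    · have : β = 0 := by nlinarith
      subst this
      simp only [add_zero, zero_mul, sub_zero] at h1 h2
      exact Prod.ext (by simp only; linarith) (by simp only; linarith)

lemma exists_reach_Y_from {l β x w : ℝ} (hβ : β ≤ 0) (hw : w ≤ β) (hw0 : w < 0) (hx : 0 ≤ x) :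
    CanLeave (Zv (l, β)).Y lower (x, w - β) := by
  rcases eq_or_lt_of_le hβ with rfl | hβ
  · refine ⟨((x + w) / 4 + (x - w), (x + w) / 4 - (x - w)), ?_, ?_⟩
    · intro e
      simp only [Prod.mk.injEq] at e
      linarith [e.1, e.2]
    · refine (reach_Y_iff_of_nonneg le_rfl).2 ⟨by simpa using hw, by simp only; linarith, ?_, ?_⟩
      · simp only [sub_zero, add_zero]; ring
      · left
        simp only [sub_zero, add_zero]
        constructor <;> linarith
  · have hpos : 0 ≤ (x + 1) ^ 2 - x ^ 2 + w ^ 2 := by nlinarith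
    refine ⟨(x + 1, -√((x + 1) ^ 2 - x ^ 2 + w ^ 2) - β), by simp, ?_⟩
    refine (reach_Y_iff_of_neg hβ).2 ⟨by simpa using hw, ?_, ?_, by simp, ?_⟩
    · have : -β ≤ √((x + 1) ^ 2 - x ^ 2 + w ^ 2) := Real.le_sqrt_of_sq_le (by nlinarith)
      simp only; linarith
    · simp only [intY, sub_add_cancel, neg_sq, Real.sq_sqrt hpos]; ring
    · simp only [intY, sub_add_cancel]
      intro h0
      have : 0 < x := by
        by_contra! h1
        have : x = 0 := le_antisymm h1 hx
        subst this
        nlinarith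
      positivity

/-- `Y.f = -x`, so trajectories enter `Σ₋` from the right half of `Σ`. From the contact point itself
one enters only if the fold is visible. -/
lemma canLeave_Y_iff {l β x : ℝ} :
    CanLeave (Zv (l, β)).Y lower (x, 0) ↔ 0 < x ∨ (x = 0 ∧ β < 0) := by
  constructor
  · rintro ⟨q, h1, h2⟩
    by_contra! hc
    refine h1 (eq_of_reach_Y_from ?_ h2)
    rcases eq_or_lt_of_le hc.1 with h | h
    · exact Or.inr ⟨h, hc.2 h⟩
    · exact Or.inl h
  · intro h
    rcases lt_or_ge β 0 with hβ | hβ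
    · have hx : 0 ≤ x := by rcases h with h | h <;> linarith
      simpa using exists_reach_Y_from (l := l) hβ.le le_rfl hβ hx
    · have hx : 0 < x := by
        rcases h with h | h
        · exact h
        · linarith [h.2]
      rcases lt_or_ge x β with h0 | h0
      · refine ⟨(-x, 0), by simp; linarith, (reach_Y_iff_of_nonneg hβ).2 ⟨le_rfl, le_rfl, ?_, ?_⟩⟩
        · ring
        · right; left
          simp only; constructor <;> linarith
      -- From `x ≥ β` the orbit does not return to `Σ`. The witness is again the point reached after
      -- time `log 2`.
      · refine ⟨((x + β) / 4 + (x - β), (x + β) / 4 - (x - β) - β), ?_,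
          (reach_Y_iff_of_nonneg hβ).2 ⟨le_rfl, by simp only; linarith, ?_, ?_⟩⟩
        · intro e
          simp only [Prod.mk.injEq] at e
          linarith [e.1, e.2]
        · simp only; ring
        · simp only
          rcases eq_or_lt_of_le h0 with h1 | h1
          · right; right; left
            constructor <;> linarith
          · left; constructor <;> linarith

lemma canArrive_Y_boundary_iff {l β x : ℝ} :
    CanArrive (Zv (l, β)).Y lower (x, 0) ↔ x < 0 ∨ (x = 0 ∧ β < 0) := by
  rw [canArrive_Y_iff, canLeave_Y_iff]
  simp

/-- Points of `D` through which only constant trajectories pass. -/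
def Stationary (V : Pt → Pt) (D : Set Pt) (p : Pt) : Prop :=
  p ∈ D ∧ ¬ CanLeave V D p ∧ ¬ CanArrive V D p

lemma not_stationary_of_neg {l β : ℝ} (hβ : β ≤ 0) {p : Pt} (hw : p.2 + β < 0) :
    ¬ Stationary (Zv (l, β)).Y lower p := by
  rintro ⟨h0, h1, h2⟩
  have hp : p.2 ≤ 0 := h0
  rw [canArrive_Y_iff] at h2
  rcases le_total 0 p.1 with h | h
  · exact h1 (by simpa using exists_reach_Y_from (l := l) hβ (by linarith) hw h)
  · exact h2 (by
      simpa using exists_reach_Y_from (l := l) hβ (by linarith) hw (by linarith : 0 ≤ -p.1))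

lemma stationary_saddle {l β : ℝ} (hβ : 0 ≤ β) : Stationary (Zv (l, β)).Y lower (0, -β) := by
  have key : ∀ {q}, Reach (Zv (l, β)).Y lower (0, -β) q → q = (0, -β) := by
    intro q h
    obtain ⟨T, hT, h1, h2, -⟩ := reach_Y_iff_flow.1 h
    simp only [neg_add_cancel, add_zero, zero_mul, sub_zero] at h1 h2
    exact Prod.ext (by simp only; linarith) (by simp only; linarith)
  have h1 : ¬ CanLeave (Zv (l, β)).Y lower (0, -β) := by
    rintro ⟨q, h1, h2⟩
    exact h1 (key h2)
  refine ⟨by simpa [lower] using hβ, h1, ?_⟩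
  rw [canArrive_Y_iff]
  simpa using h1

lemma CarriesOrbits.mem_iff {h : Pt ≃ₜ Pt} {V V' : Pt → Pt} {D D' : Set Pt}
    (H : CarriesOrbits h V D V' D') (p : Pt) : p ∈ D ↔ h p ∈ D' :=
  ⟨fun hp => ((H p p).1 (Reach.refl hp)).mem_left, fun hp => ((H p p).2 (Reach.refl hp)).mem_left⟩

lemma CarriesOrbits.stationary_iff {h : Pt ≃ₜ Pt} {V V' : Pt → Pt} {D D' : Set Pt}
    (H : CarriesOrbits h V D V' D') (p : Pt) : Stationary V D p ↔ Stationary V' D' (h p) := by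
  rw [Stationary, Stationary, H.mem_iff, H.canLeave_iff, H.canArrive_iff]

/-- The only equilibrium of `Y` is the saddle `(0, -β)`, which lies in `Σ₋` exactly when `β ≥ 0`. It
is off `Σ` when `β > 0`, which gives the companion criterion. -/
lemma neg_iff_no_stationary {l β : ℝ} :
    β < 0 ↔ ∀ p, ¬ Stationary (Zv (l, β)).Y lower p := by
  constructor
  · intro h p hp
    have : p.2 ≤ 0 := hp.1
    exact not_stationary_of_neg h.le (by linarith) hp
  · intro h
    by_contra! hβ
    exact h _ (stationary_saddle hβ)

lemma pos_iff_stationary {l β : ℝ} :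
    0 < β ↔ ∃ p, p.2 ≠ 0 ∧ Stationary (Zv (l, β)).Y lower p := by
  constructor
  · intro h
    exact ⟨_, by simp [h.ne'], stationary_saddle h.le⟩
  · rintro ⟨p, h1, h2⟩
    by_contra! hβ
    have : p.2 < 0 := lt_of_le_of_ne h2.1 h1
    exact not_stationary_of_neg hβ (by linarith) h2

lemma CarriesLower.sameSign {h : Pt ≃ₜ Pt} {l β l' β' : ℝ}
    (H : CarriesLower h (Zv (l, β)) (Zv (l', β'))) : SameSign β β' := by
  constructor
  · rw [pos_iff_stationary (l := l), pos_iff_stationary (l := l')]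
    constructor
    · rintro ⟨p, h1, h2⟩
      exact ⟨h p, by rwa [Ne, H.1.snd_eq_zero_iff], (H.2.stationary_iff p).1 h2⟩
    · rintro ⟨p, h1, h2⟩
      refine ⟨h.symm p, ?_, (H.2.stationary_iff _).2 (by simpa using h2)⟩
      rw [Ne, ← H.1.snd_eq_zero_iff]; simpa using h1
  · rw [neg_iff_no_stationary (l := l), neg_iff_no_stationary (l := l')]
    constructor
    · intro h1 p hp
      exact h1 (h.symm p) ((H.2.stationary_iff _).2 (by simpa using hp))
    · intro h1 p hp
      exact h1 (h p) ((H.2.stationary_iff p).1 hp)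

/-- On `Σ`, trajectories of `X` can leave from `x ≥ l` and arrive at `x ≤ l`. The fold is the only
point that allows both. -/
lemma CarriesUpper.map_fold {h : Pt ≃ₜ Pt} {l β l' β' : ℝ}
    (H : CarriesUpper h (Zv (l, β)) (Zv (l', β'))) : h (l, 0) = (l', 0) := by
  have h2 : (h (l, 0)).2 = 0 := (H.1.snd_eq_zero_iff _).2 rfl
  obtain ⟨x, hx⟩ : ∃ x, h (l, 0) = (x, 0) := ⟨_, Prod.ext rfl h2⟩
  have h3 := (H.2.canLeave_iff (l, 0)).1 (canLeave_X_iff.2 le_rfl)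
  have h4 := (H.2.canArrive_iff (l, 0)).1 (canArrive_X_boundary_iff.2 le_rfl)
  rw [hx, canLeave_X_iff] at h3
  rw [hx, canArrive_X_boundary_iff] at h4
  rw [hx, le_antisymm h4 h3]

/-- The points of `Σ` with `x > 0` are those that `Y` can leave but not reach, and those with `x <
0` the other way round. Apply this to the fold of `X`, whose image is known. -/
lemma sameSign_fold {h : Pt ≃ₜ Pt} {l β l' β' : ℝ}
    (H1 : CarriesUpper h (Zv (l, β)) (Zv (l', β')))
    (H2 : CarriesLower h (Zv (l, β)) (Zv (l', β'))) : SameSign l l' := by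
  have hd := H1.map_fold
  have h1 := H2.2.canLeave_iff (l, 0)
  have h2 := H2.2.canArrive_iff (l, 0)
  rw [hd, canLeave_Y_iff, canLeave_Y_iff] at h1
  rw [hd, canArrive_Y_boundary_iff, canArrive_Y_boundary_iff] at h2
  have pos : ∀ {l β : ℝ}, 0 < l ↔ (0 < l ∨ (l = 0 ∧ β < 0)) ∧ ¬ (l < 0 ∨ (l = 0 ∧ β < 0)) := by
    intro l β
    constructor
    · intro h
      refine ⟨Or.inl h, ?_⟩
      rintro (h' | h')
      · linarith
      · linarith [h'.1]
    · rintro ⟨h | h, h'⟩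
      · exact h
      · exact absurd (Or.inr h) h'
  have neg : ∀ {l β : ℝ}, l < 0 ↔ (l < 0 ∨ (l = 0 ∧ β < 0)) ∧ ¬ (0 < l ∨ (l = 0 ∧ β < 0)) := by
    intro l β
    constructor
    · intro h
      refine ⟨Or.inl h, ?_⟩
      rintro (h' | h')
      · linarith
      · linarith [h'.1]
    · rintro ⟨h | h, h'⟩
      · exact h
      · exact absurd (Or.inr h) h'
  constructor
  · rw [pos (l := l) (β := β), pos (l := l') (β := β'), h1, h2]
  · rw [neg (l := l) (β := β), neg (l := l') (β := β'), h1, h2]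

/-- Points of `Σ` that a trajectory of `V` in `D` joins to another point of `Σ`. -/
def jumpSource (V : Pt → Pt) (D : Set Pt) : Set Pt :=
  {p | p.2 = 0 ∧ ∃ q : Pt, q.2 = 0 ∧ q ≠ p ∧ Reach V D p q}

/-- Points of `Σ` to which a trajectory of `V` in `D` leads from another point of `Σ`. -/
def jumpTarget (V : Pt → Pt) (D : Set Pt) : Set Pt :=
  {p | p.2 = 0 ∧ ∃ q : Pt, q.2 = 0 ∧ q ≠ p ∧ Reach V D q p}

lemma jumpSource_Y {l β : ℝ} (hβ : 0 < β) :
    jumpSource (Zv (l, β)).Y lower = (fun x => ((x, 0) : Pt)) '' Ioo 0 β := by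
  ext p
  constructor
  · rintro ⟨hp, q, hq, hne, h⟩
    have hp' : p = (p.1, 0) := Prod.ext rfl hp
    have hpos : 0 < p.1 := by
      have : CanLeave (Zv (l, β)).Y lower (p.1, 0) := by rw [← hp']; exact ⟨q, hne, h⟩
      rcases canLeave_Y_iff.1 this with h | h
      · exact h
      · linarith [h.2]
    obtain ⟨T, hT, h1, h2, -⟩ := reach_Y_iff_flow.1 h
    have hK := h.orbY.1
    rw [hp, hq] at hK h2
    have hqp : q.1 = -p.1 := by
      have : (q.1 - p.1) * (q.1 + p.1) = 0 := by linarith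
      rcases mul_eq_zero.1 this with h | h
      · exact absurd (Prod.ext (by linarith) (by rw [hp, hq])) hne
      · linarith
    refine ⟨p.1, ⟨hpos, ?_⟩, hp'.symm⟩
    by_contra! hc
    -- For `x ≥ β` the coordinate `v = x - β` starts nonnegative and stays so, whereas `v = -x - β <
    -- 0` at the candidate end `(-x, 0)`.
    have := mul_nonneg (by linarith : 0 ≤ p.1 - (0 + β)) (Real.exp_pos T).le
    rw [← h2] at this
    linarith
  · rintro ⟨x, ⟨h0, h1⟩, rfl⟩
    refine ⟨rfl, (-x, 0), rfl, by simp; linarith,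
      (reach_Y_iff_of_nonneg hβ.le).2 ⟨le_rfl, le_rfl, by simp only; ring, Or.inr (Or.inl ?_)⟩⟩
    simp only; constructor <;> linarith

lemma jumpTarget_Y {l β : ℝ} (hβ : 0 < β) :
    jumpTarget (Zv (l, β)).Y lower = (fun x => ((x, 0) : Pt)) '' Ioo (-β) 0 := by
  have key : ∀ p : Pt, p ∈ jumpTarget (Zv (l, β)).Y lower ↔
      ((-p.1, p.2) : Pt) ∈ jumpSource (Zv (l, β)).Y lower := by
    intro p
    constructor
    · rintro ⟨hp, q, hq, hne, h⟩
      exact ⟨hp, (-q.1, q.2), hq, by simpa using reflect_ne (c := 0) hne, reach_Y_reverse h⟩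
    · rintro ⟨hp, q, hq, hne, h⟩
      refine ⟨hp, (-q.1, q.2), hq, fun e => hne ?_, by simpa using reach_Y_reverse h⟩
      rw [← e]; simp
  ext p
  rw [key, jumpSource_Y hβ]
  constructor
  · rintro ⟨x, ⟨h0, h1⟩, e⟩
    simp only [Prod.mk.injEq] at e
    exact ⟨-x, ⟨by linarith, by linarith⟩, Prod.ext (by simp only; linarith) e.2⟩
  · rintro ⟨x, ⟨h0, h1⟩, rfl⟩
    exact ⟨-x, ⟨by linarith, by linarith⟩, rfl⟩

lemma CarriesLower.image_jumpSource {h : Pt ≃ₜ Pt} {Z W : NSField} (H : CarriesLower h Z W) :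
    h '' jumpSource Z.Y lower = jumpSource W.Y lower := by
  refine image_eq_of_mem_iff fun p => and_congr (H.1.snd_eq_zero_iff p).symm ?_
  constructor
  · rintro ⟨q, h1, h2, h3⟩
    exact ⟨h q, (H.1.snd_eq_zero_iff q).2 h1, h.injective.ne h2, (H.2 _ _).1 h3⟩
  · rintro ⟨q, h1, h2, h3⟩
    refine ⟨h.symm q, (H.1.snd_eq_zero_iff _).1 (by simpa using h1),
      fun e => h2 (by rw [← e]; simp),
      (H.2 _ _).2 (by simpa using h3)⟩

lemma CarriesLower.image_jumpTarget {h : Pt ≃ₜ Pt} {Z W : NSField} (H : CarriesLower h Z W) :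
    h '' jumpTarget Z.Y lower = jumpTarget W.Y lower := by
  refine image_eq_of_mem_iff fun p => and_congr (H.1.snd_eq_zero_iff p).symm ?_
  constructor
  · rintro ⟨q, h1, h2, h3⟩
    exact ⟨h q, (H.1.snd_eq_zero_iff q).2 h1, h.injective.ne h2, (H.2 _ _).1 h3⟩
  · rintro ⟨q, h1, h2, h3⟩
    refine ⟨h.symm q, (H.1.snd_eq_zero_iff _).1 (by simpa using h1),
      fun e => h2 (by rw [← e]; simp),
      (H.2 _ _).2 (by simpa using h3)⟩

lemma mem_closure_segment_iff {a b x : ℝ} (hab : a < b) :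
    ((x, 0) : Pt) ∈ closure ((fun x => ((x, 0) : Pt)) '' Ioo a b) ↔ a ≤ x ∧ x ≤ b := by
  constructor
  · intro h
    have hc : IsClosed {p : Pt | a ≤ p.1 ∧ p.1 ≤ b} :=
      (isClosed_le continuous_const continuous_fst).inter
        (isClosed_le continuous_fst continuous_const)
    exact closure_minimal (by rintro _ ⟨y, hy, rfl⟩; exact ⟨hy.1.le, hy.2.le⟩) hc h
  · intro h
    refine image_closure_subset_closure_image (by fun_prop) ⟨x, ?_, rfl⟩
    rw [closure_Ioo hab.ne]; exact h

lemma mem_image_segment_iff {s : Set ℝ} {x : ℝ} :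
    ((x, 0) : Pt) ∈ (fun x => ((x, 0) : Pt)) '' s ↔ x ∈ s := by simp

/-- The jump intervals are `(0, β)` and `(-β, 0)`, and a homeomorphism respects membership in them
and in their closures. For the fold `d`, the first decides `|l| < β` and the second `|l| ≤ β`. -/
lemma sameOrder_of_carries {h : Pt ≃ₜ Pt} {l β l' β' : ℝ}
    (H1 : CarriesUpper h (Zv (l, β)) (Zv (l', β')))
    (H2 : CarriesLower h (Zv (l, β)) (Zv (l', β'))) (hβ : 0 < β) (hβ' : 0 < β') (hl : l ≠ 0) :
    SameOrder l β l' β' := by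
  have hd := H1.map_fold
  have hs := sameSign_fold H1 H2
  have conclude : ∀ {a a' : ℝ}, (a < β ↔ a' < β') → (a ≤ β ↔ a' ≤ β') →
      (a < β ∧ a' < β') ∨ (a = β ∧ a' = β') ∨ (β < a ∧ β' < a') := by
    intro a a' i1 i2
    rcases lt_trichotomy a β with h | h | h
    · exact Or.inl ⟨h, i1.1 h⟩
    · refine Or.inr (Or.inl ⟨h, le_antisymm (i2.1 h.le) (not_lt.1 fun h' => ?_)⟩)
      exact absurd (i1.2 h') h.not_lt
    · exact Or.inr (Or.inr ⟨h, not_le.1 fun h' => absurd (i2.2 h') (not_le.2 h)⟩)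
  rcases lt_or_gt_of_ne hl with h0 | h0
  · have h0' := hs.2.1 h0
    have e := H2.image_jumpTarget
    rw [jumpTarget_Y hβ, jumpTarget_Y hβ'] at e
    have i1 := h.injective.mem_set_image (s := (fun x => ((x, 0) : Pt)) '' Ioo (-β) 0) (a := (l, 0))
    rw [e, hd, mem_image_segment_iff, mem_image_segment_iff, mem_Ioo, mem_Ioo] at i1
    have i2 := h.injective.mem_set_image (s := closure ((fun x => ((x, 0) : Pt)) '' Ioo (-β) 0))
      (a := (l, 0))
    rw [h.image_closure, e, hd, mem_closure_segment_iff (by linarith),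
      mem_closure_segment_iff (by linarith)] at i2
    rw [SameOrder, abs_of_neg h0, abs_of_neg h0']
    refine conclude ?_ ?_
    · constructor <;> intro h5
      · linarith [(i1.2 ⟨by linarith, h0⟩).1]
      · linarith [(i1.1 ⟨by linarith, h0'⟩).1]
    · constructor <;> intro h5
      · linarith [(i2.2 ⟨by linarith, h0.le⟩).1]
      · linarith [(i2.1 ⟨by linarith, h0'.le⟩).1]
  · have h0' := hs.1.1 h0
    have e := H2.image_jumpSource
    rw [jumpSource_Y hβ, jumpSource_Y hβ'] at e
    have i1 := h.injective.mem_set_image (s := (fun x => ((x, 0) : Pt)) '' Ioo 0 β) (a := (l, 0))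
    rw [e, hd, mem_image_segment_iff, mem_image_segment_iff, mem_Ioo, mem_Ioo] at i1
    have i2 := h.injective.mem_set_image (s := closure ((fun x => ((x, 0) : Pt)) '' Ioo 0 β))
      (a := (l, 0))
    rw [h.image_closure, e, hd, mem_closure_segment_iff (by linarith),
      mem_closure_segment_iff (by linarith)] at i2
    rw [SameOrder, abs_of_pos h0, abs_of_pos h0']
    refine conclude ?_ ?_
    · constructor <;> intro h5
      · exact (i1.2 ⟨h0, by linarith⟩).2
      · exact (i1.1 ⟨h0', by linarith⟩).2
    · constructor <;> intro h5
      · exact (i2.2 ⟨h0.le, by linarith⟩).2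
      · exact (i2.1 ⟨h0'.le, by linarith⟩).2

/-! ### Invariants of the sliding vector field -/

lemma sewing_empty_iff {l β : ℝ} : (Zv (l, β)).sewing = ∅ ↔ l = 0 := by
  constructor
  · intro h
    by_contra h0
    have : ((l / 2, 0) : Pt) ∈ (Zv (l, β)).sewing := by
      refine mem_sewing.2 ⟨rfl, ?_⟩
      rcases lt_or_gt_of_ne h0 with h0 | h0
      · rw [min_eq_left h0.le, max_eq_right h0.le]
        constructor <;> simp only <;> linarith
      · rw [min_eq_right h0.le, max_eq_left h0.le]
        constructor <;> simp only <;> linarith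
    rw [h] at this
    exact this
  · rintro rfl
    ext p
    rw [mem_sewing]
    simp only [min_self, max_self, mem_empty_iff_false, iff_false]
    rintro ⟨-, h1, h2⟩
    linarith

lemma CarriesSliding.zero_iff {h : Pt ≃ₜ Pt} {l β l' β' : ℝ}
    (H : CarriesSliding h (Zv (l, β)) (Zv (l', β'))) : l = 0 ↔ l' = 0 := by
  rw [← sewing_empty_iff (β := β), ← sewing_empty_iff (β := β'), ← H.2.1, image_eq_empty]

/-- The pseudo-equilibrium has the sign opposite to `l`, so it is in `Σ₂` exactly if `l < 0`, and it
is then a point of `Σ₂` that cannot be left. -/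
lemma neg_iff_stationary_escaping {l β : ℝ} (hβ : 0 < β) (h1 : β < 1) :
    l < 0 ↔ ∃ p ∈ (Zv (l, β)).escaping,
      ¬ CanLeave (Zv (l, β)).slide (Zv (l, β)).slidingDomain p := by
  constructor
  · intro h
    have hP := (pseudo_pos_iff hβ h1).2 h
    refine ⟨(pseudo l β, 0), mem_escaping.2 ⟨rfl, by simpa [h.le] using hP⟩, ?_⟩
    rintro ⟨q, hne, hr⟩
    rcases (reach_slide_iff h1).1 hr with ⟨-, hq, ha⟩ | ⟨hq, -, -⟩
    · rcases awayLE_sub_iff.1 ha with h | h | h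
      · exact absurd h.1 (by simp)
      · exact absurd h.2 (by simp)
      · exact hne (Prod.ext h.symm (mem_escaping.1 hq).1)
    · have := (mem_sliding.1 hq).2
      rw [min_eq_left h.le] at this
      simp only at this
      linarith
  · rintro ⟨p, hp, hl⟩
    by_contra! h
    refine hl ⟨(p.1 + 1, 0), fun e => ?_, ?_⟩
    · have := congrArg Prod.fst e
      simp at this
    · have hp' := mem_escaping.1 hp
      have hP : pseudo l β ≤ 0 := by
        rw [← not_lt, pseudo_pos_iff hβ h1]; linarith
      refine (reach_slide_iff h1).2 (Or.inl ⟨hp, mem_escaping.2 ⟨rfl, ?_⟩, Or.inl ⟨?_, ?_⟩⟩)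
      · simp only; linarith [hp'.2]
      · have := (max_lt_iff.1 hp'.2).2
        linarith
      · simp

lemma CarriesSliding.sameSign {h : Pt ≃ₜ Pt} {l β l' β' : ℝ} (hβ : 0 < β) (h1 : β < 1)
    (hβ' : 0 < β') (h1' : β' < 1) (H : CarriesSliding h (Zv (l, β)) (Zv (l', β'))) :
    SameSign l l' := by
  have hz := H.zero_iff
  have hn : l < 0 ↔ l' < 0 := by
    rw [neg_iff_stationary_escaping hβ h1, neg_iff_stationary_escaping hβ' h1']
    obtain ⟨-, -, he, -, ho⟩ := H
    constructor
    · rintro ⟨p, hp, hl⟩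
      exact ⟨h p, he ▸ mem_image_of_mem h hp, by rwa [← ho.canLeave_iff]⟩
    · rintro ⟨p, hp, hl⟩
      rw [← he] at hp
      obtain ⟨q, hq, rfl⟩ := hp
      exact ⟨q, hq, by rwa [ho.canLeave_iff]⟩
  refine ⟨?_, hn⟩
  rw [← not_le, ← not_le, le_iff_lt_or_eq, le_iff_lt_or_eq, hn, hz]

end FoldSaddle

namespace FoldSaddle

/-! ### Fold points, pseudo-equilibria and the direction of the sliding vector field -/

lemma lie_lieF_X (l β : ℝ) (q : Pt) : lie (Zv (l, β)).X (lieF (Zv (l, β)).X) q = 1 := by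
  rw [lie, show lieF (Zv (l, β)).X = fun p => p.1 - l from funext (lieF_X l β), fderiv_sub_const,
    fderiv_fst, Zv_X]
  rfl

lemma lie_lieF_Y (l β : ℝ) (q : Pt) : lie (Zv (l, β)).Y (lieF (Zv (l, β)).Y) q = q.2 + β := by
  rw [lie, show lieF (Zv (l, β)).Y = fun p => -p.1 from funext (lieF_Y l β), fderiv_fun_neg,
    fderiv_fst, Zv_Y]
  simp

lemma isFold_X_iff {l β : ℝ} {q : Pt} : IsFold (Zv (l, β)).X q ↔ q = (l, 0) := by
  rw [IsFold, lieF_X, lie_lieF_X, Prod.ext_iff, sub_eq_zero]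
  change q.2 = 0 ∧ _ ∧ _ ↔ _
  constructor
  · rintro ⟨h1, h2, -⟩; exact ⟨h2, h1⟩
  · rintro ⟨h1, h2⟩; exact ⟨h2, h1, one_ne_zero⟩

lemma isFold_Y_iff {l β : ℝ} {q : Pt} : IsFold (Zv (l, β)).Y q ↔ q = (0, 0) ∧ β ≠ 0 := by
  rw [IsFold, lieF_Y, lie_lieF_Y, Prod.ext_iff, neg_eq_zero]
  change q.2 = 0 ∧ _ ∧ _ ↔ _
  constructor
  · rintro ⟨h1, h2, h3⟩
    rw [h1, zero_add] at h3
    exact ⟨⟨h2, h1⟩, h3⟩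
  · rintro ⟨⟨h1, h2⟩, h3⟩
    exact ⟨h2, h1, by rwa [h2, zero_add]⟩

lemma isVisibleFoldUpper_X (l β : ℝ) : IsVisibleFoldUpper (Zv (l, β)).X (l, 0) := by
  rw [IsVisibleFoldUpper, lieF_X, lie_lieF_X]
  exact ⟨rfl, sub_self _, one_pos⟩

lemma isVisibleFoldLower_Y_iff (l β : ℝ) : IsVisibleFoldLower (Zv (l, β)).Y (0, 0) ↔ β < 0 := by
  rw [IsVisibleFoldLower, lieF_Y, lie_lieF_Y]
  simp [switching]

lemma slide_fst_eq {l β : ℝ} (hβ : β < 1) {q : Pt} (hq : q ∈ (Zv (l, β)).slidingDomain) :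
    ((Zv (l, β)).slide q).1 = (β - 1) / (l - 2 * q.1) * (q.1 - pseudo l β) := by
  rw [slide_eq hβ hq]

lemma escaping_factor {l β x : ℝ} (hβ : β < 1) (h : max l 0 < x) : 0 < (β - 1) / (l - 2 * x) :=
  div_pos_of_neg_of_neg (by linarith) (escaping_denom h)

lemma sliding_factor {l β x : ℝ} (hβ : β < 1) (h : x < min l 0) : (β - 1) / (l - 2 * x) < 0 :=
  div_neg_of_neg_of_pos (by linarith) (sliding_denom h)

lemma slide_fst_pos_of_nonpos {l β : ℝ} (hβ : β ≤ 0) {q : Pt}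
    (hq : q ∈ (Zv (l, β)).slidingDomain) : 0 < ((Zv (l, β)).slide q).1 := by
  have hP := pseudo_mem_sewing_closure (l := l) (by linarith : β < 1) (Or.inl hβ)
  rw [slide_fst_eq (by linarith) hq]
  rcases (mem_slidingDomain.1 hq).2 with h | h
  · exact mul_pos (escaping_factor (by linarith) h) (by linarith)
  · exact mul_pos_of_neg_of_neg (sliding_factor (by linarith) h) (by linarith)

lemma slide_eq_of_zero {β : ℝ} (hβ : β < 1) {q : Pt} (hq : q ∈ (Zv (0, β)).slidingDomain) :
    (Zv (0, β)).slide q = ((1 - β) / 2, 0) := by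
  have h0 : q.1 ≠ 0 := by
    rcases (mem_slidingDomain.1 hq).2 with h | h
    · simp only [max_self] at h; exact h.ne'
    · simp only [min_self] at h; exact h.ne
  rw [slide_eq hβ hq]
  refine Prod.ext ?_ rfl
  simp only [pseudo, mul_zero, zero_div, sub_zero, zero_sub]
  field_simp
  ring

lemma slide_fst_neg_escaping {l β : ℝ} (hβ : 0 < β) (h1 : β < 1) (hl : l < 0) :
    ∀ᶠ q in 𝓝[(Zv (l, β)).escaping] (0, 0), ((Zv (l, β)).slide q).1 < 0 := by
  have hP := (pseudo_pos_iff hβ h1).2 hl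
  have h2 : ∀ᶠ q : Pt in 𝓝 (0, 0), q.1 < pseudo l β :=
    continuous_fst.continuousAt.eventually (gt_mem_nhds hP)
  filter_upwards [mem_nhdsWithin_of_mem_nhds h2, self_mem_nhdsWithin] with q hq hq'
  rw [slide_fst_eq h1 (Or.inl hq')]
  exact mul_neg_of_pos_of_neg (escaping_factor h1 (mem_escaping.1 hq').2) (sub_neg.2 hq)

lemma slide_fst_neg_sliding {l β : ℝ} (hβ : 0 < β) (h1 : β < 1) (hl : 0 < l) :
    ∀ᶠ q in 𝓝[(Zv (l, β)).sliding] (0, 0), ((Zv (l, β)).slide q).1 < 0 := by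
  have hP := (pseudo_neg_iff hβ h1).2 hl
  have h2 : ∀ᶠ q : Pt in 𝓝 (0, 0), pseudo l β < q.1 :=
    continuous_fst.continuousAt.eventually (lt_mem_nhds hP)
  filter_upwards [mem_nhdsWithin_of_mem_nhds h2, self_mem_nhdsWithin] with q hq hq'
  rw [slide_fst_eq h1 (Or.inr hq')]
  exact mul_neg_of_neg_of_pos (sliding_factor h1 (mem_sliding.1 hq').2) (sub_pos.2 hq)

lemma slide_fst_pos_sliding {l β : ℝ} (hβ : 0 < β) (h1 : β < 1) (hl : l < 0) {q : Pt}
    (hq : q ∈ (Zv (l, β)).sliding) : 0 < ((Zv (l, β)).slide q).1 := by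
  have hP := (pseudo_pos_iff hβ h1).2 hl
  have h := (mem_sliding.1 hq).2
  rw [slide_fst_eq h1 (Or.inr hq)]
  refine mul_pos_of_neg_of_neg (sliding_factor h1 h) ?_
  have := (lt_min_iff.1 h).2
  linarith

lemma slide_fst_pos_escaping {l β : ℝ} (hβ : 0 < β) (h1 : β < 1) (hl : 0 < l) {q : Pt}
    (hq : q ∈ (Zv (l, β)).escaping) : 0 < ((Zv (l, β)).slide q).1 := by
  have hP := (pseudo_neg_iff hβ h1).2 hl
  have h := (mem_escaping.1 hq).2
  rw [slide_fst_eq h1 (Or.inl hq)]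
  refine mul_pos (escaping_factor h1 h) ?_
  have := (max_lt_iff.1 h).2
  linarith

lemma slide_eq_zero_iff {l β : ℝ} (hβ : β < 1) {q : Pt} (hq : q ∈ (Zv (l, β)).slidingDomain) :
    (Zv (l, β)).slide q = 0 ↔ q.1 = pseudo l β := by
  have hf : (β - 1) / (l - 2 * q.1) ≠ 0 := by
    rcases (mem_slidingDomain.1 hq).2 with h | h
    · exact (escaping_factor hβ h).ne'
    · exact (sliding_factor hβ h).ne
  rw [slide_eq hβ hq, Prod.ext_iff]
  simp only [Prod.fst_zero, Prod.snd_zero, and_true, mul_eq_zero, hf, false_or, sub_eq_zero]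

lemma pseudoEquilibria_empty {l β : ℝ} (hβ : β < 1) (h : β ≤ 0 ∨ l = 0) :
    {q | (Zv (l, β)).IsPseudoEquilibrium q} = ∅ := by
  ext q
  simp only [mem_ofPred_eq, mem_empty_iff_false, iff_false]
  rintro ⟨h1, h2⟩
  rw [slide_eq_zero_iff hβ h1] at h2
  have hP := pseudo_mem_sewing_closure hβ h
  rcases (mem_slidingDomain.1 h1).2 with h | h <;> linarith

lemma pseudo_mem_escaping {l β : ℝ} (hβ : 0 < β) (h1 : β < 1) (hl : l < 0) :
    ((pseudo l β, 0) : Pt) ∈ (Zv (l, β)).escaping := by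
  refine mem_escaping.2 ⟨rfl, ?_⟩
  rw [max_eq_right hl.le]
  exact (pseudo_pos_iff hβ h1).2 hl

lemma pseudo_mem_sliding {l β : ℝ} (hβ : 0 < β) (h1 : β < 1) (hl : 0 < l) :
    ((pseudo l β, 0) : Pt) ∈ (Zv (l, β)).sliding := by
  refine mem_sliding.2 ⟨rfl, ?_⟩
  rw [min_eq_right hl.le]
  exact (pseudo_neg_iff hβ h1).2 hl

lemma pseudoEquilibria_eq {l β : ℝ} (hβ : 0 < β) (h1 : β < 1) (hl : l ≠ 0) :
    {q | (Zv (l, β)).IsPseudoEquilibrium q} = {(pseudo l β, 0)} := by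
  ext q
  simp only [mem_ofPred_eq, mem_singleton_iff]
  constructor
  · rintro ⟨h2, h3⟩
    exact Prod.ext ((slide_eq_zero_iff h1 h2).1 h3) (mem_slidingDomain.1 h2).1
  · rintro rfl
    have hm : ((pseudo l β, 0) : Pt) ∈ (Zv (l, β)).slidingDomain := by
      rcases lt_or_gt_of_ne hl with h | h
      · exact Or.inl (pseudo_mem_escaping hβ h1 h)
      · exact Or.inr (pseudo_mem_sliding hβ h1 h)
    exact ⟨hm, (slide_eq_zero_iff h1 hm).2 rfl⟩

lemma hasDerivAt_decay (P z s : ℝ) : HasDerivAt (fun s => ((P + z * Real.exp (-s), 0) : Pt))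
    (-(z * Real.exp (-s)), 0) s := by
  refine HasDerivAt.prodMk ?_ (hasDerivAt_const s 0)
  refine (((hasDerivAt_neg s).exp.const_mul z).const_add P).congr_deriv ?_
  ring

lemma tendsto_decay (P z : ℝ) :
    Tendsto (fun s : ℝ => ((P + z * Real.exp (-s), 0) : Pt)) atTop (𝓝 (P, 0)) := by
  refine Tendsto.prodMk_nhds ?_ tendsto_const_nhds
  have := ((Real.tendsto_exp_neg_atTop_nhds_zero).const_mul z).const_add P
  simpa using this

/-- The curves `P + z * exp (-s)` are trajectories up to a change of time, and the whole of `Σ₃` is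
attracted. The clock `(l - 2 * x) / (1 - β)` is bounded below by `l / (1 - β)` because `x < 0`, so
the time-changed trajectory exists for all positive times. -/
lemma isSigmaAttractor_pseudo {l β : ℝ} (hβ : 0 < β) (h1 : β < 1) (hl : 0 < l) :
    IsSigmaAttractor (Zv (l, β)) (pseudo l β, 0) := by
  have hP := (pseudo_neg_iff hβ h1).2 hl
  have hE := pseudoEquilibria_eq hβ h1 hl.ne'
  refine ⟨by rw [Set.ext_iff] at hE; exact (hE _).2 rfl, pseudo_mem_sliding hβ h1 hl, ?_⟩
  refine ⟨{p | p.1 < 0}, (isOpen_lt continuous_fst continuous_const).mem_nhds hP, ?_⟩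
  rintro p ⟨hp0, hp⟩
  replace hp0 : p.1 < 0 := hp0
  set P := pseudo l β with hPdef
  have hx : ∀ s : ℝ, 0 ≤ s → P + (p.1 - P) * Real.exp (-s) < 0 := fun s hs => by
    have e1 : Real.exp (-s) ≤ 1 := Real.exp_le_one_iff.2 (by linarith)
    have e2 := Real.exp_pos (-s)
    nlinarith
  have := trajectory_of_param (V := (Zv (l, β)).slide) (D := (Zv (l, β)).slidingDomain)
    (q := (P, 0)) (σ := fun s => ((P + (p.1 - P) * Real.exp (-s), 0) : Pt))
    (g := fun s => (l - 2 * (P + (p.1 - P) * Real.exp (-s))) / (1 - β)) (c := l / (1 - β))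
    (div_pos hl (by linarith)) (by fun_prop)
    (fun s hs => div_le_div_of_nonneg_right (by linarith [hx s hs]) (by linarith))
    (fun s hs => by
      have hlt : P + (p.1 - P) * Real.exp (-s) < min l 0 := by
        rw [min_eq_right hl.le]; exact hx s hs
      have hmem : ((P + (p.1 - P) * Real.exp (-s), 0) : Pt) ∈ (Zv (l, β)).slidingDomain :=
        mem_slidingDomain.2 ⟨rfl, Or.inr hlt⟩
      refine ⟨hmem, (hasDerivAt_decay _ _ s).congr_deriv ?_⟩
      rw [slide_eq h1 hmem]
      have h3 := (sliding_denom hlt).ne'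
      have h4 : 1 - β ≠ 0 := by linarith
      refine Prod.ext ?_ (by simp)
      simp only [Prod.smul_mk, smul_eq_mul, ← hPdef]
      rw [show (β - 1) = -(1 - β) by ring, neg_div,
        neg_mul ((1 - β) / (l - 2 * (P + (p.1 - P) * Real.exp (-s)))), mul_neg,
        div_mul_div_cancel_mul h3 h4]
      ring)
    (tendsto_decay _ _)
  convert this using 4
  refine Prod.ext ?_ (mem_slidingDomain.1 hp).1
  simp

lemma isSigmaRepeller_pseudo {l β : ℝ} (hβ : 0 < β) (h1 : β < 1) (hl : l < 0) :
    IsSigmaRepeller (Zv (l, β)) (pseudo l β, 0) := by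
  have hP := (pseudo_pos_iff hβ h1).2 hl
  have hE := pseudoEquilibria_eq hβ h1 hl.ne
  refine ⟨by rw [Set.ext_iff] at hE; exact (hE _).2 rfl, pseudo_mem_escaping hβ h1 hl, ?_⟩
  refine ⟨{p | 0 < p.1}, (isOpen_lt continuous_const continuous_fst).mem_nhds hP, ?_⟩
  rintro p ⟨hp0, hp⟩
  replace hp0 : 0 < p.1 := hp0
  set P := pseudo l β with hPdef
  have hx : ∀ s : ℝ, 0 ≤ s → 0 < P + (p.1 - P) * Real.exp (-s) := fun s hs => by
    have e1 : Real.exp (-s) ≤ 1 := Real.exp_le_one_iff.2 (by linarith)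
    have e2 := Real.exp_pos (-s)
    nlinarith
  have := trajectory_of_param (V := fun p => -(Zv (l, β)).slide p)
    (D := (Zv (l, β)).slidingDomain)
    (q := (P, 0)) (σ := fun s => ((P + (p.1 - P) * Real.exp (-s), 0) : Pt))
    (g := fun s => (l - 2 * (P + (p.1 - P) * Real.exp (-s))) / (β - 1)) (c := l / (β - 1))
    (div_pos_of_neg_of_neg hl (by linarith)) (by fun_prop)
    (fun s hs => div_le_div_of_nonpos_of_le (by linarith) (by linarith [hx s hs]))
    (fun s hs => by
      have hlt : max l 0 < P + (p.1 - P) * Real.exp (-s) := by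
        rw [max_eq_right hl.le]; exact hx s hs
      have hmem : ((P + (p.1 - P) * Real.exp (-s), 0) : Pt) ∈ (Zv (l, β)).slidingDomain :=
        mem_slidingDomain.2 ⟨rfl, Or.inl hlt⟩
      refine ⟨hmem, (hasDerivAt_decay _ _ s).congr_deriv ?_⟩
      rw [slide_eq h1 hmem]
      have h3 := (escaping_denom hlt).ne
      have h4 : β - 1 ≠ 0 := by linarith
      refine Prod.ext ?_ (by simp)
      simp only [Prod.neg_mk, Prod.smul_mk, smul_eq_mul, ← hPdef]
      rw [mul_neg, div_mul_div_cancel_mul h3 h4]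
      ring)
    (tendsto_decay _ _)
  convert this using 4
  refine Prod.ext ?_ (mem_slidingDomain.1 hp).1
  simp

end FoldSaddle

namespace FoldSaddle

/-! ### Closed paths -/

lemma forall_of_cyclic {n : ℕ} {S : Fin (n + 1) → Prop} (h : ∀ i, S i → S (i + 1))
    {i₀ : Fin (n + 1)} (h0 : S i₀) (i : Fin (n + 1)) : S i := by
  have key : ∀ k : Fin (n + 1), S (i₀ + k) := by
    intro k
    induction k using Fin.induction with
    | zero => simpa using h0
    | succ k ih =>
      have := h _ ih
      rwa [add_assoc, Fin.coeSucc_eq_succ] at this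
  have := key (i - i₀)
  rwa [add_sub_cancel] at this

lemma exists_cyclic_change {n : ℕ} {S : Fin (n + 1) → Prop} {i j : Fin (n + 1)} (hi : S i)
    (hj : ¬ S j) : ∃ k, S k ∧ ¬ S (k + 1) := by
  by_contra! h
  exact hj (forall_of_cyclic h hi j)

namespace ClosedPath
variable {Z : NSField} (P : ClosedPath Z)

lemma junction_succ (i : Fin (P.n + 1)) : P.junction (i + 1) = P.c (P.t i.succ) := by
  rw [junction]
  by_cases hi : i = Fin.last P.n
  · subst hi
    rw [Fin.last_add_one, Fin.castSucc_zero, P.t_zero, Fin.succ_last, P.t_last, P.closed]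
  · have hlt : i < Fin.last P.n := lt_of_le_of_ne (Fin.le_last i) hi
    congr 2
    ext
    rw [Fin.val_castSucc, Fin.val_add_one_of_lt hlt, Fin.val_succ]

lemma t_lt (i : Fin (P.n + 1)) : P.t i.castSucc < P.t i.succ :=
  P.t_strictMono Fin.castSucc_lt_succ

lemma t_mem (i : Fin (P.n + 2)) : P.t i ∈ Icc (0 : ℝ) 1 :=
  ⟨P.t_zero ▸ P.t_strictMono.monotone (Fin.zero_le i),
    P.t_last ▸ P.t_strictMono.monotone (Fin.le_last i)⟩

/-- The open parameter interval of the `i`-th arc. -/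
def dom (i : Fin (P.n + 1)) : Set ℝ := Ioo (P.t i.castSucc) (P.t i.succ)

lemma dom_subset (i : Fin (P.n + 1)) : P.dom i ⊆ Icc 0 1 := fun _ hr =>
  ⟨(P.t_mem _).1.trans hr.1.le, hr.2.le.trans (P.t_mem _).2⟩

/-- Arcs are orbits only over open parameter intervals. Closed conditions pass to the junctions by
continuity; this and `start_mem` are the means of controlling junctions. -/
lemma end_mem {i : Fin (P.n + 1)} {r : ℝ} (hr : r ∈ P.dom i) {F : Set Pt} (hF : IsClosed F)
    (h : ∀ s ∈ P.dom i, r ≤ s → P.c s ∈ F) : P.junction (i + 1) ∈ F := by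
  rw [P.junction_succ]
  have hc : Tendsto P.c (𝓝[Ioo r (P.t i.succ)] (P.t i.succ)) (𝓝 (P.c (P.t i.succ))) :=
    (P.continuousOn _ (P.t_mem _)).mono
      ((Ioo_subset_Ioo_left hr.1.le).trans (P.dom_subset i))
  have : (𝓝[Ioo r (P.t i.succ)] (P.t i.succ)).NeBot := right_nhdsWithin_Ioo_neBot hr.2
  refine hF.mem_of_tendsto hc ?_
  filter_upwards [self_mem_nhdsWithin] with s hs
  exact h s ⟨hr.1.trans hs.1, hs.2⟩ hs.1.le

lemma start_mem {i : Fin (P.n + 1)} {r : ℝ} (hr : r ∈ P.dom i) {F : Set Pt} (hF : IsClosed F)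
    (h : ∀ s ∈ P.dom i, s ≤ r → P.c s ∈ F) : P.junction i ∈ F := by
  have hc : Tendsto P.c (𝓝[Ioo (P.t i.castSucc) r] (P.t i.castSucc))
      (𝓝 (P.c (P.t i.castSucc))) :=
    (P.continuousOn _ (P.t_mem _)).mono
      ((Ioo_subset_Ioo_right hr.2.le).trans (P.dom_subset i))
  have : (𝓝[Ioo (P.t i.castSucc) r] (P.t i.castSucc)).NeBot := left_nhdsWithin_Ioo_neBot hr.1
  refine hF.mem_of_tendsto hc ?_
  filter_upwards [self_mem_nhdsWithin] with s hs
  exact h s ⟨hs.1, hs.2.trans hr.2⟩ hs.2.le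

lemma exists_mem_dom (i : Fin (P.n + 1)) : ∃ r s, r ∈ P.dom i ∧ s ∈ P.dom i ∧ r < s := by
  obtain ⟨s, h1, h2⟩ := exists_between (P.t_lt i)
  obtain ⟨r, h3, h4⟩ := exists_between h1
  exact ⟨r, s, ⟨h3, h4.trans h2⟩, ⟨h1, h2⟩, h4⟩

lemma ne_of_lt {i : Fin (P.n + 1)} {r s : ℝ} (hr : r ∈ P.dom i) (hs : s ∈ P.dom i) (h : r < s) :
    P.c r ≠ P.c s := fun e => h.ne (P.arc_injOn i hr hs e)

lemma not_const (i : Fin (P.n + 1)) (q : Pt) : ¬ ∀ r ∈ P.dom i, P.c r = q := by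
  intro h
  obtain ⟨r, s, hr, hs, hrs⟩ := P.exists_mem_dom i
  exact P.ne_of_lt hr hs hrs ((h r hr).trans (h s hs).symm)

/-- A continuous function that increases along the interior of an arc increases from its initial
point to its final point. -/
lemma junction_lt {i : Fin (P.n + 1)} {f : Pt → ℝ} (hf : Continuous f)
    (h : ∀ r ∈ P.dom i, ∀ s ∈ P.dom i, r < s → f (P.c r) < f (P.c s)) :
    f (P.junction i) < f (P.junction (i + 1)) := by
  obtain ⟨r, s, hr, hs, hrs⟩ := P.exists_mem_dom i
  have h1 : P.junction i ∈ {p | f p ≤ f (P.c r)} :=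
    P.start_mem hr (isClosed_le hf continuous_const) fun q hq hqr => by
      rcases eq_or_lt_of_le hqr with rfl | hqr
      · exact le_refl (f (P.c q))
      · exact (h q hq r hr hqr).le
  have h2 : P.junction (i + 1) ∈ {p | f (P.c s) ≤ f p} :=
    P.end_mem hs (isClosed_le continuous_const hf) fun q hq hqr => by
      rcases eq_or_lt_of_le hqr with rfl | hqr
      · exact le_refl (f (P.c s))
      · exact (h s hs q hq hqr).le
  exact (lt_of_le_of_lt h1 (h r hr s hs hrs)).trans_le h2

lemma not_increasing (f : Pt → ℝ) : ¬ ∀ i, f (P.junction i) < f (P.junction (i + 1)) := by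
  intro h
  -- There are finitely many junctions in cyclic order, so `f` has a maximum, after which it cannot
  -- grow.
  obtain ⟨i, hi⟩ := Finite.exists_max fun i => f (P.junction i)
  exact (h i).not_ge (hi (i + 1))

lemma mem_domain {i : Fin (P.n + 1)} {r : ℝ} (hr : r ∈ P.dom i) :
    P.c r ∈ (P.kind i).domain Z := (P.arc_orbit i r hr r hr le_rfl).mem_left

end ClosedPath

/-! ### Arcs of the three fields and absence of canard cycles -/

lemma isClosed_upper : IsClosed upper := isClosed_le continuous_const continuous_snd

lemma isClosed_lower : IsClosed lower := isClosed_le continuous_snd continuous_const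

section arcs
variable {l β : ℝ} {P : ClosedPath (Zv (l, β))} {i : Fin (P.n + 1)}

lemma arc_up (hi : P.kind i = .up) {r s : ℝ} (hr : r ∈ P.dom i) (hs : s ∈ P.dom i) (h : r ≤ s) :
    Reach (Zv (l, β)).X upper (P.c r) (P.c s) := by
  have := P.arc_orbit i r hr s hs h
  rwa [hi] at this

lemma arc_down (hi : P.kind i = .down) {r s : ℝ} (hr : r ∈ P.dom i) (hs : s ∈ P.dom i)
    (h : r ≤ s) : Reach (Zv (l, β)).Y lower (P.c r) (P.c s) := by
  have := P.arc_orbit i r hr s hs h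
  rwa [hi] at this

lemma arc_slide (hi : P.kind i = .slide) {r s : ℝ} (hr : r ∈ P.dom i) (hs : s ∈ P.dom i)
    (h : r ≤ s) : Reach (Zv (l, β)).slide (Zv (l, β)).slidingDomain (P.c r) (P.c s) := by
  have := P.arc_orbit i r hr s hs h
  rwa [hi] at this

lemma kind_eq_up_of_pos (h : 0 < (P.junction i).2) : P.kind i = .up := by
  by_contra hk
  obtain ⟨r, -, hr, -, -⟩ := P.exists_mem_dom i
  have : P.junction i ∈ lower := P.start_mem hr isClosed_lower fun s hs _ => by
    have hm := P.mem_domain hs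
    cases hki : P.kind i with
    | up => exact absurd hki hk
    | down => rw [hki] at hm; exact hm
    | slide => rw [hki] at hm; exact (mem_slidingDomain.1 hm).1.le
  exact h.not_ge this

lemma junction_succ_nonpos (hk : P.kind i ≠ .up) : (P.junction (i + 1)).2 ≤ 0 := by
  obtain ⟨r, -, hr, -, -⟩ := P.exists_mem_dom i
  exact P.end_mem hr isClosed_lower fun s hs _ => by
    have hm := P.mem_domain hs
    cases hki : P.kind i with
    | up => exact absurd hki hk
    | down => rw [hki] at hm; exact hm
    | slide => rw [hki] at hm; exact (mem_slidingDomain.1 hm).1.le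

lemma junction_nonneg (hk : P.kind i = .up) : 0 ≤ (P.junction i).2 := by
  obtain ⟨r, -, hr, -, -⟩ := P.exists_mem_dom i
  exact P.start_mem hr isClosed_upper fun s hs _ => (arc_up hk hs hs le_rfl).mem_left

lemma junction_slide_eq_zero (hk : P.kind i = .slide) : (P.junction i).2 = 0 := by
  obtain ⟨r, -, hr, -, -⟩ := P.exists_mem_dom i
  exact P.start_mem (F := {p | p.2 = 0}) hr (isClosed_eq continuous_snd continuous_const)
    fun s hs _ => (mem_slidingDomain.1 (arc_slide hk hs hs le_rfl).mem_left).1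

lemma junction_slide_succ_eq_zero (hk : P.kind i = .slide) : (P.junction (i + 1)).2 = 0 := by
  obtain ⟨r, -, hr, -, -⟩ := P.exists_mem_dom i
  exact P.end_mem (F := {p | p.2 = 0}) hr (isClosed_eq continuous_snd continuous_const)
    fun s hs _ => (mem_slidingDomain.1 (arc_slide hk hs hs le_rfl).mem_left).1

lemma arc_up_fst_lt (hk : P.kind i = .up) {r s : ℝ} (hr : r ∈ P.dom i) (hs : s ∈ P.dom i)
    (h : r < s) : (P.c r).1 < (P.c s).1 := by
  obtain ⟨-, -, hA, hx, -⟩ := reach_X_iff.1 (arc_up hk hr hs h.le)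
  refine lt_of_le_of_ne hx fun e => P.ne_of_lt hr hs h (Prod.ext e ?_)
  simp only [intX, e] at hA
  linarith

lemma fst_le_of_reach_Y (hβ : β ≤ 0) {p q : Pt} (h : Reach (Zv (l, β)).Y lower p q) :
    p.1 ≤ q.1 := by
  obtain ⟨T, hT, h1, h2, h3⟩ := reach_Y_iff_flow.1 h
  have hp : p.2 ≤ 0 := h.mem_left
  have hq : q.2 ≤ 0 := h.mem_right
  have a1 : 1 ≤ Real.exp T := Real.one_le_exp hT
  have c1 : Real.exp (-T) ≤ 1 := Real.exp_le_one_iff.2 (by linarith)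
  have c3 := Real.exp_pos (-T)
  have m2 : Real.exp (-T) * Real.exp T = 1 := by rw [← Real.exp_add]; simp
  have e : 2 * (q.1 - p.1) =
      (Real.exp T - 1) * ((p.1 - (p.2 + β)) - (q.1 + (q.2 + β))) := by
    rw [h1]
    linear_combination h1 + h2 + (p.1 + (p.2 + β)) * m2
  have : 0 ≤ (p.1 - (p.2 + β)) - (q.1 + (q.2 + β)) := by
    rcases le_total 0 (p.1 + (p.2 + β)) with h | h
    · nlinarith
    · have : q.1 + (q.2 + β) ≤ 0 := by rw [h1]; nlinarith
      rcases le_total 0 (p.1 - (p.2 + β)) with h' | h'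
      · linarith
      · nlinarith
  nlinarith [mul_nonneg (sub_nonneg.2 a1) this]

lemma arc_down_fst_lt (hβ : β ≤ 0) (hk : P.kind i = .down) {r s : ℝ} (hr : r ∈ P.dom i)
    (hs : s ∈ P.dom i) (h : r < s) : (P.c r).1 < (P.c s).1 := by
  have hR := arc_down hk hr hs h.le
  refine lt_of_le_of_ne (fst_le_of_reach_Y hβ hR) fun e => P.ne_of_lt hr hs h (Prod.ext e ?_)
  have hK := hR.orbY.1
  have h1 : (P.c r).2 ≤ 0 := hR.mem_left
  have h2 : (P.c s).2 ≤ 0 := hR.mem_right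
  rw [e] at hK
  have h3 : (P.c r).2 + β = (P.c s).2 + β := by
    have : ((P.c r).2 + β) ^ 2 = ((P.c s).2 + β) ^ 2 := by linarith
    rcases sq_eq_sq_iff_eq_or_eq_neg.1 this with h | h <;> linarith
  linarith

lemma arc_slide_fst_lt (hβ : β ≤ 0) (hk : P.kind i = .slide) {r s : ℝ} (hr : r ∈ P.dom i)
    (hs : s ∈ P.dom i) (h : r < s) : (P.c r).1 < (P.c s).1 := by
  have hR := arc_slide hk hr hs h.le
  have h1 := (mem_slidingDomain.1 hR.mem_left).1
  have h2 := (mem_slidingDomain.1 hR.mem_right).1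
  refine lt_of_le_of_ne ?_ fun e => P.ne_of_lt hr hs h (Prod.ext e (by rw [h1, h2]))
  have hP := pseudo_mem_sewing_closure (l := l) (by linarith : β < 1) (Or.inl hβ)
  rcases (reach_slide_iff (by linarith)).1 hR with ⟨h3, -, h4⟩ | ⟨-, h3, h4⟩
  · have := (mem_escaping.1 h3).2
    rcases awayLE_sub_iff.1 h4 with h5 | h5 | h5
    · exact h5.2
    · linarith [h5.2]
    · exact h5.le
  · have := (mem_sliding.1 h3).2
    rcases awayLE_sub_iff.1 h4 with h5 | h5 | h5
    · linarith [h5.1]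
    · exact h5.1
    · exact h5.ge

/-- All three fields move to the right: `X` always, `Y` because `y + β ≤ 0` in `Σ₋`, and `Z^Σ`
because `P` lies in the closed sewing interval. So there is no closed path of any kind. -/
lemma isEmpty_closedPath_of_nonpos (hβ : β ≤ 0) (P : ClosedPath (Zv (l, β))) : False := by
  refine P.not_increasing Prod.fst fun i => P.junction_lt continuous_fst fun r hr s hs h => ?_
  cases hk : P.kind i with
  | up => exact arc_up_fst_lt hk hr hs h
  | down => exact arc_down_fst_lt hβ hk hr hs h
  | slide => exact arc_slide_fst_lt hβ hk hr hs h

lemma AwayLE.abs_lt {z z' : ℝ} (h : AwayLE z z') (hne : z ≠ z') : |z| < |z'| := by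
  rcases h with ⟨h1, h2⟩ | ⟨h1, h2⟩ | h1
  · rw [abs_of_pos h1, abs_of_pos (h1.trans_le h2)]; exact lt_of_le_of_ne h2 hne
  · rw [abs_of_neg h2, abs_of_neg (h1.trans_lt h2)]
    have := lt_of_le_of_ne h1 hne.symm
    linarith
  · exact absurd h1 hne

/-- Such an arc stays in `Σ₂` or in `Σ₃`. The distance to `P` strictly increases along it in the
first case and strictly decreases in the second, so it cannot close up. -/
lemma not_slide_single (hβ : β < 1) (hn : P.n = 0) (hk : ∀ i, P.kind i = .slide) : False := by
  have hsub : ∀ i j : Fin (P.n + 1), i = j := by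
    intro i j; ext; omega
  have strict : ∀ {f : Pt → ℝ}, Continuous f → ∀ i : Fin (P.n + 1),
      ¬ ∀ r ∈ P.dom i, ∀ s ∈ P.dom i, r < s → f (P.c r) < f (P.c s) := by
    intro f hf i h
    refine P.not_increasing f fun j => ?_
    rw [← hsub i j]
    exact P.junction_lt hf h
  obtain ⟨r₀, -, hr₀, -, -⟩ := P.exists_mem_dom 0
  have hne : ∀ {r s}, r ∈ P.dom 0 → s ∈ P.dom 0 → r < s →
      (P.c r).1 - pseudo l β ≠ (P.c s).1 - pseudo l β := by
    intro r s hr hs h e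
    have hR := arc_slide (hk 0) hr hs h.le
    have h1 := (mem_slidingDomain.1 hR.mem_left).1
    have h2 := (mem_slidingDomain.1 hR.mem_right).1
    exact P.ne_of_lt hr hs h (Prod.ext (by linarith) (by rw [h1, h2]))
  have hdisj : ∀ {q : Pt}, q ∈ (Zv (l, β)).escaping → q ∉ (Zv (l, β)).sliding := by
    intro q h1 h2
    have h3 := (max_lt_iff.1 (mem_escaping.1 h1).2).2
    have h4 := (lt_min_iff.1 (mem_sliding.1 h2).2).2
    linarith
  have hsame : ∀ {r s}, r ∈ P.dom 0 → s ∈ P.dom 0 →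
      P.c r ∈ (Zv (l, β)).escaping → P.c s ∈ (Zv (l, β)).escaping := by
    intro r s hr hs h
    rcases le_total r s with hrs | hrs
    · rcases (reach_slide_iff hβ).1 (arc_slide (hk 0) hr hs hrs) with h1 | h1
      · exact h1.2.1
      · exact absurd h1.1 (hdisj h)
    · rcases (reach_slide_iff hβ).1 (arc_slide (hk 0) hs hr hrs) with h1 | h1
      · exact h1.1
      · exact absurd h1.2.1 (hdisj h)
  by_cases h0 : P.c r₀ ∈ (Zv (l, β)).escaping
  · refine strict (f := fun p => |p.1 - pseudo l β|) (by fun_prop) 0 fun r hr s hs h => ?_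
    rcases (reach_slide_iff hβ).1 (arc_slide (hk 0) hr hs h.le) with h1 | h1
    · exact h1.2.2.abs_lt (hne hr hs h)
    · exact absurd h1.1 (hdisj (hsame hr₀ hr h0))
  · refine strict (f := fun p => -|p.1 - pseudo l β|) (by fun_prop) 0 fun r hr s hs h => ?_
    rcases (reach_slide_iff hβ).1 (arc_slide (hk 0) hr hs h.le) with h1 | h1
    · exact absurd (hsame hr hr₀ h1.1) h0
    · exact neg_lt_neg (h1.2.2.abs_lt (hne hr hs h).symm)

lemma arc_up_junction (hk : P.kind i = .up) : (P.junction i).1 < (P.junction (i + 1)).1 ∧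
    intX l (P.junction i) = intX l (P.junction (i + 1)) := by
  have hc : Continuous (intX l) := by unfold intX; fun_prop
  refine ⟨P.junction_lt continuous_fst fun r hr s hs h => arc_up_fst_lt hk hr hs h, ?_⟩
  obtain ⟨r, -, hr, -, -⟩ := P.exists_mem_dom i
  have h1 : P.junction i ∈ {p | intX l p = intX l (P.c r)} :=
    P.start_mem hr (isClosed_eq hc continuous_const) fun s hs h =>
      (reach_X_iff.1 (arc_up hk hs hr h)).2.2.1
  have h2 : P.junction (i + 1) ∈ {p | intX l p = intX l (P.c r)} :=
    P.end_mem hr (isClosed_eq hc continuous_const) fun s hs h =>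
      (reach_X_iff.1 (arc_up hk hr hs h)).2.2.1.symm
  exact Eq.trans h1 (Eq.symm h2)

/-- To the left of the fold `X` points out of `Σ₊`. The initial point is only a limit of the arc, so
the argument compares it with interior points through closed conditions. -/
lemma le_fst_of_arc_up (hk : P.kind i = .up) (h0 : (P.junction i).2 = 0) :
    l ≤ (P.junction i).1 := by
  by_contra! hl
  obtain ⟨r, s, hr, hs, hrs⟩ := P.exists_mem_dom i
  have hc : Continuous (intX l) := by unfold intX; fun_prop
  have h1 : P.junction i ∈ {p | intX l p = intX l (P.c s)} :=
    P.start_mem hs (isClosed_eq hc continuous_const) fun q hq h =>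
      (reach_X_iff.1 (arc_up hk hq hs h)).2.2.1
  have h2 : P.junction i ∈ {p : Pt | p.1 ≤ (P.c r).1} :=
    P.start_mem hr (isClosed_le continuous_fst continuous_const) fun q hq h =>
      (reach_X_iff.1 (arc_up hk hq hr h)).2.2.2.1
  have h3 := arc_up_fst_lt hk hr hs hrs
  replace h1 : intX l (P.junction i) = intX l (P.c s) := h1
  replace h2 : (P.junction i).1 ≤ (P.c r).1 := h2
  have hpos : 0 < intX l (P.c s) := by
    rw [← h1]; simp only [intX, h0]; nlinarith
  have h4 : P.junction i ∈ {p : Pt | 0 ≤ (p.1 - l) * ((P.c s).1 - l)} :=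
    P.start_mem hs (isClosed_le continuous_const (by fun_prop)) fun q hq h => by
      obtain ⟨-, -, e, -, e'⟩ := reach_X_iff.1 (arc_up hk hq hs h)
      exact (e' (by rw [e]; exact hpos)).le
  replace h4 : 0 ≤ ((P.junction i).1 - l) * ((P.c s).1 - l) := h4
  have h5 : 0 ≤ (P.c s).2 := (arc_up hk hs hs le_rfl).mem_left
  simp only [intX, h0] at h1
  have h6 : (P.c s).1 - l ≤ 0 := by
    by_contra! h6
    nlinarith
  nlinarith

/-- An arc of `X` that follows another kind starts on `Σ`, hence at `x ≥ l`. From there it rises, so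
it ends strictly above `Σ`, where only `X` acts; the same holds for the next arc, and so on around
the cycle. -/
lemma no_arc_up (hne : ∃ i j, P.kind i ≠ P.kind j) (i : Fin (P.n + 1)) : P.kind i ≠ .up := by
  intro hi
  obtain ⟨j, hj⟩ : ∃ j, P.kind j ≠ .up := by
    by_contra! h
    obtain ⟨i, j, hij⟩ := hne
    exact hij (by rw [h, h])
  obtain ⟨k, hk, hk'⟩ := exists_cyclic_change (S := fun i => P.kind i ≠ .up) hj
    (by simpa using hi : ¬ P.kind i ≠ .up)
  rw [not_not] at hk'
  have h0 : (P.junction (k + 1)).2 = 0 :=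
    le_antisymm (junction_succ_nonpos hk) (junction_nonneg hk')
  have all := forall_of_cyclic (S := fun i => P.kind i = .up ∧ l ≤ (P.junction i).1)
    (fun m ⟨h1, h2⟩ => by
      obtain ⟨h3, h4⟩ := arc_up_junction h1
      have h5 := junction_nonneg h1
      refine ⟨kind_eq_up_of_pos ?_, by linarith⟩
      simp only [intX] at h4
      nlinarith) ⟨hk', le_fst_of_arc_up hk' h0⟩
  exact hk (all k).1

lemma eq_of_reach_Y_to {x : ℝ} {q : Pt} (hx : 0 < x ∨ (x = 0 ∧ 0 ≤ β))
    (h : Reach (Zv (l, β)).Y lower q (x, 0)) : q = (x, 0) := by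
  have h1 := reach_Y_reverse h
  have h2 := eq_of_reach_Y_from (x := -x) (by simpa using hx) h1
  simp only [Prod.mk.injEq, neg_inj] at h2
  exact Prod.ext h2.1 h2.2

lemma continuous_prodUV : Continuous fun p : Pt => (p.1 + (p.2 + β)) * (p.1 - (p.2 + β)) := by
  fun_prop

/-- `Y` reaches `Σ` from below only where `Y.f = -x` is positive. If `x ≥ 0` at the end, then `u >
0` there, so the orbit order extends to the end point; by `eq_of_reach_Y_to` the arc would be
constant. -/
lemma arc_down_end (hβ : 0 < β) (hk : P.kind i = .down) (h0 : (P.junction (i + 1)).2 = 0) :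
    (P.junction (i + 1)).1 < 0 := by
  by_contra! hx
  set b := P.junction (i + 1) with hb
  have hb' : b = (b.1, 0) := Prod.ext rfl h0
  refine P.not_const i b fun r hr => ?_
  -- Along the arc `u` shrinks if it is positive and otherwise stays nonpositive. The union of both
  -- conditions is closed, and `u > 0` at the end selects the first.
  have hu : b ∈ {p : Pt | p.1 + (p.2 + β) ≤ (P.c r).1 + ((P.c r).2 + β)} ∪
      {p | p.1 + (p.2 + β) ≤ 0} :=
    P.end_mem hr (IsClosed.union (isClosed_le (by fun_prop) continuous_const)
      (isClosed_le (by fun_prop) continuous_const)) fun s hs h => by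
        obtain ⟨T, hT, h1, -, -⟩ := reach_Y_iff_flow.1 (arc_down hk hr hs h)
        have e1 : Real.exp (-T) ≤ 1 := Real.exp_le_one_iff.2 (by linarith)
        have e2 := Real.exp_pos (-T)
        rcases le_total ((P.c r).1 + ((P.c r).2 + β)) 0 with h | h
        · right
          change _ ≤ (0 : ℝ)
          rw [h1]; nlinarith
        · left
          change _ ≤ (P.c r).1 + ((P.c r).2 + β)
          rw [h1]; nlinarith
  have hK : b ∈ {p : Pt | (p.1 + (p.2 + β)) * (p.1 - (p.2 + β)) =
      ((P.c r).1 + ((P.c r).2 + β)) * ((P.c r).1 - ((P.c r).2 + β))} :=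
    P.end_mem hr (isClosed_eq continuous_prodUV continuous_const) fun s hs h =>
      (arc_down hk hr hs h).orbY.1.symm
  have hbu : 0 < b.1 + (b.2 + β) := by rw [h0]; linarith
  have hu' : b.1 + (b.2 + β) ≤ (P.c r).1 + ((P.c r).2 + β) := by
    rcases hu with h | h
    · exact h
    · exact absurd h (not_le.2 hbu)
  have hR : Reach (Zv (l, β)).Y lower (P.c r) b :=
    (reach_Y_iff_of_nonneg hβ.le).2 ⟨(arc_down hk hr hr le_rfl).mem_left, h0.le, Eq.symm hK,
      Or.inr (Or.inr (Or.inl ⟨hbu, hu'⟩))⟩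
  rw [hb'] at hR ⊢
  refine eq_of_reach_Y_to ?_ hR
  rcases eq_or_lt_of_le hx with h | h
  · exact Or.inr ⟨h.symm, hβ.le⟩
  · exact Or.inl h

lemma arc_down_start (hβ : 0 < β) (hk : P.kind i = .down) (h0 : (P.junction i).2 = 0) :
    0 < (P.junction i).1 := by
  by_contra! hx
  set a := P.junction i with ha
  have ha' : a = (a.1, 0) := Prod.ext rfl h0
  refine P.not_const i a fun r hr => ?_
  have hv : a ∈ {p : Pt | (P.c r).1 - ((P.c r).2 + β) ≤ p.1 - (p.2 + β)} ∪
      {p | 0 ≤ p.1 - (p.2 + β)} :=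
    P.start_mem hr (IsClosed.union (isClosed_le continuous_const (by fun_prop))
      (isClosed_le continuous_const (by fun_prop))) fun s hs h => by
        obtain ⟨T, hT, -, h1, -⟩ := reach_Y_iff_flow.1 (arc_down hk hs hr h)
        have e1 : 1 ≤ Real.exp T := Real.one_le_exp hT
        rcases le_total ((P.c s).1 - ((P.c s).2 + β)) 0 with h | h
        · left
          change (P.c r).1 - ((P.c r).2 + β) ≤ _
          rw [h1]; nlinarith
        · right; exact h
  have hK : a ∈ {p : Pt | (p.1 + (p.2 + β)) * (p.1 - (p.2 + β)) =
      ((P.c r).1 + ((P.c r).2 + β)) * ((P.c r).1 - ((P.c r).2 + β))} :=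
    P.start_mem hr (isClosed_eq continuous_prodUV continuous_const) fun s hs h =>
      (arc_down hk hs hr h).orbY.1
  have hav : a.1 - (a.2 + β) < 0 := by rw [h0]; linarith
  have hv' : (P.c r).1 - ((P.c r).2 + β) ≤ a.1 - (a.2 + β) := by
    rcases hv with h | h
    · exact h
    · exact absurd h (not_le.2 hav)
  have hR : Reach (Zv (l, β)).Y lower a (P.c r) :=
    (reach_Y_iff_of_nonneg hβ.le).2 ⟨h0.le, (arc_down hk hr hr le_rfl).mem_left, hK,
      Or.inr (Or.inl ⟨hav, hv'⟩)⟩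
  rw [ha'] at hR ⊢
  refine eq_of_reach_Y_from ?_ hR
  rcases eq_or_lt_of_le hx with h | h
  · exact Or.inr ⟨h, hβ.le⟩
  · exact Or.inl h

lemma arc_slide_end (hβ : β < 1) (hk : P.kind i = .slide) (hx : (P.junction i).1 < 0) :
    (P.junction (i + 1)).1 ≤ min l 0 := by
  obtain ⟨r₁, -, hr₁, -, -⟩ := P.exists_mem_dom i
  obtain ⟨r, hr, hm⟩ : ∃ r ∈ P.dom i, P.c r ∈ (Zv (l, β)).sliding := by
    by_contra! h
    have : P.junction i ∈ {p : Pt | 0 ≤ p.1} :=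
      P.start_mem hr₁ (isClosed_le continuous_const continuous_fst) fun s hs _ => by
        rcases (arc_slide hk hs hs le_rfl).mem_left with h1 | h1
        · exact (max_lt_iff.1 (mem_escaping.1 h1).2).2.le
        · exact absurd h1 (h s hs)
    exact hx.not_ge this
  have : P.junction (i + 1) ∈ {p : Pt | p.1 ≤ min l 0} :=
    P.end_mem hr (isClosed_le continuous_fst continuous_const) fun s hs h => by
      rcases (reach_slide_iff hβ).1 (arc_slide hk hr hs h) with h1 | h1
      · have h3 := (max_lt_iff.1 (mem_escaping.1 h1.1).2).2
        have h4 := (lt_min_iff.1 (mem_sliding.1 hm).2).2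
        linarith
      · exact (mem_sliding.1 h1.2.1).2.le
  exact this

end arcs

/-- For `β > 0` and several kinds of arcs only `Y` and `Z^Σ` remain. A sliding arc that follows an
arc of `Y` starts at `x < 0` and ends at `x ≤ min l 0`. No arc of `Y` starts there, since such arcs
start at `x > 0`, so `Z^Σ` must go on for ever. -/
theorem no_canardCycle {l β : ℝ} (hβ1 : β < 1) (Γ : Set Pt) : ¬ IsCanardCycle (Zv (l, β)) Γ := by
  rintro ⟨P, -, hkinds, hpass, -⟩
  rcases le_or_gt β 0 with hβ | hβ
  · exact isEmpty_closedPath_of_nonpos hβ P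
  rcases hkinds with hne | ⟨hn, hk⟩
  · have hup := no_arc_up hne
    obtain ⟨i, hi⟩ : ∃ i, P.kind i = .down := by
      by_contra! h
      obtain ⟨i, j, hij⟩ := hne
      have : ∀ i, P.kind i = .slide := fun i => by
        cases hk : P.kind i with
        | up => exact absurd hk (hup i)
        | down => exact absurd hk (h i)
        | slide => rfl
      exact hij (by rw [this, this])
    obtain ⟨j, hj⟩ : ∃ j, P.kind j ≠ .down := by
      by_contra! h
      obtain ⟨i, j, hij⟩ := hne
      exact hij (by rw [h, h])
    have slide_of : ∀ {i}, P.kind i ≠ .down → P.kind i = .slide := fun {i} h => by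
      cases hk : P.kind i with
      | up => exact absurd hk (hup i)
      | down => exact absurd hk h
      | slide => rfl
    obtain ⟨k, hk, hk'⟩ := exists_cyclic_change (S := fun i => P.kind i = .down) hi hj
    have hs := slide_of hk'
    have all := forall_of_cyclic (S := fun i => P.kind i = .slide ∧ (P.junction i).1 < 0)
      (fun m ⟨h1, h2⟩ => by
        have h3 := arc_slide_end hβ1 h1 h2
        have h0 := junction_slide_succ_eq_zero h1
        have h4 : P.kind (m + 1) = .slide := slide_of fun hd => by
          have := arc_down_start hβ hd h0
          linarith [min_le_right l 0]
        refine ⟨h4, ?_⟩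
        -- Two sliding arcs may be joined only at a regular sliding point. This excludes a passage
        -- through `0` and keeps the junction in `Σ₃`.
        have h5 := hpass (m + 1)
        rw [add_sub_cancel_right, h1, h4] at h5
        have h6 : P.junction (m + 1) ∈ (Zv (l, β)).slidingDomain := h5.1
        rcases (mem_slidingDomain.1 h6).2 with h7 | h7
        · linarith [min_le_max (a := l) (b := 0)]
        · linarith [min_le_right l 0])
      ⟨hs, arc_down_end hβ hk (junction_slide_eq_zero hs)⟩
    exact absurd (all k).1 (by rw [hk]; simp)
  · exact not_slide_single hβ1 hn hk

end FoldSaddle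

namespace FoldSaddle

/-! ### Sigma-graphs through the fold-fold point -/

/-- The segment of `Σ` between `(-a, 0)` and `(a, 0)`, closed by an orbit of `Y` in `Σ₋` (by the two
separatrix arcs if `a = β`). -/
def loop (a β : ℝ) : Set Pt :=
  {p | |p.1| ≤ a ∧ (p.2 = 0 ∨ p.2 = -β + √(p.1 ^ 2 + β ^ 2 - a ^ 2))}

/-- A parametrisation of `loop a β` by `[0, 1]`. -/
noncomputable def loopPath (a β r : ℝ) : Pt :=
  (a * max (min (4 * r) (2 - 4 * r)) (4 * r - 4),
    -β + √((a * max (-1) (min 1 (2 - 4 * r))) ^ 2 + β ^ 2 - a ^ 2))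

section loop
variable {a β r : ℝ}

lemma continuous_loopPath (a β : ℝ) : Continuous (loopPath a β) := by
  unfold loopPath; fun_prop

/-- The abscissa runs from `0` to `a`, then to `-a` and back to `0`, turning at the parameters `1/4`
and `3/4`. The clamp in the ordinate keeps the root equal to `β` on the outer quarters, which are
therefore on `Σ`. -/
lemma loopPath_right (hβ : 0 ≤ β) (h : r ≤ 1 / 4) : loopPath a β r = (a * (4 * r), 0) := by
  rw [loopPath, min_eq_left (by linarith : 4 * r ≤ 2 - 4 * r), max_eq_left (by linarith),
    min_eq_left (by linarith), max_eq_right (by norm_num), mul_one, add_sub_cancel_left,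
    Real.sqrt_sq hβ, neg_add_cancel]

lemma loopPath_left (hβ : 0 ≤ β) (h : 3 / 4 ≤ r) :
    loopPath a β r = (a * (4 * r - 4), 0) := by
  rw [loopPath, min_eq_right (by linarith : 2 - 4 * r ≤ 4 * r), max_eq_right (by linarith),
    min_eq_right (by linarith), max_eq_left (by linarith), mul_neg_one, neg_sq,
    add_sub_cancel_left, Real.sqrt_sq hβ, neg_add_cancel]

lemma loopPath_below (h : 1 / 4 ≤ r) (h' : r ≤ 3 / 4) : loopPath a β r =
    (a * (2 - 4 * r), -β + √((a * (2 - 4 * r)) ^ 2 + β ^ 2 - a ^ 2)) := by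
  rw [loopPath, min_eq_right (by linarith : 2 - 4 * r ≤ 4 * r), max_eq_left (by linarith),
    min_eq_right (by linarith), max_eq_right (by linarith)]

lemma loopPath_image (ha : 0 < a) (hβ : 0 ≤ β) : loopPath a β '' Icc 0 1 = loop a β := by
  ext p
  constructor
  · rintro ⟨r, ⟨h0, h1⟩, rfl⟩
    rcases le_total r (1 / 4) with h | h
    · rw [loopPath_right hβ h]
      exact ⟨by rw [abs_le]; constructor <;> nlinarith, Or.inl rfl⟩
    rcases le_total r (3 / 4) with h' | h'
    · rw [loopPath_below h h']
      exact ⟨by rw [abs_le]; constructor <;> nlinarith, Or.inr rfl⟩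
    · rw [loopPath_left hβ h']
      exact ⟨by rw [abs_le]; constructor <;> nlinarith, Or.inl rfl⟩
  · rintro ⟨hx, hy⟩
    obtain ⟨s, hs⟩ : ∃ s, p.1 = a * s := ⟨p.1 / a, by field_simp⟩
    rw [hs, abs_mul, abs_of_pos ha] at hx
    have hs1 : |s| ≤ 1 := by nlinarith
    obtain ⟨h1, h2⟩ := abs_le.1 hs1
    rcases hy with hy | hy
    · rcases le_total 0 s with h | h
      · refine ⟨s / 4, ⟨by linarith, by linarith⟩, ?_⟩
        rw [loopPath_right hβ (by linarith)]
        exact Prod.ext (by rw [hs]; ring) hy.symm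
      · refine ⟨s / 4 + 1, ⟨by linarith, by linarith⟩, ?_⟩
        rw [loopPath_left hβ (by linarith)]
        exact Prod.ext (by rw [hs]; ring) hy.symm
    · refine ⟨1 / 2 - s / 4, ⟨by linarith, by linarith⟩, ?_⟩
      rw [loopPath_below (by linarith) (by linarith)]
      have : a * (2 - 4 * (1 / 2 - s / 4)) = p.1 := by rw [hs]; ring
      rw [this]
      exact Prod.ext rfl hy.symm

lemma loopPath_injOn_right (ha : 0 < a) (hβ : 0 ≤ β) :
    InjOn (loopPath a β) (Iic (1 / 4)) := by
  intro r hr s hs h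
  rw [loopPath_right hβ hr, loopPath_right hβ hs] at h
  have := mul_left_cancel₀ ha.ne' (Prod.ext_iff.1 h).1
  linarith

lemma loopPath_injOn_left (ha : 0 < a) (hβ : 0 ≤ β) :
    InjOn (loopPath a β) (Ici (3 / 4)) := by
  intro r hr s hs h
  rw [loopPath_left hβ hr, loopPath_left hβ hs] at h
  have := mul_left_cancel₀ ha.ne' (Prod.ext_iff.1 h).1
  linarith

lemma loopPath_injOn_below (ha : 0 < a) : InjOn (loopPath a β) (Icc (1 / 4) (3 / 4)) := by
  intro r hr s hs h
  rw [loopPath_below hr.1 hr.2, loopPath_below hs.1 hs.2] at h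
  have := mul_left_cancel₀ ha.ne' (Prod.ext_iff.1 h).1
  linarith

lemma mem_escaping_loop {x : ℝ} (hx : 0 < x) : ((x, 0) : Pt) ∈ (Zv (0, β)).escaping :=
  mem_escaping.2 ⟨rfl, by simpa using hx⟩

lemma mem_sliding_loop {x : ℝ} (hx : x < 0) : ((x, 0) : Pt) ∈ (Zv (0, β)).sliding :=
  mem_sliding.2 ⟨rfl, by simpa using hx⟩

lemma pseudo_zero (β : ℝ) : pseudo 0 β = 0 := by simp [pseudo]

lemma reach_slide_right (hβ : β < 1) {x y : ℝ} (hx : 0 < x) (h : x ≤ y) :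
    Reach (Zv (0, β)).slide (Zv (0, β)).slidingDomain (x, 0) (y, 0) :=
  (reach_slide_iff hβ).2 (Or.inl ⟨mem_escaping_loop hx, mem_escaping_loop (hx.trans_le h),
    Or.inl (by simpa [pseudo_zero] using ⟨hx, h⟩)⟩)

lemma reach_slide_left (hβ : β < 1) {x y : ℝ} (hy : y < 0) (h : x ≤ y) :
    Reach (Zv (0, β)).slide (Zv (0, β)).slidingDomain (x, 0) (y, 0) :=
  (reach_slide_iff hβ).2 (Or.inr ⟨mem_sliding_loop (h.trans_lt hy), mem_sliding_loop hy,
    Or.inr (Or.inl (by simpa [pseudo_zero] using ⟨h, hy⟩))⟩)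

lemma loop_sqrt_le {x : ℝ} (hβ : 0 ≤ β) (hx : |x| ≤ a) : √(x ^ 2 + β ^ 2 - a ^ 2) ≤ β :=
  Real.sqrt_le_iff.2 ⟨hβ, by
    have := sq_le_sq' (by linarith [(abs_le.1 hx).1]) (abs_le.1 hx).2
    linarith⟩

/-- The curve is the level `intY = a ^ 2` above the saddle, run to the left. The alternative in `h`
keeps an end point away from `x = 0`: for `a = β` the curve passes through the saddle, which no
trajectory reaches from another point in finite time. -/
lemma reach_loop {x y : ℝ} (hβ : 0 ≤ β) (ha : 0 ≤ a) (haβ : a ≤ β) (hx : |x| ≤ a) (hy : |y| ≤ a)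
    (h : (0 < y ∧ y ≤ x) ∨ (x < 0 ∧ y ≤ x)) :
    Reach (Zv (0, β)).Y lower (x, -β + √(x ^ 2 + β ^ 2 - a ^ 2))
      (y, -β + √(y ^ 2 + β ^ 2 - a ^ 2)) := by
  have e1 := loop_sqrt_le hβ hx
  have e2 := loop_sqrt_le hβ hy
  have hpos : 0 ≤ β ^ 2 - a ^ 2 := by nlinarith
  refine (reach_Y_iff_of_nonneg hβ).2 ⟨by linarith, by linarith, ?_, ?_⟩
  · simp only [neg_add_cancel_comm]
    have s1 := Real.sq_sqrt (by nlinarith [sq_nonneg x] : 0 ≤ x ^ 2 + β ^ 2 - a ^ 2)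
    have s2 := Real.sq_sqrt (by nlinarith [sq_nonneg y] : 0 ≤ y ^ 2 + β ^ 2 - a ^ 2)
    linear_combination s2 - s1
  · simp only [neg_add_cancel_comm]
    rcases h with ⟨h1, h2⟩ | ⟨h1, h2⟩
    · have := Real.sqrt_le_sqrt (by nlinarith : y ^ 2 + β ^ 2 - a ^ 2 ≤ x ^ 2 + β ^ 2 - a ^ 2)
      have := Real.sqrt_nonneg (y ^ 2 + β ^ 2 - a ^ 2)
      exact Or.inr (Or.inr (Or.inl ⟨by linarith, by linarith⟩))
    · have := Real.sqrt_le_sqrt (by nlinarith : x ^ 2 + β ^ 2 - a ^ 2 ≤ y ^ 2 + β ^ 2 - a ^ 2)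
      have := Real.sqrt_nonneg (x ^ 2 + β ^ 2 - a ^ 2)
      exact Or.inr (Or.inl ⟨by linarith, by linarith⟩)

lemma reach_loopPath_below (hβ : 0 ≤ β) (ha : 0 < a) (haβ : a ≤ β) {r s : ℝ}
    (hr : 1 / 4 ≤ r) (hs : s ≤ 3 / 4) (h : (r ≤ s ∧ s < 1 / 2) ∨ (1 / 2 < r ∧ r ≤ s)) :
    Reach (Zv (0, β)).Y lower (loopPath a β r) (loopPath a β s) := by
  have hrs : r ≤ s := by rcases h with h | h; exacts [h.1, h.2]
  rw [loopPath_below hr (by linarith), loopPath_below (by linarith) hs]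
  refine reach_loop hβ ha.le haβ (by rw [abs_le]; constructor <;> nlinarith)
    (by rw [abs_le]; constructor <;> nlinarith) ?_
  rcases h with ⟨h1, h2⟩ | ⟨h1, h2⟩
  · exact Or.inl ⟨mul_pos ha (by linarith), mul_le_mul_of_nonneg_left (by linarith) ha.le⟩
  · exact Or.inr ⟨mul_neg_of_pos_of_neg ha (by linarith),
      mul_le_mul_of_nonneg_left (by linarith) ha.le⟩

/-- `loop a β` as a closed path made of an arc in `Σ₂`, two arcs of `Y` and an arc in `Σ₃`. -/
noncomputable def loopClosedPath (ha : 0 < a) (haβ : a ≤ β) (hβ1 : β < 1) :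
    ClosedPath (Zv (0, β)) where
  n := 3
  -- The cut at `1/2`, where `x = 0`, separates the two separatrices when `a = β`. For `a < β` it is
  -- an ordinary point of an orbit of `Y`.
  t := ![0, 1 / 4, 1 / 2, 3 / 4, 1]
  kind := ![.slide, .down, .down, .slide]
  c := loopPath a β
  t_strictMono := Fin.strictMono_iff_lt_succ.2 fun i => by
    fin_cases i
    · change (0 : ℝ) < 1 / 4; norm_num
    · change (1 / 4 : ℝ) < 1 / 2; norm_num
    · change (1 / 2 : ℝ) < 3 / 4; norm_num
    · change (3 / 4 : ℝ) < 1; norm_num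
  t_zero := rfl
  t_last := rfl
  continuousOn := (continuous_loopPath a β).continuousOn
  closed := by
    have hβ : 0 ≤ β := ha.le.trans haβ
    rw [loopPath_right hβ (by norm_num), loopPath_left hβ (by norm_num)]
    norm_num
  arc_injOn i := by
    have hβ : 0 ≤ β := ha.le.trans haβ
    fin_cases i
    · exact (loopPath_injOn_right ha hβ).mono fun r (hr : r ∈ Ioo (0 : ℝ) (1 / 4)) => hr.2.le
    · exact (loopPath_injOn_below ha).mono
        (Ioo_subset_Icc_self.trans (Icc_subset_Icc le_rfl
          (by change (1 / 2 : ℝ) ≤ 3 / 4; norm_num)))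
    · exact (loopPath_injOn_below ha).mono
        (Ioo_subset_Icc_self.trans (Icc_subset_Icc (by norm_num) le_rfl))
    · exact (loopPath_injOn_left ha hβ).mono fun r (hr : r ∈ Ioo (3 / 4 : ℝ) 1) => hr.1.le
  arc_orbit i := by
    have hβ : 0 ≤ β := ha.le.trans haβ
    fin_cases i
    · intro r (hr : r ∈ Ioo (0 : ℝ) (1 / 4)) s (hs : s ∈ Ioo (0 : ℝ) (1 / 4)) h
      change Reach (Zv (0, β)).slide (Zv (0, β)).slidingDomain _ _
      rw [loopPath_right hβ hr.2.le, loopPath_right hβ hs.2.le]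
      exact reach_slide_right hβ1 (mul_pos ha (by linarith [hr.1]))
        (mul_le_mul_of_nonneg_left (by linarith) ha.le)
    · intro r (hr : r ∈ Ioo (1 / 4 : ℝ) (1 / 2)) s (hs : s ∈ Ioo (1 / 4 : ℝ) (1 / 2)) h
      exact reach_loopPath_below hβ ha haβ hr.1.le (by linarith [hs.2]) (Or.inl ⟨h, hs.2⟩)
    · intro r (hr : r ∈ Ioo (1 / 2 : ℝ) (3 / 4)) s (hs : s ∈ Ioo (1 / 2 : ℝ) (3 / 4)) h
      exact reach_loopPath_below hβ ha haβ (by linarith [hr.1]) hs.2.le (Or.inr ⟨hr.1, h⟩)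
    · intro r (hr : r ∈ Ioo (3 / 4 : ℝ) 1) s (hs : s ∈ Ioo (3 / 4 : ℝ) 1) h
      change Reach (Zv (0, β)).slide (Zv (0, β)).slidingDomain _ _
      rw [loopPath_left hβ hr.1.le, loopPath_left hβ hs.1.le]
      exact reach_slide_left hβ1 (mul_neg_of_pos_of_neg ha (by linarith [hs.2]))
        (mul_le_mul_of_nonneg_left (by linarith) ha.le)

lemma isTangential_zero (hβ : β ≠ 0) : (Zv (0, β)).IsTangential (0, 0) := by
  refine ⟨rfl, by rw [lieF_X]; simp, ?_, ?_⟩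
  · rw [Zv_X]; simp
  · rw [Zv_Y]; simpa using hβ

lemma isRegularSliding_loop (hβ : β < 1) {x : ℝ} (hx : x ≠ 0) :
    (Zv (0, β)).IsRegularSliding (x, 0) := by
  have hm : ((x, 0) : Pt) ∈ (Zv (0, β)).slidingDomain := by
    rcases hx.lt_or_gt with h | h
    · exact Or.inr (mem_sliding_loop h)
    · exact Or.inl (mem_escaping_loop h)
  refine ⟨hm, ?_⟩
  rw [slide_eq_of_zero hβ hm]
  intro h
  have := (Prod.ext_iff.1 h).1
  simp only [Prod.fst_zero] at this
  linarith

lemma zero_mem_loop (ha : 0 ≤ a) : ((0, 0) : Pt) ∈ loop a β := ⟨by simpa using ha, Or.inl rfl⟩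

lemma isSigmaGraph_loop (ha : 0 < a) (haβ : a ≤ β) (hβ1 : β < 1) :
    IsSigmaGraph (Zv (0, β)) (loop a β) := by
  have hβ : 0 < β := ha.trans_le haβ
  have j0 : loopPath a β 0 = (0, 0) := by rw [loopPath_right hβ.le (by norm_num)]; simp
  have v0 : IsVertex (Zv (0, β)) (loopPath a β 0) := by
    rw [j0]; exact Or.inr (Or.inr (isTangential_zero hβ.ne'))
  have j1 : loopPath a β (1 / 4) = (a, 0) := by
    rw [loopPath_right hβ.le le_rfl]; norm_num
  have j2 : loopPath a β (1 / 2) = (0, -β + √(β ^ 2 - a ^ 2)) := by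
    rw [loopPath_below (by norm_num) (by norm_num)]; norm_num
  have j3 : loopPath a β (3 / 4) = (-a, 0) := by
    rw [loopPath_left hβ.le le_rfl]; norm_num
  refine ⟨⟨loopClosedPath ha haβ hβ1, loopPath_image ha hβ.le, ⟨(0 : Fin 4), v0⟩, ?_⟩,
    ⟨(0, 0), zero_mem_loop ha.le, rfl⟩⟩
  suffices H : ∀ i : Fin (3 + 1),
      IsVertex (Zv (0, β)) (loopPath a β (![0, 1 / 4, 1 / 2, 3 / 4, 1] i.castSucc)) ∨
      MayPass (Zv (0, β)) (loopPath a β (![0, 1 / 4, 1 / 2, 3 / 4, 1] i.castSucc))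
        (![ArcKind.slide, .down, .down, .slide] (i - 1))
        (![ArcKind.slide, .down, .down, .slide] i) from H
  intro i
  fin_cases i
  · exact Or.inl v0
  · right
    change MayPass (Zv (0, β)) (loopPath a β (1 / 4)) .slide .down
    rw [j1]
    exact Or.inr (Or.inr (isRegularSliding_loop hβ1 ha.ne'))
  · change IsVertex (Zv (0, β)) (loopPath a β (1 / 2)) ∨
      MayPass (Zv (0, β)) (loopPath a β (1 / 2)) .down .down
    have hlow : loopPath a β (1 / 2) ∈ lower := by
      rw [j2]
      have := loop_sqrt_le (a := a) (x := 0) hβ.le (by simpa using ha.le)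
      rw [zero_pow two_ne_zero, zero_add] at this
      change -β + √(β ^ 2 - a ^ 2) ≤ 0
      linarith
    -- If `a = β` this junction is the saddle, a vertex; if `a < β` it is a regular point of `Y`,
    -- where two arcs of `Y` may be joined.
    by_cases h : (Zv (0, β)).Y (loopPath a β (1 / 2)) = 0
    · exact Or.inl (Or.inl (Or.inr ⟨hlow, h⟩))
    · exact Or.inr ⟨hlow, h⟩
  · right
    change MayPass (Zv (0, β)) (loopPath a β (3 / 4)) .down .slide
    rw [j3]
    exact Or.inr (Or.inr (isRegularSliding_loop hβ1 (neg_ne_zero.2 ha.ne')))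

lemma switching_subset_closure :
    switching ⊆ closure ((Zv (0, β)).escaping ∪ (Zv (0, β)).sliding) := by
  rintro ⟨x, y⟩ (rfl : y = 0)
  rcases lt_trichotomy x 0 with h | rfl | h
  · exact subset_closure (Or.inr (mem_sliding_loop h))
  · exact map_mem_closure (f := fun x : ℝ => ((x, 0) : Pt)) (by fun_prop)
      (by rw [closure_Ioi]; exact self_mem_Ici : (0 : ℝ) ∈ closure (Ioi 0))
      fun x hx => Or.inl (mem_escaping_loop hx)
  · exact subset_closure (Or.inl (mem_escaping_loop h))

lemma isSigmaGraphIII_loop (ha : 0 < a) (haβ : a ≤ β) (hβ1 : β < 1) :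
    IsSigmaGraphIII (Zv (0, β)) (loop a β) := by
  refine ⟨isSigmaGraph_loop ha haβ hβ1, fun p hp => switching_subset_closure hp.2, fun h => ?_⟩
  have : ((a + 1, 0) : Pt) ∈ loop a β :=
    (h (subset_closure (Or.inl (mem_escaping_loop (by linarith))))).1
  have h1 := (abs_le.1 this.1).2
  simp only at h1
  linarith

lemma separatrixGraph_eq_loop (hβ : 0 < β) : separatrixGraph β = loop β β := by
  ext ⟨x, y⟩
  simp only [separatrixGraph, loop, mem_union, segment, mem_ofPred_eq, Prod.smul_mk, Prod.mk_add_mk,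
    Prod.mk.injEq, smul_eq_mul, add_sub_cancel_right, Real.sqrt_sq_eq_abs]
  constructor
  · rintro ((⟨s, t, hs, ht, h, rfl, rfl⟩ | ⟨s, t, hs, ht, h, rfl, rfl⟩) |
      ⟨s, t, hs, ht, h, rfl, rfl⟩)
    · exact ⟨by rw [abs_le]; constructor <;> nlinarith, Or.inl (by ring)⟩
    · rw [abs_of_nonneg (by nlinarith)]
      exact ⟨by nlinarith, Or.inr (by linear_combination (-β) * h)⟩
    · rw [abs_of_nonpos (by nlinarith)]
      exact ⟨by nlinarith, Or.inr (by linear_combination (-β) * h)⟩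
  · rintro ⟨hx, rfl | rfl⟩
    · obtain ⟨h1, h2⟩ := abs_le.1 hx
      refine Or.inl (Or.inl ⟨(β - x) / (2 * β), (β + x) / (2 * β), div_nonneg (by linarith)
        (by linarith), div_nonneg (by linarith) (by linarith), ?_, ?_, ?_⟩) <;> field_simp <;> ring
    · rcases le_total 0 x with h | h
      · rw [abs_of_nonneg h] at hx ⊢
        refine Or.inl (Or.inr ⟨x / β, (β - x) / β, div_nonneg h hβ.le, div_nonneg (by linarith)
          hβ.le, ?_, ?_, ?_⟩) <;> field_simp <;> ring
      · rw [abs_of_nonpos h] at hx ⊢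
        refine Or.inr ⟨(β + x) / β, -x / β, div_nonneg (by linarith) hβ.le,
          div_nonneg (by linarith) hβ.le, ?_, ?_, ?_⟩ <;> field_simp <;> ring

lemma loop_ne_separatrixGraph (ha : 0 ≤ a) (haβ : a < β) : loop a β ≠ separatrixGraph β := by
  rw [separatrixGraph_eq_loop (ha.trans_lt haβ)]
  intro h
  have h1 : ((β, 0) : Pt) ∈ loop a β := by
    rw [h]
    exact ⟨(abs_of_pos (ha.trans_lt haβ)).le, Or.inl rfl⟩
  exact haβ.not_ge ((le_abs_self β).trans h1.1)

/-- The orbit of `Y` through `Q` meets `Σ` where `x ^ 2` equals `intY β Q`, so `a` is the root of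
that value. Being inside the triangle means that this level lies strictly between `0` and `β ^ 2`.
-/
lemma exists_loop_of_mem_interior {Q : Pt} (hβ : 0 < β) (hQ : Q ∈ separatrixInterior β) :
    ∃ a, 0 < a ∧ a < β ∧ Q ∈ loop a β := by
  obtain ⟨h1, h2⟩ := hQ
  have h3 : Q.1 ^ 2 < (Q.2 + β) ^ 2 := sq_lt_sq.2 (h2.trans_le (le_abs_self _))
  have h4 : 0 < Q.2 + β := (abs_nonneg _).trans_lt h2
  have h5 : (Q.2 + β) ^ 2 < β ^ 2 := by nlinarith
  have h6 : 0 < Q.1 ^ 2 - (Q.2 + β) ^ 2 + β ^ 2 := by nlinarith [sq_nonneg Q.1]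
  refine ⟨√(Q.1 ^ 2 - (Q.2 + β) ^ 2 + β ^ 2), Real.sqrt_pos.2 h6, ?_, ?_, Or.inr ?_⟩
  · rw [Real.sqrt_lt' hβ]; linarith
  · exact Real.abs_le_sqrt (by linarith)
  · rw [Real.sq_sqrt h6.le, show Q.1 ^ 2 + β ^ 2 - (Q.1 ^ 2 - (Q.2 + β) ^ 2 + β ^ 2) =
      (Q.2 + β) ^ 2 by ring, Real.sqrt_sq h4.le]
    ring

end loop

end FoldSaddle

namespace FoldSaddle

/-! ### The cells of the bifurcation diagram -/

/-- The signs that determine the cell of a parameter `(λ, β)`. -/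
noncomputable def signs (p : ℝ × ℝ) : SignType × SignType × SignType :=
  (SignType.sign p.2, SignType.sign p.1,
    if 0 < p.2 ∧ p.1 ≠ 0 then SignType.sign (|p.1| - p.2) else 0)

/-- The values of `signs` on the cells. -/
def cellSigns : Fin 13 → SignType × SignType × SignType :=
  ![(-1, -1, 0), (-1, 0, 0), (-1, 1, 0), (0, -1, 0), (0, 0, 0), (0, 1, 0), (1, -1, 1), (1, -1, 0),
    (1, -1, -1), (1, 0, 0), (1, 1, -1), (1, 1, 0), (1, 1, 1)]

lemma cellSigns_injective : Function.Injective cellSigns := by decide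

lemma signs_eq {p : ℝ × ℝ} {a b c : SignType} (h1 : SignType.sign p.2 = a)
    (h2 : SignType.sign p.1 = b)
    (h3 : (0 < p.2 ∧ p.1 ≠ 0 → SignType.sign (|p.1| - p.2) = c) ∧ (¬(0 < p.2 ∧ p.1 ≠ 0) → 0 = c)) :
    signs p = (a, b, c) := by
  rw [signs, h1, h2]
  split_ifs with h
  · rw [h3.1 h]
  · rw [h3.2 h]

lemma signs_of_mem {p : ℝ × ℝ} {k : Fin 13} (h : p ∈ cell k) : signs p = cellSigns k := by
  obtain ⟨l, β⟩ := p
  fin_cases k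
  · obtain ⟨h1, h2⟩ : β < 0 ∧ l < 0 := h
    exact signs_eq (sign_neg h1) (sign_neg h2) ⟨fun h => absurd h.1 h1.not_gt, fun _ => rfl⟩
  · obtain ⟨h1, h2⟩ : β < 0 ∧ l = 0 := h
    exact signs_eq (sign_neg h1) (by simp [h2]) ⟨fun h => absurd h.1 h1.not_gt, fun _ => rfl⟩
  · obtain ⟨h1, h2⟩ : β < 0 ∧ 0 < l := h
    exact signs_eq (sign_neg h1) (sign_pos h2) ⟨fun h => absurd h.1 h1.not_gt, fun _ => rfl⟩
  · obtain ⟨h1, h2⟩ : β = 0 ∧ l < 0 := h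
    exact signs_eq (by simp [h1]) (sign_neg h2) ⟨fun h => absurd h1 h.1.ne', fun _ => rfl⟩
  · obtain ⟨h1, h2⟩ : β = 0 ∧ l = 0 := h
    exact signs_eq (by simp [h1]) (by simp [h2]) ⟨fun h => absurd h1 h.1.ne', fun _ => rfl⟩
  · obtain ⟨h1, h2⟩ : β = 0 ∧ 0 < l := h
    exact signs_eq (by simp [h1]) (sign_pos h2) ⟨fun h => absurd h1 h.1.ne', fun _ => rfl⟩
  · obtain ⟨h1, h2⟩ : 0 < β ∧ l < -β := h
    have h3 : l < 0 := by linarith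
    exact signs_eq (sign_pos h1) (sign_neg h3)
      ⟨fun _ => sign_pos (by rw [abs_of_neg h3]; linarith), fun h => absurd ⟨h1, h3.ne⟩ h⟩
  · obtain ⟨h1, h2⟩ : 0 < β ∧ l = -β := h
    have h3 : l < 0 := by linarith
    exact signs_eq (sign_pos h1) (sign_neg h3)
      ⟨fun _ => sign_eq_zero_iff.2 (by simp only; rw [abs_of_neg h3]; linarith),
        fun h => absurd ⟨h1, h3.ne⟩ h⟩
  · obtain ⟨h1, h2, h3⟩ : 0 < β ∧ -β < l ∧ l < 0 := h
    exact signs_eq (sign_pos h1) (sign_neg h3)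
      ⟨fun _ => sign_neg (by rw [abs_of_neg h3]; linarith), fun h => absurd ⟨h1, h3.ne⟩ h⟩
  · obtain ⟨h1, h2⟩ : 0 < β ∧ l = 0 := h
    exact signs_eq (sign_pos h1) (by simp [h2]) ⟨fun h => absurd h2 h.2, fun _ => rfl⟩
  · obtain ⟨h1, h3, h2⟩ : 0 < β ∧ 0 < l ∧ l < β := h
    exact signs_eq (sign_pos h1) (sign_pos h3)
      ⟨fun _ => sign_neg (by rw [abs_of_pos h3]; linarith), fun h => absurd ⟨h1, h3.ne'⟩ h⟩
  · obtain ⟨h1, h2⟩ : 0 < β ∧ l = β := h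
    have h3 : 0 < l := by linarith
    exact signs_eq (sign_pos h1) (sign_pos h3)
      ⟨fun _ => sign_eq_zero_iff.2 (by simp only; rw [abs_of_pos h3]; linarith),
        fun h => absurd ⟨h1, h3.ne'⟩ h⟩
  · obtain ⟨h1, h2⟩ : 0 < β ∧ β < l := h
    have h3 : 0 < l := by linarith
    exact signs_eq (sign_pos h1) (sign_pos h3)
      ⟨fun _ => sign_pos (by rw [abs_of_pos h3]; linarith), fun h => absurd ⟨h1, h3.ne'⟩ h⟩

lemma exists_mem_cell (p : ℝ × ℝ) : ∃ k, p ∈ cell k := by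
  rcases lt_trichotomy p.2 0 with h1 | h1 | h1
  · rcases lt_trichotomy p.1 0 with h2 | h2 | h2
    · exact ⟨0, h1, h2⟩
    · exact ⟨1, h1, h2⟩
    · exact ⟨2, h1, h2⟩
  · rcases lt_trichotomy p.1 0 with h2 | h2 | h2
    · exact ⟨3, h1, h2⟩
    · exact ⟨4, h1, h2⟩
    · exact ⟨5, h1, h2⟩
  · rcases lt_trichotomy p.1 0 with h2 | h2 | h2
    · rcases lt_trichotomy p.1 (-p.2) with h3 | h3 | h3
      · exact ⟨6, h1, h3⟩
      · exact ⟨7, h1, h3⟩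
      · exact ⟨8, h1, h3, h2⟩
    · exact ⟨9, h1, h2⟩
    · rcases lt_trichotomy p.1 p.2 with h3 | h3 | h3
      · exact ⟨10, h1, h2, h3⟩
      · exact ⟨11, h1, h3⟩
      · exact ⟨12, h1, h3⟩

lemma existsUnique_mem_cell (p : ℝ × ℝ) : ∃! k, p ∈ cell k := by
  obtain ⟨k, hk⟩ := exists_mem_cell p
  exact ⟨k, hk, fun j hj => cellSigns_injective ((signs_of_mem hj).symm.trans (signs_of_mem hk))⟩

lemma cell_inter_square_nonempty {ε : ℝ} (hε : 0 < ε) (k : Fin 13) :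
    (cell k ∩ square ε).Nonempty := by
  have H : ∀ {x y : ℝ}, |x| < ε → |y| < ε → ((x, y) : ℝ × ℝ) ∈ square ε := fun hx hy =>
    ⟨abs_lt.1 hx, abs_lt.1 hy⟩
  have a0 : |(0 : ℝ)| < ε := by simpa
  have a1 : |ε / 2| < ε := by rw [abs_of_pos (by linarith)]; linarith
  have a2 : |-(ε / 2)| < ε := by rwa [abs_neg]
  have a3 : |ε / 4| < ε := by rw [abs_of_pos (by linarith)]; linarith
  have a4 : |-(ε / 4)| < ε := by rwa [abs_neg]
  have n1 : -(ε / 2) < 0 := by linarith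
  have n2 : 0 < ε / 2 := by linarith
  have n3 : 0 < ε / 4 := by linarith
  have n4 : ε / 4 < ε / 2 := by linarith
  fin_cases k
  · exact ⟨(-(ε / 2), -(ε / 2)), ⟨n1, n1⟩, H a2 a2⟩
  · exact ⟨(0, -(ε / 2)), ⟨n1, rfl⟩, H a0 a2⟩
  · exact ⟨(ε / 2, -(ε / 2)), ⟨n1, n2⟩, H a1 a2⟩
  · exact ⟨(-(ε / 2), 0), ⟨rfl, n1⟩, H a2 a0⟩
  · exact ⟨(0, 0), ⟨rfl, rfl⟩, H a0 a0⟩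
  · exact ⟨(ε / 2, 0), ⟨rfl, n2⟩, H a1 a0⟩
  · exact ⟨(-(ε / 2), ε / 4), ⟨n3, neg_lt_neg n4⟩, H a2 a3⟩
  · exact ⟨(-(ε / 2), ε / 2), ⟨n2, rfl⟩, H a2 a1⟩
  · exact ⟨(-(ε / 4), ε / 2), ⟨n2, neg_lt_neg n4, neg_lt_zero.2 n3⟩, H a4 a1⟩
  · exact ⟨(0, ε / 2), ⟨n2, rfl⟩, H a0 a1⟩
  · exact ⟨(ε / 4, ε / 2), ⟨n2, n3, n4⟩, H a3 a1⟩
  · exact ⟨(ε / 2, ε / 2), ⟨n2, rfl⟩, H a1 a1⟩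
  · exact ⟨(ε / 2, ε / 4), ⟨n3, n4⟩, H a1 a3⟩

lemma sign_eq_sign_iff {a b : ℝ} : SignType.sign a = SignType.sign b ↔ SameSign a b := by
  constructor
  · intro h
    refine ⟨?_, ?_⟩
    · rw [← sign_eq_one_iff, h, sign_eq_one_iff]
    · rw [← sign_eq_neg_one_iff, h, sign_eq_neg_one_iff]
  · rintro ⟨h1, h2⟩
    rcases lt_trichotomy a 0 with h | h | h
    · rw [sign_neg h, sign_neg (h2.1 h)]
    · have : b = 0 := le_antisymm (not_lt.1 fun h' => (h1.2 h').ne' h)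
        (not_lt.1 fun h' => (h2.2 h').ne h)
      rw [h, this]
    · rw [sign_pos h, sign_pos (h1.1 h)]

lemma SameSign.eq_zero_iff {a b : ℝ} (h : SameSign a b) : a = 0 ↔ b = 0 := by
  rw [← sign_eq_zero_iff, sign_eq_sign_iff.2 h, sign_eq_zero_iff]

lemma SameSign.cases {a b : ℝ} (h : SameSign a b) :
    (a < 0 ∧ b < 0) ∨ (a = 0 ∧ b = 0) ∨ (0 < a ∧ 0 < b) := by
  rcases lt_trichotomy a 0 with h' | h' | h'
  · exact Or.inl ⟨h', h.2.1 h'⟩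
  · exact Or.inr (Or.inl ⟨h', h.eq_zero_iff.1 h'⟩)
  · exact Or.inr (Or.inr ⟨h', h.1.1 h'⟩)

lemma sameOrder_iff {l β l' β' : ℝ} :
    SameOrder l β l' β' ↔ SignType.sign (|l| - β) = SignType.sign (|l'| - β') := by
  rw [sign_eq_sign_iff, SameSign, SameOrder, sub_pos, sub_pos, sub_neg, sub_neg]
  grind

/-- Cells are encoded by sign triples, so equality of cells becomes equality of signs, the form in
which the invariants are available. -/
lemma same_cell_iff {l β l' β' : ℝ} {j k : Fin 13} (hp : (l, β) ∈ cell j) (hq : (l', β') ∈ cell k) :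
    j = k ↔ SameSign β β' ∧ SameSign l l' ∧ (0 < β → l ≠ 0 → SameOrder l β l' β') := by
  rw [← cellSigns_injective.eq_iff, ← signs_of_mem hp, ← signs_of_mem hq, signs, signs,
    Prod.ext_iff, Prod.ext_iff]
  simp only [sign_eq_sign_iff (a := β), sign_eq_sign_iff (a := l), sameOrder_iff]
  refine and_congr_right fun h1 => and_congr_right fun h2 => ?_
  have hc : (0 < β' ∧ l' ≠ 0) ↔ (0 < β ∧ l ≠ 0) :=
    and_congr h1.1.symm (not_congr h2.eq_zero_iff.symm)
  simp only [hc]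
  split_ifs with h
  · exact ⟨fun e _ _ => e, fun e => e h.1 h.2⟩
  · exact ⟨fun _ h3 h4 => absurd ⟨h3, h4⟩ h, fun _ => rfl⟩

/-- The signs that determine the topological behaviour. -/
def coarse (s : SignType × SignType × SignType) : SignType × SignType :=
  (s.1, if s.1 = 1 then s.2.1 else s.2.1 * s.2.1)

/-- The square of a sign only records whether it vanishes: for `β ≤ 0` the sign of `λ` is forgotten,
for `β > 0` its comparison with `β` is. -/
lemma behaviour_eq_iff_coarse :
    ∀ j k, behaviour j = behaviour k ↔ coarse (cellSigns j) = coarse (cellSigns k) := by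
  decide

lemma sign_mul_self_eq_iff {a b : ℝ} : SignType.sign a * SignType.sign a =
    SignType.sign b * SignType.sign b ↔ (a = 0 ↔ b = 0) := by
  rw [← sign_eq_zero_iff (a := a), ← sign_eq_zero_iff (a := b)]
  generalize SignType.sign a = s
  generalize SignType.sign b = t
  revert s t
  decide

lemma same_behaviour_iff {l β l' β' : ℝ} {j k : Fin 13} (hp : (l, β) ∈ cell j)
    (hq : (l', β') ∈ cell k) : behaviour j = behaviour k ↔
      SameSign β β' ∧ (l = 0 ↔ l' = 0) ∧ (0 < β → SameSign l l') := by
  rw [behaviour_eq_iff_coarse, ← signs_of_mem hp, ← signs_of_mem hq, coarse, coarse, Prod.ext_iff]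
  simp only [signs, sign_eq_sign_iff (a := β)]
  refine and_congr_right fun h1 => ?_
  simp only [sign_eq_one_iff, ← h1.1]
  split_ifs with h
  · rw [sign_eq_sign_iff]
    exact ⟨fun e => ⟨e.eq_zero_iff, fun _ => e⟩, fun e => e.2 h⟩
  · rw [sign_mul_self_eq_iff]
    exact ⟨fun e => ⟨e, fun h' => absurd h' h⟩, fun e => e.1⟩

/-! ### Classification -/

/-- Necessity comes from the invariants, sufficiency from the constructed homeomorphisms.
`topEquivalent_iff` and `sameBehaviour_iff` follow the same pattern. -/
lemma sameConfiguration_iff {l β l' β' : ℝ} (h1 : β < 1) (h1' : β' < 1) :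
    SameConfiguration (Zv (l, β)) (Zv (l', β')) ↔
      SameSign β β' ∧ SameSign l l' ∧ (0 < β → l ≠ 0 → SameOrder l β l' β') := by
  constructor
  · rintro ⟨⟨h, hX, hY⟩, -⟩
    exact ⟨hY.sameSign, sameSign_fold hX hY, fun hβ hl =>
      sameOrder_of_carries hX hY hβ (hY.sameSign.1.1 hβ) hl⟩
  · rintro ⟨hβ, hl, ho⟩
    rcases hβ.cases with h | h | h
    · exact (topEquivalent_of_nonpos (Or.inl h) hl).sameConfiguration
    · exact (topEquivalent_of_nonpos (Or.inr h) hl).sameConfiguration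
    · by_cases h0 : l = 0
      · rw [h0, hl.eq_zero_iff.1 h0]
        exact (topEquivalent_of_zero h.1 h.2 h1 h1').sameConfiguration
      · exact sameConfiguration_of_pos h.1 h.2 h1 h1' h0 (mt hl.eq_zero_iff.2 h0) hl (ho h.1 h0)

lemma topEquivalent_iff {l β l' β' : ℝ} (h1 : β < 1 / 2) (h1' : β' < 1 / 2) (h2 : |l| < 1 / 2)
    (h2' : |l'| < 1 / 2) : TopEquivalent (Zv (l, β)) (Zv (l', β')) ↔
      SameSign β β' ∧ SameSign l l' ∧ (0 < β → l ≠ 0 → SameOrder l β l' β') := by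
  constructor
  · intro h
    exact (sameConfiguration_iff (by linarith) (by linarith)).1 h.sameConfiguration
  · rintro ⟨hβ, hl, ho⟩
    rcases hβ.cases with h | h | h
    · exact topEquivalent_of_nonpos (Or.inl h) hl
    · exact topEquivalent_of_nonpos (Or.inr h) hl
    · by_cases h0 : l = 0
      · rw [h0, hl.eq_zero_iff.1 h0]
        exact topEquivalent_of_zero h.1 h.2 (by linarith) (by linarith)
      · exact topEquivalent_of_pos h.1 h.2 h1 h1' h2 h2' h0 (mt hl.eq_zero_iff.2 h0) hl (ho h.1 h0)

lemma sameBehaviour_iff {l β l' β' : ℝ} (h1 : β < 1) (h1' : β' < 1) :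
    SameBehaviour (Zv (l, β)) (Zv (l', β')) ↔
      SameSign β β' ∧ (l = 0 ↔ l' = 0) ∧ (0 < β → SameSign l l') := by
  constructor
  · rintro ⟨-, ⟨h, hY⟩, ⟨g, hS⟩⟩
    exact ⟨hY.sameSign, hS.zero_iff, fun hβ => hS.sameSign hβ h1 (hY.sameSign.1.1 hβ) h1'⟩
  · rintro ⟨hβ, h0, hl⟩
    refine ⟨exists_carriesUpper _ _ _ _, exists_carriesLower _ _ hβ.cases, ?_⟩
    by_cases hz : l = 0
    · rw [hz, h0.1 hz]
      exact exists_carriesSliding_of_zero h1 h1'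
    · rcases le_or_gt β 0 with h | h
      · exact exists_carriesSliding_of_nonpos h (hβ.nonpos.1 h) hz (mt h0.2 hz)
      · exact exists_carriesSliding_of_pos h (hβ.1.1 h) h1 h1' hz (hl h)

/-- On `A` the relation says that the cells have equal images under `f`. Every cell meets `A` and
`f` is onto, so the classes correspond to the values of `f`. -/
lemma ncard_classes {n : ℕ} {R : NSField → NSField → Prop} {A : Set (ℝ × ℝ)} {f : Fin 13 → Fin n}
    (hf : Function.Surjective f)
    (hR : ∀ p ∈ A, ∀ q ∈ A, ∀ k l, p ∈ cell k → q ∈ cell l → (R (Zv p) (Zv q) ↔ f k = f l))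
    (hA : ∀ k, (cell k ∩ A).Nonempty) : (classes R A).ncard = n := by
  let g : Fin n → Set (ℝ × ℝ) := fun j => {q | q ∈ A ∧ ∃ k, q ∈ cell k ∧ f k = j}
  have hg : ∀ {p k}, p ∈ A → p ∈ cell k → {q | q ∈ A ∧ R (Zv p) (Zv q)} = g (f k) := by
    intro p k hp hk
    ext q
    refine and_congr_right fun hq => ?_
    obtain ⟨j, hj⟩ := exists_mem_cell q
    rw [hR p hp q hq k j hk hj]
    constructor
    · exact fun e => ⟨j, hj, e.symm⟩
    · rintro ⟨i, hi, e⟩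
      rw [← e, (existsUnique_mem_cell q).unique hi hj]
  have hinj : Function.Injective g := by
    intro i j hij
    obtain ⟨k, rfl⟩ := hf i
    obtain ⟨p, hk, hp⟩ := hA k
    have : p ∈ g j := hij ▸ ⟨hp, k, hk, rfl⟩
    obtain ⟨-, k', hk', rfl⟩ := this
    rw [(existsUnique_mem_cell p).unique hk hk']
  have hcl : classes R A = g '' univ := by
    ext C
    constructor
    · rintro ⟨p, hp, rfl⟩
      obtain ⟨k, hk⟩ := exists_mem_cell p
      exact ⟨f k, mem_univ _, (hg hp hk).symm⟩
    · rintro ⟨j, -, rfl⟩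
      obtain ⟨k, rfl⟩ := hf j
      obtain ⟨p, hk, hp⟩ := hA k
      exact ⟨p, hp, (hg hp hk).symm⟩
  rw [hcl, ncard_image_of_injective _ hinj, ncard_univ, Nat.card_fin]

lemma family_visible_eq_unfolding (l β : ℝ) :
    family .visible l β = unfolding .visible l 0 β := by
  refine NSField.ext rfl (funext fun p => Prod.ext ?_ ?_)
  · change -(p.2 + β) = 0 / 2 * p.1 + (0 - 2) / 2 * (p.2 + β)
    ring
  · change -p.1 = (0 - 2) / 2 * p.1 + 0 / 2 * (p.2 + β)
    ring

lemma square_mono {ε δ : ℝ} (h : ε ≤ δ) : square ε ⊆ square δ :=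
  prod_mono (Ioo_subset_Ioo (neg_le_neg h) h) (Ioo_subset_Ioo (neg_le_neg h) h)

lemma sameConfiguration_iff_cell {p q : ℝ × ℝ} (hp : p ∈ square 1) (hq : q ∈ square 1)
    {j k : Fin 13} (hj : p ∈ cell j) (hk : q ∈ cell k) :
    SameConfiguration (Zv p) (Zv q) ↔ j = k :=
  (sameConfiguration_iff hp.2.2 hq.2.2).trans (same_cell_iff hj hk).symm

lemma topEquivalent_iff_cell {p q : ℝ × ℝ} (hp : p ∈ square (1 / 2)) (hq : q ∈ square (1 / 2))
    {j k : Fin 13} (hj : p ∈ cell j) (hk : q ∈ cell k) : TopEquivalent (Zv p) (Zv q) ↔ j = k :=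
  (topEquivalent_iff hp.2.2 hq.2.2 (abs_lt.2 hp.1) (abs_lt.2 hq.1)).trans (same_cell_iff hj hk).symm

lemma sameBehaviour_iff_cell {p q : ℝ × ℝ} (hp : p ∈ square 1) (hq : q ∈ square 1)
    {j k : Fin 13} (hj : p ∈ cell j) (hk : q ∈ cell k) :
    SameBehaviour (Zv p) (Zv q) ↔ behaviour j = behaviour k :=
  (sameBehaviour_iff hp.2.2 hq.2.2).trans (same_behaviour_iff hj hk).symm

end FoldSaddle

/-! ### The main theorem -/

theorem theorem4 :
    -- the two-parameter family is the slice `μ = 0` of the three-parameter family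
    (∀ l β : ℝ, family .visible l β = unfolding .visible l 0 β) ∧
    -- the bifurcation diagram: thirteen cells, all adherent to the origin
    (∀ p : ℝ × ℝ, ∃! k, p ∈ cell k) ∧
    (∀ ε > 0, ∀ k, (cell k ∩ square ε).Nonempty) ∧
    -- thirteen typical configurations, one for each cell
    (∀ p ∈ square 1, ∀ q ∈ square 1, ∀ k l, p ∈ cell k → q ∈ cell l →
      (SameConfiguration (Zv p) (Zv q) ↔ k = l)) ∧
    (classes SameConfiguration (square 1)).ncard = 13 ∧
    -- for small parameters, they are the classes of topological equivalence
    (∀ p ∈ square (1 / 2), ∀ q ∈ square (1 / 2), ∀ k l, p ∈ cell k → q ∈ cell l →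
      (TopEquivalent (Zv p) (Zv q) ↔ k = l)) ∧
    (∀ ε, 0 < ε → ε ≤ 1 / 2 → (classes TopEquivalent (square ε)).ncard = 13) ∧
    -- seven topological behaviours
    (∀ p ∈ square 1, ∀ q ∈ square 1, ∀ k l, p ∈ cell k → q ∈ cell l →
      (SameBehaviour (Zv p) (Zv q) ↔ behaviour k = behaviour l)) ∧
    (classes SameBehaviour (square 1)).ncard = 7 ∧
    -- description of the configurations
    (∀ l β : ℝ, (l, β) ∈ square 1 →
      -- fold points of `X` and `Y`
      ({q | IsFold (Zv (l, β)).X q} = {(l, 0)} ∧ IsVisibleFoldUpper (Zv (l, β)).X (l, 0)) ∧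
      (β < 0 → {q | IsFold (Zv (l, β)).Y q} = {(0, 0)} ∧
        IsVisibleFoldLower (Zv (l, β)).Y (0, 0)) ∧
      (β = 0 → {q | IsFold (Zv (l, β)).Y q} = ∅ ∧ (Zv (l, β)).Y (0, 0) = 0) ∧
      (0 < β → {q | IsFold (Zv (l, β)).Y q} = {(0, 0)} ∧
        ¬ IsVisibleFoldLower (Zv (l, β)).Y (0, 0)) ∧
      -- the regions of `Σ`
      (Zv (l, β)).sewing = {q | q.2 = 0 ∧ min l 0 < q.1 ∧ q.1 < max l 0} ∧
      (Zv (l, β)).sliding = {q | q.2 = 0 ∧ q.1 < min l 0} ∧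
      (Zv (l, β)).escaping = {q | q.2 = 0 ∧ max l 0 < q.1} ∧
      -- the direction of `Z^Σ`
      (β ≤ 0 → ∀ q ∈ (Zv (l, β)).slidingDomain, 0 < ((Zv (l, β)).slide q).1) ∧
      (l = 0 → ∀ q ∈ (Zv (l, β)).slidingDomain, (Zv (l, β)).slide q = ((1 - β) / 2, 0)) ∧
      (0 < β → l < 0 → (∀ q ∈ (Zv (l, β)).sliding, 0 < ((Zv (l, β)).slide q).1) ∧
        ∀ᶠ q in 𝓝[(Zv (l, β)).escaping] (0, 0), ((Zv (l, β)).slide q).1 < 0) ∧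
      (0 < β → 0 < l → (∀ q ∈ (Zv (l, β)).escaping, 0 < ((Zv (l, β)).slide q).1) ∧
        ∀ᶠ q in 𝓝[(Zv (l, β)).sliding] (0, 0), ((Zv (l, β)).slide q).1 < 0) ∧
      -- there are no canard cycles
      (∀ Γ, ¬ IsCanardCycle (Zv (l, β)) Γ) ∧
      -- pseudo-equilibria
      (β ≤ 0 ∨ l = 0 → {q | (Zv (l, β)).IsPseudoEquilibrium q} = ∅) ∧
      (0 < β → l ≠ 0 →
        {q | (Zv (l, β)).IsPseudoEquilibrium q} = {(β * l / (-1 + β), 0)}) ∧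
      (0 < β → l < 0 → IsSigmaRepeller (Zv (l, β)) (β * l / (-1 + β), 0)) ∧
      (0 < β → 0 < l → IsSigmaAttractor (Zv (l, β)) (β * l / (-1 + β), 0)) ∧
      -- `Σ`-graphs of kind III when `d = i`
      (0 < β → l = 0 →
        (Zv (l, β)).IsTangential (0, 0) ∧
        IsSigmaGraphIII (Zv (l, β)) (separatrixGraph β) ∧
        ∀ Q ∈ separatrixInterior β, ∃ Δ, Δ ≠ separatrixGraph β ∧ Q ∈ Δ ∧ (0, 0) ∈ Δ ∧
          IsSigmaGraphIII (Zv (l, β)) Δ)) := by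
  refine ⟨family_visible_eq_unfolding, existsUnique_mem_cell,
    fun ε hε k => cell_inter_square_nonempty hε k,
    fun p hp q hq k l hk hl => sameConfiguration_iff_cell hp hq hk hl,
    ncard_classes Function.surjective_id
      (fun p hp q hq k l hk hl => sameConfiguration_iff_cell hp hq hk hl)
      (cell_inter_square_nonempty one_pos),
    fun p hp q hq k l hk hl => topEquivalent_iff_cell hp hq hk hl,
    fun ε hε h => ncard_classes Function.surjective_id
      (fun p hp q hq k l hk hl =>
        topEquivalent_iff_cell (square_mono h hp) (square_mono h hq) hk hl)
      (cell_inter_square_nonempty hε),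
    fun p hp q hq k l hk hl => sameBehaviour_iff_cell hp hq hk hl,
    ncard_classes (f := behaviour) (by decide)
      (fun p hp q hq k l hk hl => sameBehaviour_iff_cell hp hq hk hl)
      (cell_inter_square_nonempty one_pos), ?_⟩
  rintro l β ⟨-, -, h1⟩
  refine ⟨⟨Set.ext fun q => isFold_X_iff, isVisibleFoldUpper_X l β⟩, fun hβ => ⟨?_, ?_⟩,
    fun hβ => ⟨?_, ?_⟩, fun hβ => ⟨?_, ?_⟩, Set.ext fun q => mem_sewing,
    Set.ext fun q => mem_sliding, Set.ext fun q => mem_escaping,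
    fun hβ q hq => slide_fst_pos_of_nonpos hβ hq, ?_,
    fun hβ hl => ⟨fun q hq => slide_fst_pos_sliding hβ h1 hl hq, slide_fst_neg_escaping hβ h1 hl⟩,
    fun hβ hl => ⟨fun q hq => slide_fst_pos_escaping hβ h1 hl hq, slide_fst_neg_sliding hβ h1 hl⟩,
    no_canardCycle h1, pseudoEquilibria_empty h1, fun hβ hl => pseudoEquilibria_eq hβ h1 hl,
    fun hβ hl => isSigmaRepeller_pseudo hβ h1 hl, fun hβ hl => isSigmaAttractor_pseudo hβ h1 hl, ?_⟩
  · exact Set.ext fun q => isFold_Y_iff.trans (and_iff_left hβ.ne)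
  · exact (isVisibleFoldLower_Y_iff l β).2 hβ
  · exact eq_empty_iff_forall_notMem.2 fun q hq => (isFold_Y_iff.1 hq).2 hβ
  · rw [Zv_Y, hβ]
    simp
  · exact Set.ext fun q => isFold_Y_iff.trans (and_iff_left hβ.ne')
  · exact fun h => hβ.not_gt ((isVisibleFoldLower_Y_iff l β).1 h)
  · rintro rfl q hq
    exact slide_eq_of_zero h1 hq
  · rintro hβ rfl
    refine ⟨isTangential_zero hβ.ne', ?_, fun Q hQ => ?_⟩
    · rw [separatrixGraph_eq_loop hβ]
      exact isSigmaGraphIII_loop hβ le_rfl h1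
    · obtain ⟨a, ha, haβ, hQa⟩ := exists_loop_of_mem_interior hβ hQ
      exact ⟨loop a β, loop_ne_separatrixGraph ha.le haβ, hQa, zero_mem_loop ha.le,
        isSigmaGraphIII_loop ha haβ.le h1⟩
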